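/- **Setting.** Let $B$ be a compact smooth ($C^\infty$) Hausdorff manifold without boundary, whose connected components may have different dimensions, and let $p:E\to B$ be a $C^\infty$ real vector bundle of finite rank, where the rank may depend on the connected component of $B$. Assume $E$ carries an orthogonal structure, i.e. a cover by smooth local trivializations, linear on fibres, whose transition functions take values in the orthogonal groups, and let $\|\cdot\|:E\to[0,\infty)$ be the corresponding fibrewise Euclidean norm. Identify $B$ with the zero section and put $R_\varepsilon=\{x\in E : \|x\|\le\varepsilon\}$. Let $N\subset E$ be a smooth submanifold of codimension $0$ (possibly with boundary, not necessarily compact) that is a neighbourhood of $B$. Let $\mathcal E(N,E)$ be the set of smooth embeddings $h:N\to E$ with $h(B)\subset B$, endowed with the weak Whitney topology $W^\infty$ (uniform convergence of all derivatives, in charts, on compact subsets of $N$). Each such $h$ induces a vector bundle morphism $T^{\mathrm{fib}}h:E\to E$ over $h|_B$: a vector $v\in E_b$, regarded as a vertical tangent vector at $0_b$, is sent to the vertical component (along $TB$) of its image under the tangent map of $h$; equivalently $T^{\mathrm{fib}}h(v)=\lim_{t\to0}\frac1t h(tv)$. Fix constants $0<a<b$ and a $C^\infty$ function $\mu:\mathbb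 R\to[0,1]$ with $\mu=0$ on $[0,a]$ and $\mu=1$ on $[b,\infty)$. **Theorem (Linearization theorem).** There exists a strictly positive $W^\infty$-continuous function $\delta:\mathcal E(N,E)\to(0,\infty)$ such that, with $$\phi(h,t,x)=t+(1-t)\,\mu\!\left(\frac{\|x\|}{\delta(h)}\right),\qquad H(h,t)(x)=\frac{h\bigl(\phi(h,t,x)\,x\bigr)}{\phi(h,t,x)},$$ for all $h\in\mathcal E(N,E)$, $t\in(0,1]$ and $x\in N$ the point $\phi(h,t,x)x$ lies in $N$, the map $H(h,t):N\to E$ belongs to $\mathcal E(N,E)$, and $H$ extends to a $W^\infty$-continuous map $H:\mathcal E(N,E)\times[0,1]\to\mathcal E(N,E)$ such that for all $h\in\mathcal E(N,E)$: 0. $H(h,t)(x)=h(x)$ for all $t\in[0,1]$ and all $x\in N$ with $\|x\|\ge b\,\delta(h)$; 1. $R_{\delta(h)}\subset N$ and $H(h,t)(R_{\delta(h)})\subset N$ for all $t\in[0,1]$; 2. $R_{a\delta(h)}\subset N$ and $H(h,0)$ coincides with $T^{\mathrm{fib}}h$ on $R_{a\delta(h)}$. -/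

import Mathlib

open Bundle Manifold Topology Set
open scoped ContDiff

noncomputable section

namespace LinEmb

/-- Euclidean space of dimension `n`. -/
abbrev Euc (n : ℕ) := EuclideanSpace ℝ (Fin n)

/-- The model of the total space of a rank `m` vector bundle over a `k`-manifold without boundary:
its charts take values in `ℝᵏ × ℝᵐ`. -/
abbrev totModel (k m : ℕ) := (𝓡 k).prod 𝓘(ℝ, Euc m)

section Orthogonal

variable (k m : ℕ) {B : Type*} [TopologicalSpace B] [ChartedSpace (Euc k) B]
  (V : B → Type*) [∀ b, AddCommGroup (V b)] [∀ b, Module ℝ (V b)] [∀ b, TopologicalSpace (V b)]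
  [TopologicalSpace (TotalSpace (Euc m) V)] [FiberBundle (Euc m) V] [VectorBundle ℝ (Euc m) V]

/-- An orthogonal structure on a smooth vector bundle: a family of smooth local trivializations,
linear on fibres, that cover the base and whose transition maps take values in `O(m)`. -/
structure OrthogonalStructure where
  charts : Set (Trivialization (Euc m) (π (Euc m) V))
  linear : ∀ e ∈ charts, e.IsLinear ℝ
  smooth : ∀ e ∈ charts, ContMDiffOn (totModel k m) (totModel k m) ∞ e e.source
  smooth_symm : ∀ e ∈ charts,
    ContMDiffOn (totModel k m) (totModel k m) ∞ e.toOpenPartialHomeomorph.symm e.target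
  cover : ∀ b : B, ∃ e ∈ charts, b ∈ e.baseSet
  orthogonal : ∀ e ∈ charts, ∀ e' ∈ charts, ∀ b ∈ e.baseSet ∩ e'.baseSet,
    ∀ u : Euc m, ‖e.coordChange e' b u‖ = ‖u‖

variable {k m V}

/-- The norm of an orthogonal structure: the Euclidean norm of the fibre coordinate in a chart of
the structure. -/
def OrthogonalStructure.norm (ξ : OrthogonalStructure k m V) (x : TotalSpace (Euc m) V) : ℝ :=
  ‖((ξ.cover x.proj).choose x).2‖

set_option linter.unusedSectionVars false in
/-- The norm does not depend on the chart. -/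
theorem OrthogonalStructure.norm_eq (ξ : OrthogonalStructure k m V) (x : TotalSpace (Euc m) V)
    (e : Trivialization (Euc m) (π (Euc m) V)) (he : e ∈ ξ.charts) (hx : x.proj ∈ e.baseSet) :
    ξ.norm x = ‖(e x).2‖ := by
  have h := (ξ.cover x.proj).choose_spec
  have h2 := ξ.orthogonal _ h.1 e he x.proj ⟨h.2, hx⟩ ((ξ.cover x.proj).choose x).2
  rw [Trivialization.coordChange_apply_snd _ _ h.2] at h2
  exact h2.symm

end Orthogonal

section FibreDerivative

variable {k m k' m' : ℕ} {B B' : Type*} [TopologicalSpace B] [TopologicalSpace B']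
  {V : B → Type*} [∀ b, AddCommGroup (V b)] [∀ b, Module ℝ (V b)] [∀ b, TopologicalSpace (V b)]
  [TopologicalSpace (TotalSpace (Euc m) V)] [FiberBundle (Euc m) V] [VectorBundle ℝ (Euc m) V]
  {V' : B' → Type*} [∀ b, AddCommGroup (V' b)] [∀ b, Module ℝ (V' b)]
  [∀ b, TopologicalSpace (V' b)]
  [TopologicalSpace (TotalSpace (Euc m') V')] [FiberBundle (Euc m') V']
  [VectorBundle ℝ (Euc m') V']

/-- For a map `f` of total spaces that sends zero vectors near `0_b` to zero vectors, and `0_b` to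
`0_b'`: the linear map from the fibre over `b` to the fibre over `b'` that takes `v`, seen as a
vertical tangent vector at `0_b`, to the vertical component of its image under the tangent map
of `f`, where the tangent space at `0_b'` is split into the vectors tangent to the zero section and
the vertical vectors. In trivializations `e` near `b` and `e'` near `b'`, the vertical component is
the derivative of the fibre coordinate, so this is the derivative at zero of the fibre coordinate
of `f` along the fibre; the result does not depend on `e` and `e'`. -/
def fibDeriv (f : TotalSpace (Euc m) V → TotalSpace (Euc m') V') (b : B) (b' : B') :
    V b →ₗ[ℝ] V' b' :=
  let e := trivializationAt (Euc m) V b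
  let e' := trivializationAt (Euc m') V' b'
  (e'.symmₗ ℝ b') ∘ₗ
    (fderiv ℝ (fun u : Euc m => (e' (f ⟨b, e.symm b u⟩)).2) 0 : Euc m →ₗ[ℝ] Euc m') ∘ₗ
    (e.linearMapAt ℝ b)

end FibreDerivative

section Total

/- The base manifold may have components of different dimensions, and the rank may vary with the
component. So the base is a finite disjoint union of pieces `B i` of pure dimension `k i`, and the
bundle has constant rank `m i` over `B i`. -/

variable {ι : Type*} (k m : ι → ℕ) {B : ι → Type*}
  [∀ i, TopologicalSpace (B i)] [∀ i, ChartedSpace (Euc (k i)) (B i)]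
  (V : ∀ i, B i → Type*)
  [∀ i b, AddCommGroup (V i b)] [∀ i b, Module ℝ (V i b)] [∀ i b, TopologicalSpace (V i b)]
  [∀ i, TopologicalSpace (TotalSpace (Euc (m i)) (V i))]
  [∀ i, FiberBundle (Euc (m i)) (V i)] [∀ i, VectorBundle ℝ (Euc (m i)) (V i)]

/-- The total space of the bundle, with the disjoint union topology. -/
abbrev Tot := Σ i, TotalSpace (Euc (m i)) (V i)

/-- The zero section, identified with the base. -/
def zeroSec : Set (Tot m V) := {z | z.2.2 = 0}

variable {m V}

/-- Multiplication by scalars in the fibres. -/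
def scale (s : ℝ) (z : Tot m V) : Tot m V := ⟨z.1, ⟨z.2.proj, s • z.2.2⟩⟩

variable {k} in
/-- The norm on the total space. -/
def nrm (ξ : ∀ i, OrthogonalStructure (k i) (m i) (V i)) (z : Tot m V) : ℝ := (ξ z.1).norm z.2

/-- The part of a subset of the total space that lies over the piece `B i`. -/
def slice (N : Set (Tot m V)) (i : ι) : Set (TotalSpace (Euc (m i)) (V i)) :=
  {x | (⟨i, x⟩ : Tot m V) ∈ N}

/-- `N` is a smooth submanifold of codimension zero, possibly with boundary: near each of its
points it is `{ρ ≥ 0}` for a smooth function `ρ` that has zero as a regular value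
(`ρ = 1` near interior points). -/
def IsDomain (N : Set (Tot m V)) : Prop :=
  ∀ i, ∀ x ∈ slice N i, ∃ U : Set (TotalSpace (Euc (m i)) (V i)), IsOpen U ∧ x ∈ U ∧
    ∃ ρ : TotalSpace (Euc (m i)) (V i) → ℝ,
      ContMDiffOn (totModel (k i) (m i)) 𝓘(ℝ, ℝ) ∞ ρ U ∧
      (∀ y ∈ U, (y ∈ slice N i ↔ 0 ≤ ρ y)) ∧
      ∀ y ∈ U, ρ y = 0 → mfderiv (totModel (k i) (m i)) 𝓘(ℝ, ℝ) ρ y ≠ 0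

open Classical in
/-- A map defined on `N`, extended by the identity outside `N`; all derivatives below are taken
within `N`, or at interior points of `N`. -/
def ext {N : Set (Tot m V)} (h : N → Tot m V) (z : Tot m V) : Tot m V :=
  if hz : z ∈ N then h ⟨z, hz⟩ else z

open Classical in
/-- The points of the piece that contains `c`, seen as points of the total space of this piece
(the value is `c.2` on the other pieces). -/
def toPiece (c z : Tot m V) : TotalSpace (Euc (m c.1)) (V c.1) :=
  if hz : z.1 = c.1 then hz ▸ z.2 else c.2

/-- The map `g` near the point `x` of the piece with index `i`, as a map from this piece of the
total space to the piece that contains `g x`. -/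
def loc (g : Tot m V → Tot m V) (i : ι) (x : TotalSpace (Euc (m i)) (V i)) :
    TotalSpace (Euc (m i)) (V i) → TotalSpace (Euc (m (g ⟨i, x⟩).1)) (V (g ⟨i, x⟩).1) :=
  fun x' => toPiece (g ⟨i, x⟩) (g ⟨i, x'⟩)

/-- Smooth maps from `N` to the total space. -/
structure SmoothMap (N : Set (Tot m V)) where
  toFun : N → Tot m V
  continuous_toFun : Continuous toFun
  smooth_toFun : ∀ i, ∀ x ∈ slice N i,
    ContMDiffWithinAt (totModel (k i) (m i))
      (totModel (k (ext toFun ⟨i, x⟩).1) (m (ext toFun ⟨i, x⟩).1)) ∞ (loc (ext toFun) i x) (slice N i) x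

/-- Domain of the chart centred at `c`. -/
def chartDom (c : Tot m V) : Set (Tot m V) :=
  Sigma.mk c.1 '' (extChartAt (totModel (k c.1) (m c.1)) c.2).source

/-- The chart centred at `c`. -/
def coord (c z : Tot m V) : Euc (k c.1) × Euc (m c.1) :=
  extChartAt (totModel (k c.1) (m c.1)) c.2 (toPiece c z)

/-- The inverse of the chart centred at `c`. -/
def coordSymm (c : Tot m V) (u : Euc (k c.1) × Euc (m c.1)) : Tot m V :=
  ⟨c.1, (extChartAt (totModel (k c.1) (m c.1)) c.2).symm u⟩

/-- The `l`-th derivative of `h` at `z`, in the chart centred at `c` of the source and the chart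
centred at `c'` of the target. -/
def chartDeriv {N : Set (Tot m V)} (h : N → Tot m V) (c c' : Tot m V) (l : ℕ) (z : Tot m V) :
    (Euc (k c.1) × Euc (m c.1)) [×l]→L[ℝ] (Euc (k c'.1) × Euc (m c'.1)) :=
  iteratedFDerivWithin ℝ l (fun u => coord k c' (ext h (coordSymm k c u)))
    (coord k c '' (N ∩ chartDom k c)) (coord k c z)

/-- The subbasic neighbourhoods of `f` in the weak Whitney topology: the smooth maps `g` that send
the compact set `K`, inside the chart centred at `c`, into the chart centred at `c'`, and whose
derivatives up to order `r` in these charts are `ε`-close on `K` to those of `f`. -/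
def whitneyNhd {N : Set (Tot m V)} (f : SmoothMap k N) (c c' : Tot m V) (K : Set (Tot m V))
    (r : ℕ) (ε : ℝ) : Set (SmoothMap k N) :=
  {g | MapsTo (ext g.toFun) K (chartDom k c') ∧
    ∀ l ≤ r, ∀ z ∈ K,
      ‖chartDeriv k g.toFun c c' l z - chartDeriv k f.toFun c c' l z‖ < ε}

/-- The weak Whitney topology `W^∞`. -/
instance {N : Set (Tot m V)} : TopologicalSpace (SmoothMap k N) :=
  TopologicalSpace.generateFrom
    {S | ∃ (f : SmoothMap k N) (c c' : Tot m V) (K : Set (Tot m V)) (r : ℕ) (ε : ℝ),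
      IsCompact K ∧ K ⊆ N ∩ chartDom k c ∧ MapsTo (ext f.toFun) K (chartDom k c') ∧ 0 < ε ∧
      S = whitneyNhd k f c c' K r ε}

/-- A smooth embedding: a topological embedding with injective tangent maps. -/
def IsEmb {N : Set (Tot m V)} (h : SmoothMap k N) : Prop :=
  IsEmbedding h.toFun ∧ ∀ i, ∀ x ∈ slice N i, Function.Injective
    (mfderivWithin (totModel (k i) (m i))
      (totModel (k (ext h.toFun ⟨i, x⟩).1) (m (ext h.toFun ⟨i, x⟩).1))
      (loc (ext h.toFun) i x) (slice N i) x)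

/-- The space of smooth embeddings of `N` into the total space that send the zero section to
itself, with the topology induced by `W^∞`. -/
def Emb (N : Set (Tot m V)) : Type _ :=
  {h : SmoothMap k N // (∀ z : N, z.1 ∈ zeroSec m V → h.toFun z ∈ zeroSec m V) ∧ IsEmb k h}

instance {N : Set (Tot m V)} : TopologicalSpace (Emb k N) :=
  instTopologicalSpaceSubtype

instance {N : Set (Tot m V)} : CoeFun (Emb k N) (fun _ => N → Tot m V) := ⟨fun h => h.1.toFun⟩

/-- The vector bundle morphism `T^fib g`: it sends the fibre over `b` to the fibre over the base
point of `g (0_b)`, by the derivative of `g` along the fibre. -/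
def tfib (g : Tot m V → Tot m V) (z : Tot m V) : Tot m V :=
  ⟨(g ⟨z.1, ⟨z.2.proj, 0⟩⟩).1, ⟨(g ⟨z.1, ⟨z.2.proj, 0⟩⟩).2.proj,
    fibDeriv (loc g z.1 ⟨z.2.proj, 0⟩) z.2.proj (g ⟨z.1, ⟨z.2.proj, 0⟩⟩).2.proj z.2.2⟩⟩

variable {k} in
/-- The function `φ = t + (1 - t) μ(‖z‖ / d)`. -/
def phi (ξ : ∀ i, OrthogonalStructure (k i) (m i) (V i)) (μ : ℝ → ℝ) (d t : ℝ) (z : Tot m V) : ℝ :=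
  t + (1 - t) * μ (nrm ξ z / d)

end Total

end LinEmb

end

noncomputable section

/-! Write `blowup h s z` for `h(s z)/s`, so that the deformation is `blowup h s z` with `s = φ(h, t,
z)`. In bundle charts the fibre coordinate `h₂` of `h` vanishes on the zero section, so Hadamard's
formula `h₂(x, s v)/s = ∫₀¹ ∂_v h₂(x, τ s v) v dτ` extends this family smoothly across `s = 0`,
where it becomes the fibre derivative (`FamAt.psAt_blowup`). The function `φ` is smooth although the
norm is not, because it equals `t` near the zero section (`psAt_phi`). Hence `H` is smooth in the
point and all its derivatives are jointly continuous in `(h, t, z)`, also at `t = 0`; outside the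
ball of radius `b δ(h)` it is just `h`, so the boundary and the ends of `N` cause no trouble.

The real question is why `H(h, t)` is an embedding for small `δ`. Conjugation by multiplication with
the radius `d` turns the deformation into `rescaled`, which lives on a fixed compact ball and
depends continuously on `d` down to `d = 0`, where it is `T^fib h` for every `t`. The fibre
derivative is injective with bijective derivative. Indeed the derivative of `h` along the zero
section is block triangular with injective horizontal block; this block is square because an
embedding that preserves the zero section preserves the dimension of each component
(`eq_of_le_of_open`, `Emb.dim_eq`), so the vertical block is injective as well, and square because
the rank is preserved too. On a compact ball, injectivity, injectivity of the derivative and control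
of the image persist for all embeddings near `h` and all small `d` (`eventually_isGoodRadius`). The
image of the ball where `H(h, t)` differs from `h` stays inside the `h`-image of a slightly larger
ball, so it cannot collide with the image of the outside; this also yields a topological embedding
although `N` is not compact (`isEmbedding_of_eqOn`).

It remains to choose the radius continuously in `h`. The set of radii below which everything is good
is an interval, so local constants can be averaged by a partition of unity, which needs a
paracompact parameter space. Only derivatives near the compact zero section matter, and countably
many uniform norms of cut off derivatives define a coarser pseudometrizable topology on the
embeddings for which the local argument still works (`exists_pseudoMetrizable_family`,
`exists_continuous_pos`). A function continuous for the coarser topology is `W^∞`-continuous. -/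

namespace LinEmb

open Filter

set_option linter.unusedSectionVars false

/-! ### Calculus of families that are smooth in space and jointly continuous in a topological
parameter. -/

section ParamSmooth

variable {P : Type*} [TopologicalSpace P] {Q : Type*} [TopologicalSpace Q]
  {E G W : Type} [NormedAddCommGroup E] [NormedSpace ℝ E]
  [NormedAddCommGroup G] [NormedSpace ℝ G] [NormedAddCommGroup W] [NormedSpace ℝ W]

/-- A family of maps `F p : E → G` is parametrically `C^n` near a point of `P × E` if its
derivatives in `E` up to order `n` exist and are jointly continuous near this point. -/
def PSAt : ℕ → ∀ {G : Type} [NormedAddCommGroup G] [NormedSpace ℝ G], (P → E → G) → P × E → Prop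
  | 0, _, _, _, F, q => ∀ᶠ r in 𝓝 q, ContinuousAt (Function.uncurry F) r
  | n + 1, _, _, _, F, q => (∀ᶠ r in 𝓝 q, ContinuousAt (Function.uncurry F) r ∧
      DifferentiableAt ℝ (F r.1) r.2) ∧ PSAt n (fun p => fderiv ℝ (F p)) q

theorem PSAt.eventually_continuousAt {n : ℕ} {F : P → E → G} {q : P × E} (h : PSAt n F q) :
    ∀ᶠ r in 𝓝 q, ContinuousAt (Function.uncurry F) r := by
  cases n with
  | zero => exact h
  | succ n => exact h.1.mono fun _ h => h.1

theorem PSAt.continuousAt {n : ℕ} {F : P → E → G} {q : P × E} (h : PSAt n F q) :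
    ContinuousAt (Function.uncurry F) q := h.eventually_continuousAt.self_of_nhds

theorem PSAt.pred {n : ℕ} {F : P → E → G} {q : P × E} (h : PSAt (n + 1) F q) : PSAt n F q := by
  induction n generalizing G with
  | zero => exact h.eventually_continuousAt
  | succ n ih => exact ⟨h.1, ih h.2⟩

theorem eventuallyEq_slice {F F' : P → E → G} {q : P × E}
    (h : ∀ᶠ r in 𝓝 q, F r.1 r.2 = F' r.1 r.2) : ∀ᶠ r in 𝓝 q, F r.1 =ᶠ[𝓝 r.2] F' r.1 := by
  filter_upwards [eventually_eventually_nhds.2 h] with r hr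
  have : Tendsto (fun u : E => (r.1, u)) (𝓝 r.2) (𝓝 r) :=
    (Continuous.prodMk_right r.1).tendsto' _ _ rfl
  exact this.eventually hr

theorem PSAt.congr {n : ℕ} {F F' : P → E → G} {q : P × E} (h : PSAt n F q)
    (he : ∀ᶠ r in 𝓝 q, F r.1 r.2 = F' r.1 r.2) : PSAt n F' q := by
  have hc : ∀ᶠ r in 𝓝 q, Function.uncurry F =ᶠ[𝓝 r] Function.uncurry F' :=
    eventually_eventually_nhds.2 he
  induction n generalizing G with
  | zero =>
    filter_upwards [h, hc] with r h1 h2 using h1.congr h2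
  | succ n ih =>
    refine ⟨?_, ?_⟩
    · filter_upwards [h.1, hc, eventuallyEq_slice he] with r h1 h2 h3
      exact ⟨h1.1.congr h2, h1.2.congr_of_eventuallyEq h3.symm⟩
    · have h3 : ∀ᶠ r in 𝓝 q, fderiv ℝ (F r.1) r.2 = fderiv ℝ (F' r.1) r.2 :=
        (eventuallyEq_slice he).mono fun r hr => hr.fderiv_eq
      exact ih h.2 h3 (eventually_eventually_nhds.2 h3)

theorem PSAt.reparam {n : ℕ} {F : P → E → G} {θ : Q → P} {q : Q × E}
    (h : PSAt n F (θ q.1, q.2)) (hθ : ∀ᶠ x in 𝓝 q.1, ContinuousAt θ x) :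
    PSAt n (fun x => F (θ x)) q := by
  have key : ∀ᶠ r in 𝓝 q, ContinuousAt (fun r : Q × E => (θ r.1, r.2)) r := by
    filter_upwards [continuousAt_fst.eventually hθ] with r hr
    exact (ContinuousAt.comp (f := Prod.fst) hr continuousAt_fst).prodMk continuousAt_snd
  have key' := key.self_of_nhds
  induction n generalizing G with
  | zero =>
    filter_upwards [key, key'.eventually h] with r h1 h2
    exact ContinuousAt.comp (f := fun r : Q × E => (θ r.1, r.2)) h2 h1
  | succ n ih =>
    refine ⟨?_, ih h.2⟩
    filter_upwards [key, key'.eventually h.1] with r h1 h2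
    exact ⟨ContinuousAt.comp (f := fun r : Q × E => (θ r.1, r.2)) h2.1 h1, h2.2⟩

theorem PSAt.of_contDiffAt {n : ℕ} {f : E → G} {q : P × E} (h : ContDiffAt ℝ n f q.2) :
    PSAt n (fun _ : P => f) q := by
  have hs : Tendsto (Prod.snd : P × E → E) (𝓝 q) (𝓝 q.2) := continuousAt_snd
  induction n generalizing G with
  | zero =>
    obtain ⟨u, hu, h1⟩ := contDiffAt_zero.1 h
    filter_upwards [hs.eventually (eventually_mem_nhds_iff.2 hu)] with r hr
    exact ContinuousAt.comp (g := f) (f := Prod.snd) (h1.continuousAt hr) continuousAt_snd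
  | succ n ih =>
    refine ⟨?_, ih (h.fderiv_right (by norm_cast))⟩
    have h1 : ∀ᶠ u in 𝓝 q.2, ContDiffAt ℝ ((n + 1 : ℕ) : ℕ∞ω) f u :=
      h.eventually (by simp)
    filter_upwards [hs.eventually h1] with r hr
    exact ⟨ContinuousAt.comp (g := f) (f := Prod.snd) hr.continuousAt continuousAt_snd,
      hr.differentiableAt (by simp)⟩

theorem PSAt.of_continuousAt {n : ℕ} {f : P → G} {q : P × E}
    (h : ∀ᶠ p in 𝓝 q.1, ContinuousAt f p) : PSAt n (fun p (_ : E) => f p) q := by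
  have h0 : ∀ᶠ r in 𝓝 q, ContinuousAt (Function.uncurry fun p (_ : E) => f p) r := by
    filter_upwards [continuousAt_fst.eventually h] with r hr
    exact ContinuousAt.comp (f := Prod.fst) hr continuousAt_fst
  cases n with
  | zero => exact h0
  | succ n =>
    refine ⟨h0.mono fun r hr => ⟨hr, differentiableAt_const _⟩, ?_⟩
    exact (PSAt.of_contDiffAt (n := n) (f := fun _ : E => (0 : E →L[ℝ] G))
      contDiffAt_const).congr (Eventually.of_forall fun r => by simp)

theorem PSAt.add {n : ℕ} {F F' : P → E → G} {q : P × E} (h : PSAt n F q) (h' : PSAt n F' q) :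
    PSAt n (fun p u => F p u + F' p u) q := by
  induction n generalizing G with
  | zero =>
    filter_upwards [h, h'] with r h1 h2 using h1.add h2
  | succ n ih =>
    refine ⟨?_, (ih h.2 h'.2).congr ?_⟩
    · filter_upwards [h.1, h'.1] with r h1 h2 using ⟨h1.1.add h2.1, h1.2.add h2.2⟩
    · filter_upwards [h.1, h'.1] with r h1 h2
      exact (fderiv_fun_add h1.2 h2.2).symm

theorem PSAt.clm {n : ℕ} {F : P → E → G} {q : P × E} (A : G →L[ℝ] W) (h : PSAt n F q) :
    PSAt n (fun p u => A (F p u)) q := by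
  induction n generalizing G W with
  | zero =>
    filter_upwards [h] with r h1
    exact A.continuous.continuousAt.comp h1
  | succ n ih =>
    refine ⟨?_, (ih (ContinuousLinearMap.compL ℝ E G W A) h.2).congr ?_⟩
    · filter_upwards [h.1] with r h1
      exact ⟨A.continuous.continuousAt.comp h1.1, A.differentiableAt.comp _ h1.2⟩
    · filter_upwards [h.1] with r h1
      exact ((A.hasFDerivAt.comp r.2 h1.2.hasFDerivAt).fderiv).symm

/-- Leibniz rule: the derivative is a sum of two bilinear expressions, each with one factor
differentiated and the other lowered by one order, so the induction has to vary the bilinear map and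
all target spaces. -/
theorem PSAt.bilin {n : ℕ} {G' : Type} [NormedAddCommGroup G'] [NormedSpace ℝ G']
    {F : P → E → G} {F' : P → E → G'} {q : P × E}
    (A : G →L[ℝ] G' →L[ℝ] W) (h : PSAt n F q) (h' : PSAt n F' q) :
    PSAt n (fun p u => A (F p u) (F' p u)) q := by
  induction n generalizing G G' W with
  | zero =>
    filter_upwards [h, h'] with r h1 h2
    exact (A.continuous.continuousAt.comp h1).clm_apply h2
  | succ n ih =>
    refine ⟨?_, ((ih (A.precompR E) h.pred h'.2).add (ih (A.precompL E) h.2 h'.pred)).congr ?_⟩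
    · filter_upwards [h.1, h'.1] with r h1 h2
      exact ⟨(A.continuous.continuousAt.comp h1.1).clm_apply h2.1,
        (A.hasFDerivAt_of_bilinear h1.2.hasFDerivAt h2.2.hasFDerivAt).differentiableAt⟩
    · filter_upwards [h.1, h'.1] with r h1 h2
      exact ((A.hasFDerivAt_of_bilinear h1.2.hasFDerivAt h2.2.hasFDerivAt).fderiv).symm

theorem PSAt.prodMk {n : ℕ} {F : P → E → G} {F' : P → E → W} {q : P × E}
    (h : PSAt n F q) (h' : PSAt n F' q) : PSAt n (fun p u => (F p u, F' p u)) q := by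
  refine ((h.clm (ContinuousLinearMap.inl ℝ G W)).add
    (h'.clm (ContinuousLinearMap.inr ℝ G W))).congr (Eventually.of_forall fun r => ?_)
  simp

theorem PSAt.fst {n : ℕ} {F : P → E → G × W} {q : P × E} (h : PSAt n F q) :
    PSAt n (fun p u => (F p u).1) q := h.clm (ContinuousLinearMap.fst ℝ G W)

theorem PSAt.snd {n : ℕ} {F : P → E → G × W} {q : P × E} (h : PSAt n F q) :
    PSAt n (fun p u => (F p u).2) q := h.clm (ContinuousLinearMap.snd ℝ G W)

theorem PSAt.smul {n : ℕ} {F : P → E → ℝ} {F' : P → E → W} {q : P × E}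
    (h : PSAt n F q) (h' : PSAt n F' q) : PSAt n (fun p u => F p u • F' p u) q :=
  h.bilin (ContinuousLinearMap.lsmul ℝ ℝ) h'

theorem PSAt.clm_apply {n : ℕ} {F : P → E → G →L[ℝ] W} {F' : P → E → G} {q : P × E}
    (h : PSAt n F q) (h' : PSAt n F' q) : PSAt n (fun p u => F p u (F' p u)) q :=
  h.bilin (ContinuousLinearMap.id ℝ _) h'

/-- Chain rule: the derivative is bilinear in the outer derivative taken along `F`, which the
induction handles, and the derivative of `F`. The outer map may depend on the same parameter. -/
theorem PSAt.comp {n : ℕ} {K : P → G → W} {F : P → E → G} {q : P × E}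
    (hK : PSAt n K (q.1, F q.1 q.2)) (hF : PSAt n F q) : PSAt n (fun p u => K p (F p u)) q := by
  have key : ∀ᶠ r in 𝓝 q, ContinuousAt (fun r : P × E => (r.1, F r.1 r.2)) r := by
    filter_upwards [hF.eventually_continuousAt] with r hr
    exact continuousAt_fst.prodMk hr
  have key' := key.self_of_nhds
  induction n generalizing W with
  | zero =>
    filter_upwards [key, key'.eventually hK] with r h1 h2
    exact ContinuousAt.comp (f := fun r : P × E => (r.1, F r.1 r.2)) h2 h1
  | succ n ih =>
    refine ⟨?_, ((ih hK.2 hF.pred).bilin (ContinuousLinearMap.compL ℝ E G W) hF.2).congr ?_⟩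
    · filter_upwards [key, key'.eventually hK.1, hF.1] with r h1 h2 h3
      exact ⟨ContinuousAt.comp (f := fun r : P × E => (r.1, F r.1 r.2)) h2.1 h1,
        h2.2.comp r.2 h3.2⟩
    · filter_upwards [key'.eventually hK.1, hF.1] with r h2 h3
      exact (fderiv_comp r.2 h2.2 h3.2).symm

theorem PSAt.contDiffAt_comp {n : ℕ} {f : G → W} {F : P → E → G} {q : P × E}
    (hf : ContDiffAt ℝ n f (F q.1 q.2)) (hF : PSAt n F q) : PSAt n (fun p u => f (F p u)) q :=
  PSAt.comp (K := fun _ => f) (PSAt.of_contDiffAt hf) hF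

theorem PSAt.eventually_contDiffAt {n : ℕ} {F : P → E → G} {q : P × E} (h : PSAt n F q) :
    ∀ᶠ r in 𝓝 q, ContDiffAt ℝ n (F r.1) r.2 := by
  have hs (r : P × E) : Tendsto (fun u : E => (r.1, u)) (𝓝 r.2) (𝓝 r) :=
    (Continuous.prodMk_right r.1).tendsto' _ _ rfl
  induction n generalizing G with
  | zero =>
    filter_upwards [eventually_eventually_nhds.2 h] with r hr
    refine contDiffAt_zero.2 ⟨_, (hs r).eventually hr, fun u hu => ?_⟩
    exact (ContinuousAt.comp (f := fun u => (r.1, u)) hu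
      (Continuous.prodMk_right r.1).continuousAt).continuousWithinAt
  | succ n ih =>
    filter_upwards [eventually_eventually_nhds.2 h.1, ih h.2] with r h1 h2
    push_cast
    refine contDiffAt_succ_iff_hasFDerivAt.2 ⟨_, ⟨_, (hs r).eventually h1, fun u hu => ?_⟩, h2⟩
    exact hu.2.hasFDerivAt

theorem PSAt.contDiffAt {n : ℕ} {F : P → E → G} {q : P × E} (h : PSAt n F q) :
    ContDiffAt ℝ n (F q.1) q.2 := h.eventually_contDiffAt.self_of_nhds

theorem PSAt.continuousAt_iteratedFDeriv {n : ℕ} {F : P → E → G} {q : P × E} (h : PSAt n F q) :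
    ContinuousAt (fun r : P × E => iteratedFDeriv ℝ n (F r.1) r.2) q := by
  induction n generalizing G with
  | zero =>
    have := h.continuousAt
    simp only [iteratedFDeriv_zero_eq_comp]
    exact ((continuousMultilinearCurryFin0 ℝ E G).symm.continuous.continuousAt).comp this
  | succ n ih =>
    simp only [iteratedFDeriv_succ_eq_comp_right]
    exact ((continuousMultilinearCurryRightEquiv' ℝ n E G).symm.continuous.continuousAt).comp
      (ih h.2)

/-- The bridge from the Whitney topology, which controls iterated derivatives, to the recursive
notion, which is convenient for calculus. -/
theorem PSAt.of_iteratedFDeriv {n : ℕ} {F : P → E → G} {q : P × E}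
    (h1 : ∀ᶠ r in 𝓝 q, ContDiffAt ℝ n (F r.1) r.2)
    (h2 : ∀ l ≤ n, ∀ᶠ r in 𝓝 q, ContinuousAt (fun r : P × E => iteratedFDeriv ℝ l (F r.1) r.2) r) :
    PSAt n F q := by
  have h0 : ∀ᶠ r in 𝓝 q, ContinuousAt (Function.uncurry F) r := by
    filter_upwards [h2 0 (Nat.zero_le _)] with r hr
    have := ((continuousMultilinearCurryFin0 ℝ E G).continuous.continuousAt).comp hr
    simpa [Function.comp_def, Function.uncurry_def, iteratedFDeriv_zero_eq_comp] using this
  induction n generalizing G with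
  | zero => exact h0
  | succ n ih =>
    have h3 : ∀ l ≤ n, ∀ᶠ r in 𝓝 q,
        ContinuousAt (fun r : P × E => iteratedFDeriv ℝ l (fderiv ℝ (F r.1)) r.2) r := by
      intro l hl
      filter_upwards [h2 (l + 1) (by lia)] with r hr
      simp only [iteratedFDeriv_succ_eq_comp_right] at hr
      have := ((continuousMultilinearCurryRightEquiv' ℝ l E G).continuous.continuousAt).comp hr
      simpa [Function.comp_def] using this
    refine ⟨?_, ih ?_ h3 ?_⟩
    · filter_upwards [h0, h1] with r h3 h4 using ⟨h3, h4.differentiableAt (by simp)⟩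
    · filter_upwards [h1] with r h1
      exact h1.fderiv_right (by norm_cast)
    · filter_upwards [h3 0 (Nat.zero_le _)] with r hr
      have := ((continuousMultilinearCurryFin0 ℝ E (E →L[ℝ] G)).continuous.continuousAt).comp hr
      simpa [Function.comp_def, Function.uncurry_def, iteratedFDeriv_zero_eq_comp] using this

/-- The tube lemma for the compact interval of integration. -/
theorem eventually_forall_Icc {C : (P × ℝ) × E → Prop} {q : P × E}
    (h : ∀ τ ∈ Icc (0 : ℝ) 1, ∀ᶠ r in 𝓝 ((q.1, τ), q.2), C r) :
    ∀ᶠ r in 𝓝 q, ∀ τ ∈ Icc (0 : ℝ) 1, C ((r.1, τ), r.2) := by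
  refine isCompact_Icc.eventually_forall_of_forall_eventually
    (P := fun (r : P × E) τ => C ((r.1, τ), r.2)) fun τ hτ => ?_
  have : Tendsto (fun z : (P × E) × ℝ => ((z.1.1, z.2), z.1.2)) (𝓝 (q, τ))
      (𝓝 ((q.1, τ), q.2)) := by
    refine Continuous.tendsto' ?_ _ _ rfl
    fun_prop
  exact this.eventually (h τ hτ)

theorem continuousOn_slice {F : P × ℝ → E → G} {q : P × E}
    (h : ∀ τ ∈ Icc (0 : ℝ) 1, ContinuousAt (Function.uncurry F) ((q.1, τ), q.2)) :
    ContinuousOn (fun τ => F (q.1, τ) q.2) (Icc 0 1) := by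
  intro τ hτ
  have : ContinuousAt (fun τ : ℝ => ((q.1, τ), q.2)) τ := by fun_prop
  exact (ContinuousAt.comp (f := fun τ : ℝ => ((q.1, τ), q.2)) (h τ hτ)
    this).continuousWithinAt

/-- The parameter space need not be first countable, so dominated convergence does not apply to the
parameter; the tube lemma makes the integrand close to its value at `q` uniformly in `τ`. -/
theorem continuousAt_integral {F : P × ℝ → E → G} {q : P × E}
    (h : ∀ τ ∈ Icc (0 : ℝ) 1,
      ∀ᶠ r in 𝓝 ((q.1, τ), q.2), ContinuousAt (Function.uncurry F) r) :
    ContinuousAt (Function.uncurry fun p u => ∫ τ in (0 : ℝ)..1, F (p, τ) u) q := by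
  have hc := eventually_forall_Icc h
  have hint : ∀ᶠ r in 𝓝 q,
      IntervalIntegrable (fun τ => F (r.1, τ) r.2) MeasureTheory.volume 0 1 := by
    filter_upwards [hc] with r hr
    refine ContinuousOn.intervalIntegrable ?_
    rw [uIcc_of_le zero_le_one]
    exact continuousOn_slice hr
  rw [Metric.continuousAt_iff']
  intro ε hε
  have h2 : ∀ τ ∈ Icc (0 : ℝ) 1, ∀ᶠ r in 𝓝 ((q.1, τ), q.2),
      ‖F r.1 r.2 - F (q.1, r.1.2) q.2‖ < ε / 2 := by
    intro τ hτ
    have h3 := (h τ hτ).self_of_nhds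
    have h4 : ContinuousAt (fun r : (P × ℝ) × E => F (q.1, r.1.2) q.2) ((q.1, τ), q.2) :=
      ContinuousAt.comp (g := Function.uncurry F)
        (f := fun r : (P × ℝ) × E => ((q.1, r.1.2), q.2)) h3 (by fun_prop)
    have h5 : ContinuousAt (fun r => ‖F r.1 r.2 - F (q.1, r.1.2) q.2‖) ((q.1, τ), q.2) :=
      (h3.sub h4).norm
    exact h5.eventually_lt_const (by simpa using half_pos hε)
  filter_upwards [hint, eventually_forall_Icc h2] with r h3 h4
  rw [dist_eq_norm, Function.uncurry, Function.uncurry,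
    ← intervalIntegral.integral_sub h3 hint.self_of_nhds]
  calc _ ≤ ε / 2 * |(1 : ℝ) - 0| := by
        refine intervalIntegral.norm_integral_le_of_norm_le_const fun τ hτ => ?_
        rw [uIoc_of_le zero_le_one] at hτ
        exact (h4 τ ⟨hτ.1.le, hτ.2⟩).le
    _ < ε := by simp [hε]

theorem PSAt.integral {n : ℕ} [CompleteSpace G] {F : P × ℝ → E → G} {q : P × E}
    (h : ∀ τ ∈ Icc (0 : ℝ) 1, PSAt n F ((q.1, τ), q.2)) :
    PSAt n (fun p u => ∫ τ in (0 : ℝ)..1, F (p, τ) u) q := by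
  have hcont : ∀ᶠ r in 𝓝 q,
      ContinuousAt (Function.uncurry fun p u => ∫ τ in (0 : ℝ)..1, F (p, τ) u) r := by
    filter_upwards [eventually_forall_Icc fun τ hτ =>
      eventually_eventually_nhds.2 (h τ hτ).eventually_continuousAt] with r hr
    exact continuousAt_integral hr
  induction n generalizing G with
  | zero => exact hcont
  | succ n ih =>
    have hd : ∀ᶠ r in 𝓝 q, HasFDerivAt (fun u => ∫ τ in (0 : ℝ)..1, F (r.1, τ) u)
        (∫ τ in (0 : ℝ)..1, fderiv ℝ (F (r.1, τ)) r.2) r.2 := by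
      have h1 := eventually_forall_Icc fun τ hτ => eventually_eventually_nhds.2 (h τ hτ).1
      have h2 := eventually_forall_Icc fun τ hτ =>
        eventually_eventually_nhds.2 (h τ hτ).2.eventually_continuousAt
      filter_upwards [h1, h2] with r h1 h2
      have hs : Tendsto (fun u : E => (r.1, u)) (𝓝 r.2) (𝓝 r) :=
        (Continuous.prodMk_right r.1).tendsto' _ _ rfl
      obtain ⟨C, hC⟩ : ∃ C, ∀ τ ∈ Icc (0 : ℝ) 1, ‖fderiv ℝ (F (r.1, τ)) r.2‖ ≤ C := by
        have := continuousOn_slice (F := fun p => fderiv ℝ (F p)) (q := r)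
          fun τ hτ => (h2 τ hτ).self_of_nhds
        obtain ⟨C, hC⟩ := (isCompact_Icc.image_of_continuousOn this.norm).bddAbove
        exact ⟨C, fun τ hτ => hC ⟨τ, hτ, rfl⟩⟩
      -- The dominating function is constant: a bound on the slice through `r`, plus one, remains a
      -- bound for nearby `u`, uniformly in `τ`.
      have hbd : ∀ᶠ u in 𝓝 r.2, ∀ τ ∈ Icc (0 : ℝ) 1, ‖fderiv ℝ (F (r.1, τ)) u‖ ≤ C + 1 := by
        refine hs.eventually (eventually_forall_Icc
          (C := fun z => ‖fderiv ℝ (F z.1) z.2‖ ≤ C + 1) fun τ hτ => ?_)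
        have h5 : ContinuousAt (fun z : (P × ℝ) × E => ‖fderiv ℝ (F z.1) z.2‖)
          ((r.1, τ), r.2) := (h2 τ hτ).self_of_nhds.norm
        have h6 := h5.eventually_lt_const (u := C + 1) (by
          have := hC τ hτ
          linarith)
        exact h6.mono fun _ h => le_of_lt h
      have hdf : ∀ᶠ u in 𝓝 r.2, ∀ τ ∈ Icc (0 : ℝ) 1,
          ContinuousAt (Function.uncurry F) ((r.1, τ), u) ∧ DifferentiableAt ℝ (F (r.1, τ)) u :=
        hs.eventually (eventually_forall_Icc h1)
      have hmeas : ∀ {f : ℝ → G}, ContinuousOn f (Icc 0 1) →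
          MeasureTheory.AEStronglyMeasurable f
            (MeasureTheory.volume.restrict (uIoc (0 : ℝ) 1)) := fun hf => by
        rw [uIoc_of_le zero_le_one]
        exact (hf.mono Ioc_subset_Icc_self).aestronglyMeasurable measurableSet_Ioc
      have hIcc : ∀ τ ∈ uIoc (0 : ℝ) 1, τ ∈ Icc (0 : ℝ) 1 := fun τ hτ => by
        rw [uIoc_of_le zero_le_one] at hτ
        exact ⟨hτ.1.le, hτ.2⟩
      refine intervalIntegral.hasFDerivAt_integral_of_dominated_of_fderiv_le
        (F := fun u τ => F (r.1, τ) u) (F' := fun u τ => fderiv ℝ (F (r.1, τ)) u)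
        (bound := fun _ => C + 1) (hbd.and hdf) ?_ ?_ ?_ ?_ ?_ ?_
      · filter_upwards [hdf] with u hu
        exact hmeas (continuousOn_slice (q := (r.1, u)) fun τ hτ => (hu τ hτ).1)
      · refine ContinuousOn.intervalIntegrable ?_
        rw [uIcc_of_le zero_le_one]
        exact continuousOn_slice fun τ hτ => (hdf.self_of_nhds τ hτ).1
      · rw [uIoc_of_le zero_le_one]
        exact ((continuousOn_slice (F := fun p => fderiv ℝ (F p)) (q := r)
          fun τ hτ => (h2 τ hτ).self_of_nhds).mono
          Ioc_subset_Icc_self).aestronglyMeasurable measurableSet_Ioc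
      · exact Eventually.of_forall fun τ hτ u hu => hu.1 τ (hIcc τ hτ)
      · exact intervalIntegrable_const
      · exact Eventually.of_forall fun τ hτ u hu => (hu.2 τ (hIcc τ hτ)).2.hasFDerivAt
    refine ⟨hcont.and (hd.mono fun r hr => hr.differentiableAt), ?_⟩
    refine (ih (F := fun p => fderiv ℝ (F p)) (fun τ hτ => (h τ hτ).2) ?_).congr
      (hd.mono fun r hr => hr.fderiv.symm)
    filter_upwards [eventually_forall_Icc fun τ hτ =>
      eventually_eventually_nhds.2 (h τ hτ).2.eventually_continuousAt] with r hr
    exact continuousAt_integral (F := fun p => fderiv ℝ (F p)) hr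

open Metric in
/-- A parametrically `C¹` family is uniformly close to its derivative on a small ball. -/
theorem PSAt.approximatesLinearOn {F : P → E → G} {q : P × E} (h : PSAt 1 F q) {c : NNReal}
    (hc : 0 < c) : ∀ᶠ ρ in 𝓝[>] (0 : ℝ), ∀ᶠ p in 𝓝 q.1,
      ApproximatesLinearOn (F p) (fderiv ℝ (F q.1) q.2) (closedBall q.2 ρ) c := by
  have h2 : ∀ᶠ r in 𝓝 q, DifferentiableAt ℝ (F r.1) r.2 ∧
      ‖fderiv ℝ (F r.1) r.2 - fderiv ℝ (F q.1) q.2‖ < c := by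
    have h3 : ContinuousAt (fun r : P × E => ‖fderiv ℝ (F r.1) r.2 - fderiv ℝ (F q.1) q.2‖) q :=
      (h.2.continuousAt.sub continuousAt_const).norm
    filter_upwards [h.1, h3.eventually_lt_const (u := (c : ℝ)) (by simpa using hc)] with r h4 h5
    exact ⟨h4.2, h5⟩
  rw [← Prod.mk.eta (p := q), nhds_prod_eq] at h2
  obtain ⟨A, hA, B, hB, hAB⟩ := eventually_prod_iff.1 h2
  obtain ⟨ε, hε, hball⟩ := Metric.eventually_nhds_iff_ball.1 hB
  filter_upwards [Ioo_mem_nhdsGT hε] with ρ hρ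
  filter_upwards [hA] with p hp
  have h5 : ∀ u ∈ closedBall q.2 ρ, DifferentiableAt ℝ (F p) u ∧
      ‖fderiv ℝ (F p) u - fderiv ℝ (F q.1) q.2‖ < c := fun u hu =>
    hAB hp (hball u (closedBall_subset_ball hρ.2 hu))
  intro u hu v hv
  exact (convex_closedBall q.2 ρ).norm_image_sub_le_of_norm_fderiv_le' (fun x hx => (h5 x hx).1)
    (fun x hx => (h5 x hx).2.le) hv hu

-- The injectivity half of the inverse function theorem with a parameter: on one small ball, all
-- nearby `F p` differ from `A` by a map of Lipschitz constant `‖A⁻¹‖⁻¹ / 2`, which is too small to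
-- destroy injectivity.
open Metric in
theorem PSAt.eventually_injective [CompleteSpace E] {F : P → E → G} {q : P × E} (h : PSAt 1 F q)
    (A : E ≃L[ℝ] G) (hA : fderiv ℝ (F q.1) q.2 = A) :
    ∀ᶠ z in 𝓝 (q.1, (q.2, q.2)), F z.1 z.2.1 = F z.1 z.2.2 → z.2.1 = z.2.2 := by
  rcases subsingleton_or_nontrivial E with hE | hE
  · exact Eventually.of_forall fun z _ => Subsingleton.elim _ _
  have hpos : 0 < ‖(A.symm : G →L[ℝ] E)‖₊⁻¹ := inv_pos.2 A.nnnorm_symm_pos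
  obtain ⟨ρ, h1, hρ⟩ := ((h.approximatesLinearOn (half_pos hpos)).and
    self_mem_nhdsWithin).exists
  have hρ : 0 < ρ := hρ
  rw [hA] at h1
  have h2 : ∀ᶠ x in 𝓝 (q.2, q.2), x.1 ∈ closedBall q.2 ρ ∧ x.2 ∈ closedBall q.2 ρ :=
    (eventually_of_mem (prod_mem_nhds (closedBall_mem_nhds q.2 hρ) (closedBall_mem_nhds q.2 hρ)))
      fun _ hx => hx
  rw [nhds_prod_eq]
  filter_upwards [h1.prod_mk h2] with z hz
  exact fun he => hz.1.injOn (Or.inr (half_lt_self hpos)) hz.2.1 hz.2.2 he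

-- The openness half of the inverse function theorem with a parameter: the same small ball serves
-- for all nearby parameters, so a fixed ball in the target is covered by every nearby `F p`.
open Metric in
theorem PSAt.eventually_mem_image [CompleteSpace E] {F : P → E → G} {q : P × E} (h : PSAt 1 F q)
    (A : E ≃L[ℝ] G) (hA : fderiv ℝ (F q.1) q.2 = A) {U : Set E} (hU : U ∈ 𝓝 q.2) :
    ∀ᶠ z in 𝓝 (q.1, F q.1 q.2), z.2 ∈ F z.1 '' U := by
  rcases subsingleton_or_nontrivial E with hE | hE
  · have : Subsingleton G := A.symm.injective.subsingleton
    exact Eventually.of_forall fun z => ⟨q.2, mem_of_mem_nhds hU, Subsingleton.elim _ _⟩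
  have hpos : 0 < ‖(A.symm : G →L[ℝ] E)‖₊⁻¹ := inv_pos.2 A.nnnorm_symm_pos
  obtain ⟨ε, hε, hball⟩ := Metric.mem_nhds_iff.1 hU
  obtain ⟨ρ, h1, hρ⟩ := ((h.approximatesLinearOn (half_pos hpos)).and
    (Ioo_mem_nhdsGT hε)).exists
  rw [hA] at h1
  -- `F p` covers the ball of radius `(‖A⁻¹‖⁻¹ - ‖A⁻¹‖⁻¹ / 2) ρ = κ` about the moving centre `F p
  -- q.2`. As this centre moves by less than `κ / 2`, the fixed ball of radius `κ / 2` about `F q.1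
  -- q.2` is covered as well.
  set κ : ℝ := (‖(A.symm : G →L[ℝ] E)‖₊⁻¹ / 2 : NNReal) * ρ with hκ
  have hκ0 : 0 < κ := mul_pos (by exact_mod_cast half_pos hpos) hρ.1
  have h3 : ∀ᶠ p in 𝓝 q.1, dist (F p q.2) (F q.1 q.2) < κ / 2 := by
    have h4 : ContinuousAt (fun p => F p q.2) q.1 :=
      ContinuousAt.comp (f := fun p => (p, q.2)) h.continuousAt (by fun_prop)
    exact Metric.continuousAt_iff'.1 h4 _ (half_pos hκ0)
  rw [nhds_prod_eq]
  filter_upwards [(h1.and h3).prod_mk (ball_mem_nhds (F q.1 q.2) (half_pos hκ0))] with z hz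
  have hsurj := hz.1.1.surjOn_closedBall_of_nonlinearRightInverse
    A.toNonlinearRightInverse hρ.1.le subset_rfl
  have hmem : z.2 ∈ closedBall (F z.1 q.2)
      (((A.toNonlinearRightInverse.nnnorm : ℝ)⁻¹ - (‖(A.symm : G →L[ℝ] E)‖₊⁻¹ / 2 : NNReal)) * ρ) := by
    have e1 : ((A.toNonlinearRightInverse.nnnorm : ℝ)⁻¹ -
        (‖(A.symm : G →L[ℝ] E)‖₊⁻¹ / 2 : NNReal)) * ρ = κ := by
      have : A.toNonlinearRightInverse.nnnorm = ‖(A.symm : G →L[ℝ] E)‖₊ := rfl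
      rw [this, hκ]
      push_cast
      ring
    rw [e1, mem_closedBall]
    have e2 : dist z.2 (F q.1 q.2) < κ / 2 := hz.2
    have e3 := dist_triangle_right z.2 (F z.1 q.2) (F q.1 q.2)
    linarith [hz.1.2]
  obtain ⟨u, hu, hu2⟩ := hsurj hmem
  exact ⟨u, hball (closedBall_subset_ball hρ.2 hu), hu2⟩

theorem PSAt.eventually_fderiv_injective [CompleteSpace E] {F : P → E → G} {q : P × E}
    (h : PSAt 1 F q)
    (A : E ≃L[ℝ] G) (hA : fderiv ℝ (F q.1) q.2 = A) :
    ∀ᶠ r in 𝓝 q, Function.Injective (fderiv ℝ (F r.1) r.2) := by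
  have h1 : ContinuousAt (fun r : P × E => fderiv ℝ (F r.1) r.2) q := h.2.continuousAt
  have h2 : range ((↑) : (E ≃L[ℝ] G) → E →L[ℝ] G) ∈ 𝓝 (fderiv ℝ (F q.1) q.2) :=
    hA ▸ A.nhds
  filter_upwards [h1.eventually h2] with r hr
  obtain ⟨A', hA'⟩ := hr
  rw [← hA']
  exact A'.injective

end ParamSmooth

/-! ### Topology and norm of a single vector bundle of constant rank. -/

section SinglePiece

variable {k m : ℕ} {B : Type*} [TopologicalSpace B] [ChartedSpace (Euc k) B]
  {V : B → Type*} [∀ b, AddCommGroup (V b)] [∀ b, Module ℝ (V b)] [∀ b, TopologicalSpace (V b)]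
  [TopologicalSpace (TotalSpace (Euc m) V)] [FiberBundle (Euc m) V] [VectorBundle ℝ (Euc m) V]

theorem mem_extChartAt_source_iff (c x : TotalSpace (Euc m) V) :
    x ∈ (extChartAt (totModel k m) c).source ↔
      x.proj ∈ (trivializationAt (Euc m) V c.proj).baseSet ∧
        x.proj ∈ (extChartAt (𝓡 k) c.proj).source := by
  rw [FiberBundle.extChartAt]
  simp only [PartialEquiv.trans_source, mem_inter_iff, mem_preimage]
  change x ∈ (trivializationAt (Euc m) V c.proj).source ∧ _ ↔ _
  rw [Trivialization.mem_source]
  refine and_congr_right fun h => ?_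
  simp only [PartialEquiv.prod_source, PartialEquiv.refl_source, mem_prod, mem_univ, and_true]
  change ((trivializationAt (Euc m) V c.proj) x).1 ∈ _ ↔ _
  rw [Trivialization.coe_fst' _ h]

theorem extChartAt_apply (c x : TotalSpace (Euc m) V)
    (hx : x.proj ∈ (trivializationAt (Euc m) V c.proj).baseSet) :
    extChartAt (totModel k m) c x =
      (extChartAt (𝓡 k) c.proj x.proj, (trivializationAt (Euc m) V c.proj x).2) := by
  rw [FiberBundle.extChartAt]
  simp only [PartialEquiv.trans_apply, PartialEquiv.prod_coe, PartialEquiv.refl_coe, id]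
  congr 2
  exact Trivialization.coe_fst' _ hx

theorem extChartAt_target_eq (c : TotalSpace (Euc m) V) :
    (extChartAt (totModel k m) c).target =
      ((extChartAt (𝓡 k) c.proj).target ∩
        (extChartAt (𝓡 k) c.proj).symm ⁻¹' (trivializationAt (Euc m) V c.proj).baseSet) ×ˢ univ :=
  FiberBundle.extChartAt_target c

theorem trivialization_smul (e : Trivialization (Euc m) (π (Euc m) V)) (he : e.IsLinear ℝ)
    (s : ℝ) (x : TotalSpace (Euc m) V) (hx : x.proj ∈ e.baseSet) :
    (e ⟨x.proj, s • x.2⟩).2 = s • (e x).2 :=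
  (e.linear ℝ hx).map_smul s x.2

/-- Points that cannot be separated have the same base point, since `B` is Hausdorff; then they lie
in the domain of one trivialization, which separates them. -/
theorem t2Space_totalSpace [T2Space B] : T2Space (TotalSpace (Euc m) V) := by
  refine t2_iff_nhds.2 fun {x y} hxy => ?_
  have h1 : Tendsto (π (Euc m) V) (𝓝 x ⊓ 𝓝 y) (𝓝 x.proj) :=
    ((FiberBundle.continuous_proj (Euc m) V).tendsto x).mono_left inf_le_left
  have h2 : Tendsto (π (Euc m) V) (𝓝 x ⊓ 𝓝 y) (𝓝 y.proj) :=
    ((FiberBundle.continuous_proj (Euc m) V).tendsto y).mono_left inf_le_right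
  have hp := tendsto_nhds_unique h1 h2
  have hxs : x ∈ (trivializationAt (Euc m) V x.proj).source :=
    (Trivialization.mem_source _).2 (mem_baseSet_trivializationAt _ _ _)
  have hys : y ∈ (trivializationAt (Euc m) V x.proj).source :=
    (Trivialization.mem_source _).2 (hp ▸ mem_baseSet_trivializationAt _ _ _)
  set e := trivializationAt (Euc m) V x.proj
  have h3 := (e.toOpenPartialHomeomorph.continuousAt hxs).mono_left (inf_le_left (b := 𝓝 y))
  have h4 := (e.toOpenPartialHomeomorph.continuousAt hys).mono_left (inf_le_right (a := 𝓝 x))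
  exact e.toOpenPartialHomeomorph.injOn hxs hys (tendsto_nhds_unique h3 h4)

/-- Along an ultrafilter the base point converges because `B` is compact. In an orthogonal chart
near the limit the fibre coordinate stays in a closed ball of a finite dimensional space, so it
converges too. -/
theorem OrthogonalStructure.isCompact_norm_le [CompactSpace B] (ξ : OrthogonalStructure k m V)
    (r : ℝ) : IsCompact {x | ξ.norm x ≤ r} := by
  refine isCompact_iff_ultrafilter_le_nhds.2 fun f hf => ?_
  obtain ⟨b, hproj⟩ : ∃ b, Tendsto (π (Euc m) V) f (𝓝 b) := by
    have := isCompact_iff_ultrafilter_le_nhds.1 (isCompact_univ (X := B))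
      (f.map (π (Euc m) V)) (by simp)
    obtain ⟨b, _, hb⟩ := this
    exact ⟨b, hb⟩
  obtain ⟨e, he, hbe⟩ := ξ.cover b
  have hbase : ∀ᶠ x in (f : Filter (TotalSpace (Euc m) V)), x.proj ∈ e.baseSet :=
    hproj.eventually (e.open_baseSet.mem_nhds hbe)
  have hf' : ∀ᶠ x in (f : Filter (TotalSpace (Euc m) V)), ξ.norm x ≤ r := le_principal_iff.1 hf
  have hball : ↑(f.map fun x => (e x).2) ≤ 𝓟 (Metric.closedBall (0 : Euc m) r) := by
    rw [le_principal_iff]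
    change ∀ᶠ x in (f : Filter (TotalSpace (Euc m) V)), (e x).2 ∈ Metric.closedBall (0 : Euc m) r
    filter_upwards [hbase, hf'] with x h1 h2
    rw [ξ.norm_eq x e he h1] at h2
    simpa using h2
  obtain ⟨v, hv, hv2⟩ := isCompact_iff_ultrafilter_le_nhds.1
    (isCompact_closedBall (0 : Euc m) r) _ hball
  have hv2 : Tendsto (fun x => (e x).2) f (𝓝 v) := hv2
  have ht : (b, v) ∈ e.target := e.mem_target.2 hbe
  refine ⟨e.toOpenPartialHomeomorph.symm (b, v), ?_, ?_⟩
  · have h1 : (e.toOpenPartialHomeomorph.symm (b, v)).proj = b := e.proj_symm_apply ht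
    have h2 := ξ.norm_eq (e.toOpenPartialHomeomorph.symm (b, v)) e he (h1.symm ▸ hbe)
    have h3 : e (e.toOpenPartialHomeomorph.symm (b, v)) = (b, v) := e.apply_symm_apply ht
    rw [mem_ofPred_eq, h2, h3]
    simpa using hv
  · have h1 : Tendsto (fun x => e.toOpenPartialHomeomorph.symm (x.proj, (e x).2)) f
        (𝓝 (e.toOpenPartialHomeomorph.symm (b, v))) :=
      (e.toOpenPartialHomeomorph.continuousAt_symm ht).tendsto.comp (hproj.prodMk_nhds hv2)
    refine tendsto_id'.1 (h1.congr' ?_)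
    filter_upwards [hbase] with x hx
    have h2 : (x.proj, (e x).2) = e x := Prod.ext (Trivialization.coe_fst' _ hx).symm rfl
    rw [h2]
    exact e.symm_apply_apply ((Trivialization.mem_source _).2 hx)

/-- The square is needed: the norm itself is in general not smooth along the zero section. -/
theorem OrthogonalStructure.contMDiff_norm_sq (ξ : OrthogonalStructure k m V) :
    ContMDiff (totModel k m) 𝓘(ℝ, ℝ) ∞ fun x => ξ.norm x ^ 2 := by
  intro x
  obtain ⟨e, he, hx⟩ := ξ.cover x.proj
  have hxs : e.source ∈ 𝓝 x := e.open_source.mem_nhds ((Trivialization.mem_source _).2 hx)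
  have h1 : ContMDiffAt (totModel k m) 𝓘(ℝ, Euc m) ∞ (fun x => (e x).2) x :=
    ((ξ.smooth e he).contMDiffAt hxs).snd
  have h2 : ContMDiffAt (totModel k m) 𝓘(ℝ, ℝ) ∞ (fun x => ‖(e x).2‖ ^ 2) x :=
    (contDiff_norm_sq ℝ).contMDiff.contMDiffAt.comp x h1
  refine h2.congr_of_eventuallyEq ?_
  filter_upwards [hxs] with y hy
  rw [ξ.norm_eq y e he ((Trivialization.mem_source _).1 hy)]

theorem OrthogonalStructure.norm_smul (ξ : OrthogonalStructure k m V) (s : ℝ)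
    (x : TotalSpace (Euc m) V) : ξ.norm ⟨x.proj, s • x.2⟩ = |s| * ξ.norm x := by
  obtain ⟨e, he, hx⟩ := ξ.cover x.proj
  rw [ξ.norm_eq x e he hx, ξ.norm_eq ⟨x.proj, s • x.2⟩ e he hx,
    trivialization_smul e (ξ.linear e he) s x hx, _root_.norm_smul, Real.norm_eq_abs]

theorem OrthogonalStructure.norm_eq_zero_iff (ξ : OrthogonalStructure k m V)
    (x : TotalSpace (Euc m) V) : ξ.norm x = 0 ↔ x.2 = 0 := by
  obtain ⟨e, he, hx⟩ := ξ.cover x.proj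
  rw [ξ.norm_eq x e he hx, norm_eq_zero]
  have := ξ.linear e he
  have h0 : (e ⟨x.proj, 0⟩).2 = 0 := (e.linear ℝ hx).map_zero
  constructor
  · intro h
    have h1 : e x = e ⟨x.proj, 0⟩ := by
      refine Prod.ext ?_ (h.trans h0.symm)
      rw [Trivialization.coe_fst' _ hx, Trivialization.coe_fst' _ (by exact hx)]
    have h2 := e.injOn ((Trivialization.mem_source _).2 hx)
      ((Trivialization.mem_source _).2 (by exact hx)) h1
    have := congrArg (fun y : TotalSpace (Euc m) V => y) h2
    obtain ⟨b, v⟩ := x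
    simpa using this
  · intro h
    obtain ⟨b, v⟩ := x
    obtain rfl : v = 0 := h
    exact h0

end SinglePiece

/-! ### Charts of the whole total space, and multiplication by scalars in these charts. -/

section Total

variable {ι : Type*} (k : ι → ℕ) {m : ι → ℕ} {B : ι → Type*}
  [∀ i, TopologicalSpace (B i)] [∀ i, ChartedSpace (Euc (k i)) (B i)]
  {V : ∀ i, B i → Type*}
  [∀ i b, AddCommGroup (V i b)] [∀ i b, Module ℝ (V i b)] [∀ i b, TopologicalSpace (V i b)]
  [∀ i, TopologicalSpace (TotalSpace (Euc (m i)) (V i))]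
  [∀ i, FiberBundle (Euc (m i)) (V i)] [∀ i, VectorBundle ℝ (Euc (m i)) (V i)]

/-- Image of the chart centred at `c`. -/
def chartImg (c : Tot m V) : Set (Euc (k c.1) × Euc (m c.1)) :=
  (extChartAt (totModel (k c.1) (m c.1)) c.2).target

variable {k}

theorem toPiece_mk (c : Tot m V) (x : TotalSpace (Euc (m c.1)) (V c.1)) :
    toPiece c ⟨c.1, x⟩ = x := by
  simp [toPiece]

theorem coord_mk (c : Tot m V) (x : TotalSpace (Euc (m c.1)) (V c.1)) :
    coord k c ⟨c.1, x⟩ = extChartAt (totModel (k c.1) (m c.1)) c.2 x := by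
  rw [coord, toPiece_mk]

theorem mk_mem_chartDom {c : Tot m V} {x : TotalSpace (Euc (m c.1)) (V c.1)} :
    (⟨c.1, x⟩ : Tot m V) ∈ chartDom k c ↔ x ∈ (extChartAt (totModel (k c.1) (m c.1)) c.2).source :=
  sigma_mk_injective.mem_set_image

theorem exists_of_mem_chartDom {c z : Tot m V} (hz : z ∈ chartDom k c) :
    ∃ x : TotalSpace (Euc (m c.1)) (V c.1), z = ⟨c.1, x⟩ ∧
      x ∈ (extChartAt (totModel (k c.1) (m c.1)) c.2).source := by
  obtain ⟨x, hx, rfl⟩ := hz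
  exact ⟨x, rfl, hx⟩

theorem mem_chartDom_self (c : Tot m V) : c ∈ chartDom k c :=
  ⟨c.2, mem_extChartAt_source c.2, rfl⟩

theorem isOpen_chartDom (c : Tot m V) : IsOpen (chartDom k c) :=
  isOpenMap_sigmaMk _ (isOpen_extChartAt_source c.2)

theorem isOpen_chartImg (c : Tot m V) : IsOpen (chartImg k c) :=
  isOpen_extChartAt_target c.2

theorem coord_mem {c z : Tot m V} (hz : z ∈ chartDom k c) : coord k c z ∈ chartImg k c := by
  obtain ⟨x, rfl, hx⟩ := exists_of_mem_chartDom hz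
  rw [coord_mk]
  exact (extChartAt (totModel (k c.1) (m c.1)) c.2).map_source hx

theorem coordSymm_mem {c : Tot m V} {u} (hu : u ∈ chartImg k c) :
    coordSymm k c u ∈ chartDom k c :=
  mk_mem_chartDom.2 ((extChartAt (totModel (k c.1) (m c.1)) c.2).map_target hu)

theorem coordSymm_coord {c z : Tot m V} (hz : z ∈ chartDom k c) :
    coordSymm k c (coord k c z) = z := by
  obtain ⟨x, rfl, hx⟩ := exists_of_mem_chartDom hz
  rw [coord_mk, coordSymm, (extChartAt (totModel (k c.1) (m c.1)) c.2).left_inv hx]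

theorem coord_coordSymm {c : Tot m V} {u} (hu : u ∈ chartImg k c) :
    coord k c (coordSymm k c u) = u := by
  rw [coordSymm, coord_mk]
  exact (extChartAt (totModel (k c.1) (m c.1)) c.2).right_inv hu

theorem continuousOn_coord (c : Tot m V) : ContinuousOn (coord k c) (chartDom k c) := by
  intro z hz
  obtain ⟨x, rfl, hx⟩ := exists_of_mem_chartDom hz
  have h1 : ContinuousAt (fun x => coord k c ⟨c.1, x⟩) x := by
    simp_rw [coord_mk]
    exact continuousAt_extChartAt' hx
  have h2 : ContinuousAt (coord k c) ⟨c.1, x⟩ :=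
    (IsOpenEmbedding.sigmaMk (i := c.1)).continuousAt_iff.1 h1
  exact h2.continuousWithinAt

theorem continuousAt_coord {c z : Tot m V} (hz : z ∈ chartDom k c) :
    ContinuousAt (coord k c) z :=
  (continuousOn_coord c).continuousAt ((isOpen_chartDom c).mem_nhds hz)

theorem continuousOn_coordSymm (c : Tot m V) : ContinuousOn (coordSymm k c) (chartImg k c) :=
  continuous_sigmaMk.comp_continuousOn (continuousOn_extChartAt_symm c.2)

theorem continuousAt_coordSymm {c : Tot m V} {u} (hu : u ∈ chartImg k c) :
    ContinuousAt (coordSymm k c) u :=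
  (continuousOn_coordSymm c).continuousAt ((isOpen_chartImg c).mem_nhds hu)

theorem injOn_coord (c : Tot m V) : InjOn (coord k c) (chartDom k c) :=
  fun z hz w hw h => by rw [← coordSymm_coord hz, h, coordSymm_coord hw]

variable (k) in
/-- The part of the base over which the chart centred at `c` is defined. -/
def baseDom (c : Tot m V) : Set (B c.1) :=
  (trivializationAt (Euc (m c.1)) (V c.1) c.2.proj).baseSet ∩
    (extChartAt (𝓡 (k c.1)) c.2.proj).source

theorem mk_mem_chartDom_iff {c : Tot m V} {x : TotalSpace (Euc (m c.1)) (V c.1)} :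
    (⟨c.1, x⟩ : Tot m V) ∈ chartDom k c ↔ x.proj ∈ baseDom k c :=
  mk_mem_chartDom.trans (mem_extChartAt_source_iff c.2 x)

/-- Membership in a chart domain depends only on the base point. -/
theorem mem_chartDom_congr {c : Tot m V} {i : ι} {x y : TotalSpace (Euc (m i)) (V i)}
    (h : x.proj = y.proj) :
    (⟨i, x⟩ : Tot m V) ∈ chartDom k c ↔ (⟨i, y⟩ : Tot m V) ∈ chartDom k c := by
  by_cases hi : i = c.1
  · subst hi
    rw [mk_mem_chartDom_iff, mk_mem_chartDom_iff, h]
  · have : ∀ x : TotalSpace (Euc (m i)) (V i), (⟨i, x⟩ : Tot m V) ∉ chartDom k c := by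
      rintro x ⟨y, -, hy⟩
      exact hi (congrArg Sigma.fst hy).symm
    exact iff_of_false (this x) (this y)

theorem scale_mem_chartDom {c z : Tot m V} {s : ℝ} :
    scale s z ∈ chartDom k c ↔ z ∈ chartDom k c :=
  mem_chartDom_congr rfl

theorem scale_one (z : Tot m V) : scale 1 z = z := by
  obtain ⟨i, b, v⟩ := z
  simp [scale]

theorem scale_scale (s t : ℝ) (z : Tot m V) : scale s (scale t z) = scale (s * t) z :=
  congrArg (fun v => (⟨z.1, ⟨z.2.proj, v⟩⟩ : Tot m V)) (mul_smul s t z.2.2).symm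

theorem scale_zero (z : Tot m V) : scale 0 z = ⟨z.1, ⟨z.2.proj, 0⟩⟩ := by
  simp [scale]

theorem scale_zero_mem (z : Tot m V) : scale 0 z ∈ zeroSec m V := by
  simp [scale, zeroSec]

theorem scale_of_mem_zeroSec {z : Tot m V} (hz : z ∈ zeroSec m V) (s : ℝ) : scale s z = z := by
  obtain ⟨i, b, v⟩ := z
  obtain rfl : v = 0 := hz
  simp [scale]

theorem coord_scale {c z : Tot m V} (hz : z ∈ chartDom k c) (s : ℝ) :
    coord k c (scale s z) = ((coord k c z).1, s • (coord k c z).2) := by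
  obtain ⟨x, rfl, hx⟩ := exists_of_mem_chartDom hz
  rw [mem_extChartAt_source_iff] at hx
  rw [scale, coord_mk, coord_mk, extChartAt_apply _ _ hx.1, extChartAt_apply _ _ (by exact hx.1),
    trivialization_smul _ inferInstance s x hx.1]

theorem mem_chartImg_of_fst {c : Tot m V} {u w : Euc (k c.1) × Euc (m c.1)} (h : u.1 = w.1)
    (hu : u ∈ chartImg k c) : w ∈ chartImg k c := by
  rw [chartImg, extChartAt_target_eq] at hu ⊢
  exact ⟨h ▸ hu.1, mem_univ _⟩

theorem coordSymm_smul {c : Tot m V} {u : Euc (k c.1) × Euc (m c.1)} (hu : u ∈ chartImg k c)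
    (s : ℝ) : coordSymm k c (u.1, s • u.2) = scale s (coordSymm k c u) := by
  have h1 : (u.1, s • u.2) ∈ chartImg k c := mem_chartImg_of_fst (by rfl) hu
  refine injOn_coord (k := k) c (coordSymm_mem h1)
    (scale_mem_chartDom.2 (coordSymm_mem hu)) ?_
  rw [coord_coordSymm h1, coord_scale (coordSymm_mem hu), coord_coordSymm hu]

theorem mem_zeroSec_iff {c z : Tot m V} (hz : z ∈ chartDom k c) :
    z ∈ zeroSec m V ↔ (coord k c z).2 = 0 := by
  constructor
  · intro h
    have := coord_scale hz 0
    rw [scale_of_mem_zeroSec h] at this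
    rw [this]
    simp
  · intro h
    have : scale 0 z = z := by
      refine injOn_coord (k := k) c (scale_mem_chartDom.2 hz) hz ?_
      rw [coord_scale hz]
      exact Prod.ext rfl (by simp [h])
    rw [← this]
    exact scale_zero_mem z

/-- The conclusion does not mention `k`, which enters only through the charts of the proof; hence it
is explicit. -/
theorem continuous_scale (k : ι → ℕ) [∀ i, ChartedSpace (Euc (k i)) (B i)] : Continuous fun p : ℝ × Tot m V => scale p.1 p.2 := by
  rw [continuous_iff_continuousAt]
  rintro ⟨s, z⟩
  have hz := mem_chartDom_self (k := k) z
  have h1 : ContinuousAt (fun p : ℝ × Tot m V => coord k z p.2) (s, z) :=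
    ContinuousAt.comp (f := Prod.snd) (continuousAt_coord hz) continuousAt_snd
  have h2 : ContinuousAt
      (fun p : ℝ × Tot m V => ((coord k z p.2).1, p.1 • (coord k z p.2).2)) (s, z) :=
    h1.fst.prodMk (continuousAt_fst.smul h1.snd)
  have h3 : ContinuousAt (fun p : ℝ × Tot m V =>
      coordSymm k z ((coord k z p.2).1, p.1 • (coord k z p.2).2)) (s, z) := by
    refine ContinuousAt.comp (g := coordSymm k z) ?_ h2
    exact continuousAt_coordSymm (mem_chartImg_of_fst (by rfl) (coord_mem hz))
  refine h3.congr ?_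
  filter_upwards [continuousAt_snd.eventually ((isOpen_chartDom (k := k) z).mem_nhds hz)] with p hp
  rw [coordSymm_smul (coord_mem hp), coordSymm_coord hp]

theorem continuousAt_of_coord {X : Type*} [TopologicalSpace X] {f : X → Tot m V} {x : X}
    {c : Tot m V} (h1 : ∀ᶠ y in 𝓝 x, f y ∈ chartDom k c)
    (h2 : ContinuousAt (fun y => coord k c (f y)) x) : ContinuousAt f x := by
  have h3 : ContinuousAt (fun y => coordSymm k c (coord k c (f y))) x :=
    ContinuousAt.comp (g := coordSymm k c)
      (continuousAt_coordSymm (coord_mem h1.self_of_nhds)) h2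
  exact h3.congr (h1.mono fun y hy => coordSymm_coord hy)

theorem nrm_scale (ξ : ∀ i, OrthogonalStructure (k i) (m i) (V i)) (s : ℝ) (z : Tot m V) :
    nrm ξ (scale s z) = |s| * nrm ξ z := (ξ z.1).norm_smul s z.2

theorem nrm_eq_zero_iff (ξ : ∀ i, OrthogonalStructure (k i) (m i) (V i)) (z : Tot m V) :
    nrm ξ z = 0 ↔ z ∈ zeroSec m V := (ξ z.1).norm_eq_zero_iff z.2

theorem nrm_nonneg (ξ : ∀ i, OrthogonalStructure (k i) (m i) (V i)) (z : Tot m V) :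
    0 ≤ nrm ξ z := norm_nonneg _

theorem isCompact_nrm_le [Finite ι] [∀ i, CompactSpace (B i)]
    (ξ : ∀ i, OrthogonalStructure (k i) (m i) (V i)) (r : ℝ) : IsCompact {z | nrm ξ z ≤ r} := by
  have : {z | nrm ξ z ≤ r} = ⋃ i, Sigma.mk i '' {x | (ξ i).norm x ≤ r} := by
    ext ⟨i, x⟩
    refine ⟨fun h => mem_iUnion.2 ⟨i, x, h, rfl⟩, fun h => ?_⟩
    obtain ⟨j, y, hy, h⟩ := mem_iUnion.1 h
    rw [← h]
    exact hy
  rw [this]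
  exact isCompact_iUnion fun i => ((ξ i).isCompact_norm_le r).image continuous_sigmaMk

theorem t2Space_tot [∀ i, T2Space (B i)] : T2Space (Tot m V) := by
  have : ∀ i, T2Space (TotalSpace (Euc (m i)) (V i)) := fun i => t2Space_totalSpace
  infer_instance

section Smooth

variable [∀ i, IsManifold (𝓡 (k i)) ∞ (B i)]
  [∀ i, ContMDiffVectorBundle ∞ (Euc (m i)) (V i) (𝓡 (k i))]

theorem contDiffOn_nrm_sq (ξ : ∀ i, OrthogonalStructure (k i) (m i) (V i)) (c : Tot m V) :
    ContDiffOn ℝ ∞ (fun u => nrm ξ (coordSymm k c u) ^ 2) (chartImg k c) := by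
  have h1 := (ξ c.1).contMDiff_norm_sq.comp_contMDiffOn
    (contMDiffOn_extChartAt_symm (I := totModel (k c.1) (m c.1)) (n := ∞) c.2)
  exact contMDiffOn_iff_contDiffOn.1 h1

theorem continuous_nrm (ξ : ∀ i, OrthogonalStructure (k i) (m i) (V i)) :
    Continuous (nrm ξ) := by
  have h : Continuous fun z => nrm ξ z ^ 2 :=
    continuous_sigma fun i => (ξ i).contMDiff_norm_sq.continuous
  have h2 := h.sqrt
  simp_rw [Real.sqrt_sq (nrm_nonneg ξ _)] at h2
  exact h2

/-- Multiplication by a small scalar carries the compact unit ball into any given neighbourhood of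
the zero section, by the tube lemma, and a nonzero vector is its norm times a unit vector. -/
theorem eventually_nrm_subset [Finite ι] [∀ i, CompactSpace (B i)]
    (ξ : ∀ i, OrthogonalStructure (k i) (m i) (V i)) {O : Set (Tot m V)}
    (hO : O ∈ 𝓝ˢ (zeroSec m V)) : ∀ᶠ r in 𝓝 (0 : ℝ), {z | nrm ξ z ≤ r} ⊆ O := by
  have h1 : ∀ᶠ s in 𝓝 (0 : ℝ), ∀ z ∈ {z | nrm ξ z ≤ 1}, scale s z ∈ interior O := by
    refine (isCompact_nrm_le ξ 1).eventually_forall_of_forall_eventually fun z _ => ?_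
    have h := (continuous_scale (V := V) k).continuousAt (x := ((0 : ℝ), z))
    refine h.eventually (isOpen_interior.mem_nhds ?_)
    exact subset_interior_iff_mem_nhdsSet.2 hO (scale_zero_mem z)
  obtain ⟨ε, hε, h⟩ := Metric.eventually_nhds_iff.1 h1
  filter_upwards [gt_mem_nhds hε] with r hr z hz
  have hz : nrm ξ z ≤ r := hz
  rcases (nrm_nonneg ξ z).eq_or_lt with h0 | h0
  · exact interior_subset
      (subset_interior_iff_mem_nhdsSet.2 hO ((nrm_eq_zero_iff ξ z).1 h0.symm))
  · have h2 := h (y := nrm ξ z) (by simpa [abs_of_pos h0] using hz.trans_lt hr)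
      (scale (nrm ξ z)⁻¹ z) (by
        rw [mem_ofPred_eq, nrm_scale, abs_of_pos (inv_pos.2 h0), inv_mul_cancel₀ h0.ne'])
    rw [scale_scale, mul_inv_cancel₀ h0.ne', scale_one] at h2
    exact interior_subset h2

end Smooth

end Total

/-! ### Domains with boundary, and maps written in charts. -/

/-- A set that contains one side of a regular level hypersurface through a point has unique
derivatives at this point. -/
theorem uniqueDiffWithinAt_of_hasFDerivAt {E : Type*} [NormedAddCommGroup E] [NormedSpace ℝ E]
    {f : E → ℝ} {f' : E →L[ℝ] ℝ} {s : Set E} {x : E} (hf : HasFDerivAt f f' x) (h0 : f x = 0)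
    (hf' : f' ≠ 0) (hx : x ∈ s) (hs : ∀ᶠ y in 𝓝 x, 0 ≤ f y → y ∈ s) :
    UniqueDiffWithinAt ℝ s x := by
  -- Along a direction in which `f` increases, `f` is positive for small positive times, so the ray
  -- stays in `s`. These directions form an open half space, which spans.
  have key : ∀ v, 0 < f' v → v ∈ tangentConeAt ℝ s x := by
    intro v hv
    have hline : HasDerivAt (fun t : ℝ => f (x + t • v)) (f' v) 0 := by
      have h1 : HasDerivAt (fun t : ℝ => x + t • v) v 0 := by
        simpa using ((hasDerivAt_id (0 : ℝ)).smul_const v).const_add x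
      have h2 : HasFDerivAt f f' (x + (0 : ℝ) • v) := by simpa using hf
      exact h2.comp_hasDerivAt (0 : ℝ) h1
    have hpos : ∀ᶠ t in 𝓝[>] (0 : ℝ), 0 < f (x + t • v) := by
      have h2 := hline.hasDerivWithinAt (s := Ioi 0)
      rw [hasDerivWithinAt_iff_tendsto_slope' (by simp)] at h2
      filter_upwards [h2.eventually (lt_mem_nhds hv), self_mem_nhdsWithin] with t h3 h4
      rw [slope_def_field] at h3
      have h4 : 0 < t := h4
      simp only [zero_smul, add_zero, h0, sub_zero] at h3
      exact (div_pos_iff_of_pos_right h4).1 h3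
    refine mem_tangentConeAt_of_add_smul_mem (l := 𝓝[>] (0 : ℝ)) (c := id) ?_ ?_
    · exact tendsto_id.mono_left (nhdsWithin_mono _ fun t (ht : 0 < t) => ht.ne')
    · have h3 : Tendsto (fun t : ℝ => x + t • v) (𝓝[>] 0) (𝓝 x) := by
        refine (Continuous.tendsto' ?_ 0 x (by simp)).mono_left nhdsWithin_le_nhds
        fun_prop
      filter_upwards [hpos, h3.eventually hs] with t h4 h5 using h5 h4.le
  obtain ⟨v₀, hv₀⟩ : ∃ v, 0 < f' v := by
    obtain ⟨v, hv⟩ : ∃ v, f' v ≠ 0 := by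
      by_contra! h
      exact hf' (ContinuousLinearMap.ext h)
    rcases hv.lt_or_gt with h | h
    · exact ⟨-v, by simpa using h⟩
    · exact ⟨v, h⟩
  refine ⟨?_, subset_closure hx⟩
  have : (Submodule.span ℝ (tangentConeAt ℝ s x) : Set E) = univ := by
    refine eq_univ_of_forall fun w => ?_
    -- With this `t`, `f' (w + t v₀) = f' w + 1 + |f' w| > 0`, so `w` is a difference of vectors of
    -- the span.
    set t : ℝ := (1 + |f' w|) / f' v₀
    have h1 : 0 < f' (w + t • v₀) := by
      have : t * f' v₀ = 1 + |f' w| := div_mul_cancel₀ _ hv₀.ne'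
      simp only [map_add, map_smul, smul_eq_mul, this]
      linarith [neg_abs_le (f' w)]
    have h2 : w = (w + t • v₀) - t • v₀ := by simp
    rw [h2]
    exact Submodule.sub_mem _ (Submodule.subset_span (key _ h1))
      (Submodule.smul_mem _ _ (Submodule.subset_span (key _ hv₀)))
  rw [this]
  exact dense_univ

section Total

variable {ι : Type*} (k : ι → ℕ) {m : ι → ℕ} {B : ι → Type*}
  [∀ i, TopologicalSpace (B i)] [∀ i, ChartedSpace (Euc (k i)) (B i)]
  {V : ∀ i, B i → Type*}
  [∀ i b, AddCommGroup (V i b)] [∀ i b, Module ℝ (V i b)] [∀ i b, TopologicalSpace (V i b)]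
  [∀ i, TopologicalSpace (TotalSpace (Euc (m i)) (V i))]
  [∀ i, FiberBundle (Euc (m i)) (V i)] [∀ i, VectorBundle ℝ (Euc (m i)) (V i)]

/-- The map `g` in the charts centred at `c` and `c'`. -/
def rep (g : Tot m V → Tot m V) (c c' : Tot m V) (u : Euc (k c.1) × Euc (m c.1)) :
    Euc (k c'.1) × Euc (m c'.1) := coord k c' (g (coordSymm k c u))

/-- The image of a set in the chart centred at `c`. -/
def chartSet (S : Set (Tot m V)) (c : Tot m V) : Set (Euc (k c.1) × Euc (m c.1)) :=
  coord k c '' (S ∩ chartDom k c)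

variable {k}

theorem chartSet_eq (S : Set (Tot m V)) (c : Tot m V) :
    chartSet k S c = chartImg k c ∩ coordSymm k c ⁻¹' S := by
  ext u
  constructor
  · rintro ⟨z, hz, rfl⟩
    exact ⟨coord_mem hz.2, by rw [mem_preimage, coordSymm_coord hz.2]; exact hz.1⟩
  · rintro ⟨h1, h2⟩
    exact ⟨coordSymm k c u, ⟨h2, coordSymm_mem h1⟩, coord_coordSymm h1⟩

theorem coord_mem_chartSet {S : Set (Tot m V)} {c z : Tot m V} (hz : z ∈ S)
    (hc : z ∈ chartDom k c) : coord k c z ∈ chartSet k S c := ⟨z, ⟨hz, hc⟩, rfl⟩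

theorem chartSet_mem_nhds {S : Set (Tot m V)} {c z : Tot m V} (hz : z ∈ interior S)
    (hc : z ∈ chartDom k c) : chartSet k S c ∈ 𝓝 (coord k c z) := by
  rw [chartSet_eq]
  refine inter_mem ((isOpen_chartImg c).mem_nhds (coord_mem hc))
    ((continuousAt_coordSymm (coord_mem hc)).preimage_mem_nhds ?_)
  rw [coordSymm_coord hc]
  exact mem_interior_iff_mem_nhds.1 hz

theorem tendsto_coord_nhdsWithin {S : Set (Tot m V)} {c z : Tot m V} (hc : z ∈ chartDom k c) :
    Tendsto (coord k c) (𝓝[S] z) (𝓝[chartSet k S c] (coord k c z)) := by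
  refine tendsto_nhdsWithin_iff.2 ⟨(continuousAt_coord hc).mono_left nhdsWithin_le_nhds, ?_⟩
  filter_upwards [self_mem_nhdsWithin,
    nhdsWithin_le_nhds ((isOpen_chartDom c).mem_nhds hc)] with w h1 h2
  exact coord_mem_chartSet h1 h2

theorem tendsto_coordSymm_nhdsWithin {S : Set (Tot m V)} {c z : Tot m V}
    (hc : z ∈ chartDom k c) :
    Tendsto (coordSymm k c) (𝓝[chartSet k S c] (coord k c z)) (𝓝[S] z) := by
  refine tendsto_nhdsWithin_iff.2 ⟨?_, ?_⟩
  · have := continuousAt_coordSymm (coord_mem hc)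
    rw [ContinuousAt, coordSymm_coord hc] at this
    exact this.mono_left nhdsWithin_le_nhds
  · filter_upwards [self_mem_nhdsWithin] with u hu
    rw [chartSet_eq] at hu
    exact hu.2

/-- `N` need not be closed, but near a point it is `{ρ ≥ 0}`; intersecting with a compact
neighbourhood on which `ρ` is continuous keeps compactness. -/
theorem exists_isCompact_nhdsWithin {N : Set (Tot m V)} (hN : IsDomain k N) (z : Tot m V) (hz : z ∈ N)
    {O : Set (Tot m V)} (hO : O ∈ 𝓝 z) : ∃ K, IsCompact K ∧ K ⊆ N ∩ O ∧ K ∈ 𝓝[N] z := by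
  obtain ⟨i, x⟩ := z
  obtain ⟨U, hU, hxU, ρ, hρ, hρN, -⟩ := hN i x hz
  have : LocallyCompactSpace (TotalSpace (Euc (m i)) (V i)) :=
    Manifold.locallyCompact_of_finiteDimensional (totModel (k i) (m i))
  set O' : Set (TotalSpace (Euc (m i)) (V i)) := {y | (⟨i, y⟩ : Tot m V) ∈ O}
  have hO' : O' ∈ 𝓝 x := continuous_sigmaMk.continuousAt hO
  obtain ⟨K, hK, hKc⟩ := exists_compact_subset (isOpen_interior (s := U ∩ O'))
    (mem_interior_iff_mem_nhds.2 (inter_mem (hU.mem_nhds hxU) hO'))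
  have hKU : K ⊆ U ∩ O' := hKc.2.trans interior_subset
  have hcl : IsCompact (K ∩ ρ ⁻¹' Ici 0) := by
    have h1 : ContinuousOn (K.domRestrict ρ) univ := by
      rw [continuousOn_univ]
      exact continuousOn_iff_continuous_domRestrict.1
        (hρ.continuousOn.mono fun y hy => (hKU hy).1)
    have h2 : IsClosed (K.domRestrict ρ ⁻¹' Ici 0) :=
      isClosed_Ici.preimage (continuousOn_univ.1 h1)
    have : CompactSpace K := isCompact_iff_compactSpace.1 hK
    have h3 := h2.isCompact.image continuous_subtype_val
    convert h3 using 1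
    ext y
    refine ⟨fun h => ⟨⟨y, h.1⟩, h.2, rfl⟩, ?_⟩
    rintro ⟨w, hw, rfl⟩
    exact ⟨w.2, hw⟩
  refine ⟨Sigma.mk i '' (K ∩ ρ ⁻¹' Ici 0), hcl.image continuous_sigmaMk, ?_, ?_⟩
  · rintro _ ⟨y, hy, rfl⟩
    exact ⟨(hρN y (hKU hy.1).1).2 hy.2, (hKU hy.1).2⟩
  · have h4 : Sigma.mk i '' interior K ∈ 𝓝 (⟨i, x⟩ : Tot m V) :=
      (isOpenMap_sigmaMk _ isOpen_interior).mem_nhds ⟨x, hKc.1, rfl⟩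
    filter_upwards [self_mem_nhdsWithin, nhdsWithin_le_nhds h4] with w hw h5
    obtain ⟨y, hy, rfl⟩ := h5
    exact ⟨y, ⟨interior_subset hy, (hρN y (hKU (interior_subset hy)).1).1 hw⟩, rfl⟩

section Smooth

variable [∀ i, IsManifold (𝓡 (k i)) ∞ (B i)]
  [∀ i, ContMDiffVectorBundle ∞ (Euc (m i)) (V i) (𝓡 (k i))]

/-- This makes derivatives within `N` unique, hence continuous up to the boundary. Points with `ρ >
0` are interior; where `ρ = 0`, the regular value condition, carried to the chart by the chain rule,
supplies a half space of tangent directions. -/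
theorem uniqueDiffOn_chartSet {N : Set (Tot m V)} (hN : IsDomain k N) (c : Tot m V) :
    UniqueDiffOn ℝ (chartSet k N c) := by
  intro u hu
  have hu' := hu
  rw [chartSet_eq] at hu'
  obtain ⟨h1, h2⟩ := hu'
  set e := extChartAt (totModel (k c.1) (m c.1)) c.2
  obtain ⟨U, hU, hxU, ρ, hρ, hρN, hρ0⟩ := hN c.1 (e.symm u) h2
  have hO : e.symm ⁻¹' U ∩ chartImg k c ∈ 𝓝 u :=
    inter_mem ((continuousAt_extChartAt_symm'' h1).preimage_mem_nhds (hU.mem_nhds hxU))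
      ((isOpen_chartImg c).mem_nhds h1)
  have hρu : 0 ≤ ρ (e.symm u) := (hρN _ hxU).1 h2
  have hsmooth : ContMDiffAt (totModel (k c.1) (m c.1)) 𝓘(ℝ, ℝ) ∞ ρ (e.symm u) :=
    hρ.contMDiffAt (hU.mem_nhds hxU)
  have hsymm : ContMDiffAt 𝓘(ℝ, Euc (k c.1) × Euc (m c.1)) (totModel (k c.1) (m c.1)) ∞
      e.symm u := (contMDiffOn_extChartAt_symm c.2).contMDiffAt ((isOpen_chartImg c).mem_nhds h1)
  have hcomp : ContDiffAt ℝ ∞ (ρ ∘ e.symm) u := contMDiffAt_iff_contDiffAt.1 (hsmooth.comp u hsymm)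
  rcases hρu.eq_or_lt with h0 | h0
  · refine uniqueDiffWithinAt_of_hasFDerivAt (f := ρ ∘ e.symm)
      (hcomp.differentiableAt (by simp)).hasFDerivAt h0.symm ?_ hu ?_
    · intro hzero
      refine hρ0 _ hxU h0.symm ?_
      have hsrc : e.symm u ∈ e.source := e.map_target h1
      have h3 : ContMDiffAt (totModel (k c.1) (m c.1)) 𝓘(ℝ, Euc (k c.1) × Euc (m c.1)) ∞ e
          (e.symm u) := contMDiffAt_extChartAt' (by rwa [← extChartAt_source (totModel _ _)])
      have h4 : ρ =ᶠ[𝓝 (e.symm u)] (ρ ∘ e.symm) ∘ e := by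
        filter_upwards [(isOpen_extChartAt_source c.2).mem_nhds hsrc] with y hy
        simp only [Function.comp]
        rw [e.left_inv hy]
      have h5 : e (e.symm u) = u := e.right_inv h1
      rw [h4.mfderiv_eq, mfderiv_comp_of_eq (y := u) (I' := 𝓘(ℝ, Euc (k c.1) × Euc (m c.1)))
        (hcomp.contMDiffAt.mdifferentiableAt (by simp)) (h3.mdifferentiableAt (by simp)) h5,
        mfderiv_eq_fderiv]
      have h6 : fderiv ℝ (ρ ∘ e.symm) (e (e.symm u)) = 0 := by rw [h5]; exact hzero
      exact ContinuousLinearMap.ext fun v => DFunLike.congr_fun h6 _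
    · filter_upwards [hO] with y hy h6
      rw [chartSet_eq]
      exact ⟨hy.2, (hρN _ hy.1).2 h6⟩
  · refine uniqueDiffWithinAt_of_mem_nhds ?_
    have h6 : ∀ᶠ y in 𝓝 u, 0 < (ρ ∘ e.symm) y := hcomp.continuousAt.eventually (lt_mem_nhds h0)
    filter_upwards [h6, hO] with y h7 hy
    rw [chartSet_eq]
    exact ⟨hy.2, (hρN _ hy.1).2 (le_of_lt h7)⟩

theorem toPiece_of_mem {c c' z : Tot m V} (hz : z.1 = c.1) :
    coord k c' ⟨c.1, toPiece c z⟩ = coord k c' z := by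
  obtain ⟨j, y⟩ := z
  obtain rfl : j = c.1 := hz
  rw [toPiece_mk]

theorem fst_eq_of_mem_chartDom {c z : Tot m V} (hz : z ∈ chartDom k c) : z.1 = c.1 := by
  obtain ⟨x, -, rfl⟩ := hz
  rfl

theorem continuousAt_toPiece {c : Tot m V} (y : TotalSpace (Euc (m c.1)) (V c.1)) :
    ContinuousAt (toPiece c) ⟨c.1, y⟩ := by
  have h1 : ContinuousAt (fun x => toPiece c ⟨c.1, x⟩) y := by
    simp_rw [toPiece_mk]
    exact continuousAt_id
  exact (IsOpenEmbedding.sigmaMk (i := c.1)).continuousAt_iff.1 h1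

theorem nhdsWithin_preimage_symm {S : Set (Tot m V)} {c : Tot m V}
    {x : TotalSpace (Euc (m c.1)) (V c.1)}
    (hx : x ∈ (extChartAt (totModel (k c.1) (m c.1)) c.2).source) :
    ((extChartAt (totModel (k c.1) (m c.1)) c.2).symm ⁻¹' slice S c.1 ∩
      range (totModel (k c.1) (m c.1)) : Set _) =ᶠ[𝓝 (coord k c ⟨c.1, x⟩)] chartSet k S c := by
  have h1 := coord_mem (k := k) (mk_mem_chartDom.2 hx)
  filter_upwards [(isOpen_chartImg c).mem_nhds h1] with u hu
  rw [ModelWithCorners.Boundaryless.range_eq_univ, inter_univ, chartSet_eq]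
  exact propext ⟨fun h => ⟨hu, h⟩, fun h => h.2⟩

theorem contMDiffWithinAt_loc_iff {g : Tot m V → Tot m V} {S : Set (Tot m V)} {c c' : Tot m V}
    {x : TotalSpace (Euc (m c.1)) (V c.1)}
    (hx : (⟨c.1, x⟩ : Tot m V) ∈ chartDom k c) (hg : ContinuousWithinAt g S ⟨c.1, x⟩)
    (hgx : g ⟨c.1, x⟩ ∈ chartDom k c') :
    ContMDiffWithinAt (totModel (k c.1) (m c.1))
      (totModel (k (g ⟨c.1, x⟩).1) (m (g ⟨c.1, x⟩).1)) ∞ (loc g c.1 x) (slice S c.1) x ↔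
    ContDiffWithinAt ℝ ∞ (rep k g c c') (chartSet k S c) (coord k c ⟨c.1, x⟩) := by
  -- The target type depends on the value of `g` at the point. Replacing this value by a variable
  -- allows its index to be unified with that of `c'`.
  have main : ∀ w : Tot m V, g ⟨c.1, x⟩ = w → (ContMDiffWithinAt (totModel (k c.1) (m c.1))
      (totModel (k w.1) (m w.1)) ∞ (fun x' => toPiece w (g ⟨c.1, x'⟩)) (slice S c.1) x ↔
      ContDiffWithinAt ℝ ∞ (rep k g c c') (chartSet k S c) (coord k c ⟨c.1, x⟩)) := by
    intro w hw
    have hw' := hgx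
    rw [hw] at hw'
    have hsrc := mk_mem_chartDom.1 hx
    have hcont : ContinuousWithinAt (fun x' => toPiece w (g ⟨c.1, x'⟩)) (slice S c.1) x := by
      have h1 : ContinuousWithinAt (fun x' => g ⟨c.1, x'⟩) (slice S c.1) x :=
        ContinuousWithinAt.comp (g := g) hg continuous_sigmaMk.continuousWithinAt
          fun y hy => hy
      refine ContinuousAt.comp_continuousWithinAt (g := toPiece w) ?_ h1
      rw [hw]
      exact continuousAt_toPiece w.2
    obtain ⟨j, y⟩ := w
    obtain ⟨j', y'⟩ := c'
    obtain rfl : j = j' := fst_eq_of_mem_chartDom hw'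
    rw [contMDiffWithinAt_iff_of_mem_source (x := c.2) (y := y')
      (by rwa [← extChartAt_source (totModel _ _)]) (by
        rw [hw, ← extChartAt_source (totModel (k j) (m j))]
        have := mk_mem_chartDom.1 hw'
        rwa [toPiece_mk (⟨j, y⟩ : Tot m V)])]
    rw [and_iff_right hcont, coord_mk]
    have hset := nhdsWithin_preimage_symm (k := k) (S := S) hsrc
    rw [coord_mk] at hset
    rw [contDiffWithinAt_congr_set hset]
    have hev : ∀ᶠ u in 𝓝[chartSet k S c] (extChartAt (totModel (k c.1) (m c.1)) c.2 x),
        (g (coordSymm k c u)).1 = j := by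
      have h2 := (tendsto_coordSymm_nhdsWithin (k := k) (S := S) hx)
      rw [coord_mk] at h2
      have h3 := hg.tendsto.comp h2
      have h4 : Sigma.fst ⁻¹' {j} ∈ 𝓝 (g ⟨c.1, x⟩) := by
        have : IsOpen (Sigma.fst ⁻¹' {j} : Set (Tot m V)) := by
          rw [← range_sigmaMk]
          exact isOpen_range_sigmaMk
        refine this.mem_nhds ?_
        rw [hw]
        rfl
      exact h3 h4
    refine Filter.EventuallyEq.congr_contDiffWithinAt ?_ ?_
    · filter_upwards [hev] with u hu
      have := toPiece_of_mem (k := k) (c := ⟨j, y⟩) (c' := ⟨j, y'⟩) hu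
      rw [rep, ← this, coord_mk]
      rfl
    · have h5 : coordSymm k c (extChartAt (totModel (k c.1) (m c.1)) c.2 x) = ⟨c.1, x⟩ := by
        rw [← coord_mk, coordSymm_coord hx]
      have := toPiece_of_mem (k := k) (c := ⟨j, y⟩) (c' := ⟨j, y'⟩)
        (z := g (coordSymm k c (extChartAt (totModel (k c.1) (m c.1)) c.2 x))) (by rw [h5, hw])
      rw [rep, ← this, coord_mk]
      rfl
  exact main _ rfl

/-- The tangent map is by definition computed in the charts centred at the point and at its image,
so only these occur here; `injective_fderiv_rep` later passes to other charts at interior points. -/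
theorem mfderivWithin_loc_injective_iff {g : Tot m V → Tot m V} {S : Set (Tot m V)} {i : ι}
    {x : TotalSpace (Euc (m i)) (V i)} {w : Tot m V} (hw : g ⟨i, x⟩ = w)
    (hd : MDifferentiableWithinAt (totModel (k i) (m i))
      (totModel (k (g ⟨i, x⟩).1) (m (g ⟨i, x⟩).1)) (loc g i x) (slice S i) x) :
    Function.Injective (mfderivWithin (totModel (k i) (m i))
      (totModel (k (g ⟨i, x⟩).1) (m (g ⟨i, x⟩).1)) (loc g i x) (slice S i) x) ↔
    Function.Injective (fderivWithin ℝ (rep k g ⟨i, x⟩ w)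
      (chartSet k S ⟨i, x⟩) (coord k ⟨i, x⟩ ⟨i, x⟩)) := by
  subst hw
  rw [hd.mfderivWithin]
  have h1 : loc g i x x = (g ⟨i, x⟩).2 := toPiece_mk (g ⟨i, x⟩) _
  have h2 : writtenInExtChartAt (totModel (k i) (m i))
      (totModel (k (g ⟨i, x⟩).1) (m (g ⟨i, x⟩).1)) x (loc g i x) =
      rep k g ⟨i, x⟩ (g ⟨i, x⟩) := by
    unfold writtenInExtChartAt
    rw [h1]
    rfl
  rw [h2]
  have h3 := nhdsWithin_preimage_symm (k := k) (S := S) (c := ⟨i, x⟩) (x := x)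
    (mem_extChartAt_source x)
  rw [← coord_mk (⟨i, x⟩ : Tot m V), fderivWithin_congr_set h3]
  rfl

end Smooth

end Total

/-! ### The weak Whitney topology and parametrically smooth families of maps. -/

section Total

variable {ι : Type*} (k : ι → ℕ) {m : ι → ℕ} {B : ι → Type*}
  [∀ i, TopologicalSpace (B i)] [∀ i, ChartedSpace (Euc (k i)) (B i)]
  {V : ∀ i, B i → Type*}
  [∀ i b, AddCommGroup (V i b)] [∀ i b, Module ℝ (V i b)] [∀ i b, TopologicalSpace (V i b)]
  [∀ i, TopologicalSpace (TotalSpace (Euc (m i)) (V i))]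
  [∀ i, FiberBundle (Euc (m i)) (V i)] [∀ i, VectorBundle ℝ (Euc (m i)) (V i)]

variable {k}

theorem ext_of_mem {N : Set (Tot m V)} (h : N → Tot m V) {z : Tot m V} (hz : z ∈ N) :
    ext h z = h ⟨z, hz⟩ := dif_pos hz

theorem ext_coe {N : Set (Tot m V)} (h : N → Tot m V) (z : N) : ext h z = h z :=
  ext_of_mem h z.2

theorem continuousOn_ext {N : Set (Tot m V)} {h : N → Tot m V} (hh : Continuous h) :
    ContinuousOn (ext h) N := by
  rw [continuousOn_iff_continuous_domRestrict]
  exact hh.congr fun z => (ext_coe h z).symm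

theorem tendsto_of_coord {X : Type*} {l : Filter X} {f : X → Tot m V} {c w : Tot m V}
    (hw : w ∈ chartDom k c) (h1 : ∀ᶠ y in l, f y ∈ chartDom k c)
    (h2 : Tendsto (fun y => coord k c (f y)) l (𝓝 (coord k c w))) : Tendsto f l (𝓝 w) := by
  have h3 := (continuousAt_coordSymm (coord_mem hw)).tendsto.comp h2
  rw [coordSymm_coord hw] at h3
  exact h3.congr' (h1.mono fun y hy => coordSymm_coord hy)

theorem chartDeriv_eq {N : Set (Tot m V)} (h : N → Tot m V) (c c' : Tot m V) (l : ℕ)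
    (z : Tot m V) : chartDeriv k h c c' l z =
      iteratedFDerivWithin ℝ l (rep k (ext h) c c') (chartSet k N c) (coord k c z) := rfl

theorem chartDeriv_zero {N : Set (Tot m V)} (h : N → Tot m V) {c z : Tot m V} (c' : Tot m V)
    (hz : z ∈ chartDom k c) : coord k c' (ext h z) =
      continuousMultilinearCurryFin0 ℝ (Euc (k c.1) × Euc (m c.1)) (Euc (k c'.1) × Euc (m c'.1))
        (chartDeriv k h c c' 0 z) := by
  rw [chartDeriv_eq, continuousMultilinearCurryFin0_apply, iteratedFDerivWithin_zero_apply, rep,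
    coordSymm_coord hz]

section Smooth

variable [∀ i, IsManifold (𝓡 (k i)) ∞ (B i)]
  [∀ i, ContMDiffVectorBundle ∞ (Euc (m i)) (V i) (𝓡 (k i))] {N : Set (Tot m V)}

theorem SmoothMap.contDiffWithinAt_rep (f : SmoothMap k N) {z c c' : Tot m V} (hz : z ∈ N)
    (hc : z ∈ chartDom k c) (hc' : ext f.toFun z ∈ chartDom k c') :
    ContDiffWithinAt ℝ ∞ (rep k (ext f.toFun) c c') (chartSet k N c) (coord k c z) := by
  obtain ⟨x, rfl, hx⟩ := exists_of_mem_chartDom hc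
  exact (contMDiffWithinAt_loc_iff hc (continuousOn_ext f.continuous_toFun _ hz) hc').1
    (f.smooth_toFun c.1 x hz)

theorem SmoothMap.continuousWithinAt_chartDeriv (hN : IsDomain k N) (f : SmoothMap k N)
    {z c c' : Tot m V} (hz : z ∈ N) (hc : z ∈ chartDom k c)
    (hc' : ext f.toFun z ∈ chartDom k c') (l : ℕ) :
    ContinuousWithinAt (chartDeriv k f.toFun c c' l) N z := by
  have h1 := (f.contDiffWithinAt_rep hz hc hc').of_le (m := (l : ℕ∞ω))
    (by exact_mod_cast le_top)
  obtain ⟨U, hU, hzU, h2⟩ := h1.contDiffOn' le_rfl (by simp)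
  have hz' := coord_mem_chartSet hz hc
  rw [insert_eq_of_mem hz'] at h2
  have h3 := h2.continuousOn_iteratedFDerivWithin le_rfl
    ((uniqueDiffOn_chartSet hN c).inter hU) _ ⟨hz', hzU⟩
  have h4 : ContinuousWithinAt
      (iteratedFDerivWithin ℝ l (rep k (ext f.toFun) c c') (chartSet k N c))
      (chartSet k N c) (coord k c z) := by
    refine ((continuousWithinAt_inter (hU.mem_nhds hzU)).1 h3).congr_of_eventuallyEq ?_ ?_
    · filter_upwards [nhdsWithin_le_nhds (hU.mem_nhds hzU)] with u hu
      exact (iteratedFDerivWithin_inter_open hU hu).symm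
    · exact (iteratedFDerivWithin_inter_open hU hzU).symm
  exact h4.tendsto.comp (tendsto_coord_nhdsWithin hc)

theorem eventually_mem_whitneyNhd (f : SmoothMap k N) {c c' : Tot m V} {K : Set (Tot m V)}
    (hK : IsCompact K) (hKc : K ⊆ N ∩ chartDom k c) (hKc' : MapsTo (ext f.toFun) K (chartDom k c'))
    (r : ℕ) {ε : ℝ} (hε : 0 < ε) : ∀ᶠ g in 𝓝 f, g ∈ whitneyNhd k f c c' K r ε := by
  have h1 : IsOpen (whitneyNhd k f c c' K r ε) :=
    TopologicalSpace.isOpen_generateFrom_of_mem ⟨f, c, c', K, r, ε, hK, hKc, hKc', hε, rfl⟩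
  exact h1.mem_nhds ⟨hKc', fun l _ z _ => by simpa using hε⟩

theorem exists_compact_chart (hN : IsDomain k N) (f : SmoothMap k N) {z c c' : Tot m V}
    (hz : z ∈ N) (hc : z ∈ chartDom k c) (hc' : ext f.toFun z ∈ chartDom k c') :
    ∃ K, IsCompact K ∧ K ⊆ N ∩ chartDom k c ∧ MapsTo (ext f.toFun) K (chartDom k c') ∧
      K ∈ 𝓝[N] z := by
  have h1 : ext f.toFun ⁻¹' chartDom k c' ∈ 𝓝[N] z :=
    continuousOn_ext f.continuous_toFun z hz ((isOpen_chartDom c').mem_nhds hc')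
  obtain ⟨O, hO, hOz⟩ := mem_nhdsWithin_iff_exists_mem_nhds_inter.1 h1
  obtain ⟨K, hK, hKO, hKz⟩ := exists_isCompact_nhdsWithin hN z hz
    (inter_mem hO ((isOpen_chartDom c).mem_nhds hc))
  exact ⟨K, hK, fun y hy => ⟨(hKO hy).1, (hKO hy).2.2⟩,
    fun y hy => hOz ⟨(hKO hy).2.1, (hKO hy).1⟩, hKz⟩

/-- The point has a compact neighbourhood in `N` on which a Whitney neighbourhood of `f` controls
derivatives uniformly; the derivative of `f` itself is continuous. -/
theorem tendsto_chartDeriv (hN : IsDomain k N) (f : SmoothMap k N) {z c c' : Tot m V}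
    (hz : z ∈ N) (hc : z ∈ chartDom k c) (hc' : ext f.toFun z ∈ chartDom k c') (l : ℕ) :
    Tendsto (fun p : SmoothMap k N × Tot m V => chartDeriv k p.1.toFun c c' l p.2)
      (𝓝 f ×ˢ 𝓝[N] z) (𝓝 (chartDeriv k f.toFun c c' l z)) := by
  obtain ⟨K, hK, hKc, hKc', hKz⟩ := exists_compact_chart hN f hz hc hc'
  rw [Metric.tendsto_nhds]
  intro ε hε
  have h1 := eventually_mem_whitneyNhd f hK hKc hKc' l (half_pos hε)
  have h2 := Metric.tendsto_nhds.1 (f.continuousWithinAt_chartDeriv hN hz hc hc' l) _ (half_pos hε)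
  filter_upwards [h1.prod_mk (h2.and hKz)] with p hp
  have h3 := hp.1.2 l le_rfl p.2 hp.2.2
  rw [← dist_eq_norm] at h3
  linarith [dist_triangle (chartDeriv k p.1.toFun c c' l p.2) (chartDeriv k f.toFun c c' l p.2)
    (chartDeriv k f.toFun c c' l z), hp.2.1]

theorem tendsto_ext (hN : IsDomain k N) (f : SmoothMap k N) {z : Tot m V} (hz : z ∈ N) :
    Tendsto (fun p : SmoothMap k N × Tot m V => ext p.1.toFun p.2)
      (𝓝 f ×ˢ 𝓝[N] z) (𝓝 (ext f.toFun z)) := by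
  have hc := mem_chartDom_self (k := k) z
  have hc' := mem_chartDom_self (k := k) (ext f.toFun z)
  obtain ⟨K, hK, hKc, hKc', hKz⟩ := exists_compact_chart hN f hz hc hc'
  have h1 := eventually_mem_whitneyNhd f hK hKc hKc' 0 one_pos
  refine tendsto_of_coord hc' ?_ ?_
  · filter_upwards [h1.prod_mk hKz] with p hp using hp.1.1 hp.2
  · have h2 := ((continuousMultilinearCurryFin0 ℝ (Euc (k z.1) × Euc (m z.1))
      (Euc (k (ext f.toFun z).1) × Euc (m (ext f.toFun z).1))).continuous.tendsto _).comp
      (tendsto_chartDeriv hN f hz hc hc' 0)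
    rw [← chartDeriv_zero _ _ hc] at h2
    refine h2.congr' ?_
    filter_upwards [(Eventually.of_forall fun _ => trivial : ∀ᶠ _ in 𝓝 f, True).prod_mk hKz]
      with p hp
    exact (chartDeriv_zero _ _ (hKc hp.2).2).symm

/-- A map into the space of smooth maps is continuous if its derivatives in charts are jointly
continuous. -/
theorem continuous_of_tendsto_chartDeriv {P : Type*} [TopologicalSpace P] (hN : IsDomain k N)
    {Φ : P → SmoothMap k N}
    (h0 : ∀ p, ∀ z ∈ N, Tendsto (fun q : P × Tot m V => ext (Φ q.1).toFun q.2)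
      (𝓝 p ×ˢ 𝓝[N] z) (𝓝 (ext (Φ p).toFun z)))
    (h1 : ∀ p, ∀ z ∈ N, ∀ c c', z ∈ chartDom k c → ext (Φ p).toFun z ∈ chartDom k c' → ∀ l,
      Tendsto (fun q : P × Tot m V => chartDeriv k (Φ q.1).toFun c c' l q.2)
      (𝓝 p ×ˢ 𝓝[N] z) (𝓝 (chartDeriv k (Φ p).toFun c c' l z))) : Continuous Φ := by
  refine continuous_generateFrom_iff.2 ?_
  rintro _ ⟨f, c, c', K, r, ε, hK, hKc, hKc', hε, rfl⟩
  rw [isOpen_iff_mem_nhds]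
  intro p hp
  obtain ⟨hp1, hp2⟩ := hp
  have hKN : ∀ z ∈ K, 𝓝[K] z ≤ 𝓝[N] z := fun z _ => nhdsWithin_mono z fun y hy => (hKc hy).1
  -- A local estimate at each point of `K`, made uniform below by compactness. It is restricted to
  -- points of `K` because derivatives at boundary points of `N` are continuous only within `N`.
  have key : ∀ z ∈ K, ∀ᶠ q in 𝓝 (p, z), q.2 ∈ K →
      ext (Φ q.1).toFun q.2 ∈ chartDom k c' ∧ ∀ l ≤ r,
        ‖chartDeriv k (Φ q.1).toFun c c' l q.2 - chartDeriv k f.toFun c c' l q.2‖ < ε := by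
    intro z hz
    have h2 : ∀ᶠ q in 𝓝 p ×ˢ 𝓝[K] z,
        ext (Φ q.1).toFun q.2 ∈ chartDom k c' ∧ ∀ l ≤ r,
        ‖chartDeriv k (Φ q.1).toFun c c' l q.2 - chartDeriv k f.toFun c c' l q.2‖ < ε := by
      have hmono : 𝓝 p ×ˢ 𝓝[K] z ≤ 𝓝 p ×ˢ 𝓝[N] z := prod_mono le_rfl (hKN z hz)
      refine Eventually.and ?_ ?_
      · exact ((h0 p z (hKc hz).1).mono_left hmono).eventually
          ((isOpen_chartDom c').mem_nhds (hp1 hz))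
      · refine (Set.finite_Iic r).eventually_all.2 fun l hl => ?_
        have h3 := (h1 p z (hKc hz).1 c c' (hKc hz).2 (hp1 hz) l).mono_left hmono
        have h4 := ((f.continuousWithinAt_chartDeriv hN (hKc hz).1 (hKc hz).2 (hKc' hz) l).mono
          fun y hy => (hKc hy).1).tendsto.comp (tendsto_snd (f := 𝓝 p) (g := 𝓝[K] z))
        exact (h3.sub h4).norm.eventually (gt_mem_nhds (hp2 l hl z hz))
    rw [← nhdsWithin_univ p, ← nhdsWithin_prod_eq, eventually_nhdsWithin_iff] at h2
    exact h2.mono fun q hq hqK => hq ⟨mem_univ _, hqK⟩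
  have h5 := hK.eventually_forall_of_forall_eventually
    (P := fun p z => z ∈ K → ext (Φ p).toFun z ∈ chartDom k c' ∧ ∀ l ≤ r,
        ‖chartDeriv k (Φ p).toFun c c' l z - chartDeriv k f.toFun c c' l z‖ < ε) key
  filter_upwards [h5] with p' hp'
  exact ⟨fun z hz => (hp' z hz hz).1, fun l hl z hz => (hp' z hz hz).2 l hl⟩

variable (k) in
/-- A family of maps of the total space that, in all charts, is parametrically smooth near a
point. -/
def FamAt {P : Type*} [TopologicalSpace P] (Φ : P → Tot m V → Tot m V) (p : P) (z : Tot m V) :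
    Prop :=
  ContinuousAt (Function.uncurry Φ) (p, z) ∧
    ∀ c c', z ∈ chartDom k c → Φ p z ∈ chartDom k c' → ∀ n,
      PSAt n (fun p => rep k (Φ p) c c') (p, coord k c z)

theorem chartDeriv_eq_iteratedFDeriv (h : N → Tot m V) {c z : Tot m V} (c' : Tot m V)
    (hz : z ∈ interior N) (hc : z ∈ chartDom k c) (l : ℕ) : chartDeriv k h c c' l z =
      iteratedFDeriv ℝ l (rep k (ext h) c c') (coord k c z) := by
  rw [chartDeriv_eq, ← iteratedFDerivWithin_univ]
  refine iteratedFDerivWithin_congr_set ?_ l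
  filter_upwards [chartSet_mem_nhds hz hc] with u hu
  exact propext ⟨fun _ => mem_univ u, fun _ => hu⟩

theorem SmoothMap.contDiffAt_rep (f : SmoothMap k N) {z c c' : Tot m V} (hz : z ∈ interior N)
    (hc : z ∈ chartDom k c) (hc' : ext f.toFun z ∈ chartDom k c') :
    ContDiffAt ℝ ∞ (rep k (ext f.toFun) c c') (coord k c z) :=
  (f.contDiffWithinAt_rep (interior_subset hz) hc hc').contDiffAt (chartSet_mem_nhds hz hc)

/-- `W` is the part of the target chart over which the derivatives are known to be continuous: the
whole chart domain for the Whitney topology, the set where a cutoff does not vanish for the coarser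
topology used in the choice of the radius. -/
theorem famAt_of_tendsto {P : Type*} [TopologicalSpace P] {Φ : P → SmoothMap k N}
    {O : Set (Tot m V)} (hO : IsOpen O) (hON : O ⊆ N)
    {c c' : Tot m V} {W : Set (Tot m V)} (hW : IsOpen W) (hWc' : W ⊆ chartDom k c')
    (h1 : ∀ p, ∀ z ∈ O, z ∈ chartDom k c → ext (Φ p).toFun z ∈ W → ∀ l,
      ContinuousAt (fun q : P × Tot m V => chartDeriv k (Φ q.1).toFun c c' l q.2) (p, z))
    {p : P} {z : Tot m V}
    (h0 : ContinuousAt (fun q : P × Tot m V => ext (Φ q.1).toFun q.2) (p, z)) (hz : z ∈ O) (hc : z ∈ chartDom k c)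
    (hc' : ext (Φ p).toFun z ∈ W) (n : ℕ) :
    PSAt n (fun p => rep k (ext (Φ p).toFun) c c') (p, coord k c z) := by
  have hOint : O ⊆ interior N := hO.subset_interior_iff.2 hON
  have hw : ContinuousAt (fun q : P × (Euc (k c.1) × Euc (m c.1)) => (q.1, coordSymm k c q.2))
      (p, coord k c z) :=
    continuousAt_fst.prodMk (ContinuousAt.comp (g := coordSymm k c) (f := Prod.snd)
      (continuousAt_coordSymm (coord_mem hc)) continuousAt_snd)
  have e1 : ((p, coordSymm k c (coord k c z)) : P × Tot m V) = (p, z) := by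
    rw [coordSymm_coord hc]
  have h2 : ∀ᶠ q in 𝓝 (p, z), q.2 ∈ O ∧ q.2 ∈ chartDom k c ∧
      ext (Φ q.1).toFun q.2 ∈ W :=
    (continuousAt_snd.eventually (hO.mem_nhds hz)).and
      ((continuousAt_snd.eventually ((isOpen_chartDom c).mem_nhds hc)).and
      (h0.eventually (hW.mem_nhds hc')))
  have h3 : ∀ᶠ q in 𝓝 (p, coord k c z), coordSymm k c q.2 ∈ O ∧
      coordSymm k c q.2 ∈ chartDom k c ∧
      ext (Φ q.1).toFun (coordSymm k c q.2) ∈ W := by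
    have := hw.tendsto
    simp only [e1] at this
    exact this.eventually h2
  have himg : ∀ᶠ q in 𝓝 (p, coord k c z), q.2 ∈ chartImg k c :=
    continuousAt_snd.eventually ((isOpen_chartImg c).mem_nhds (coord_mem hc))
  refine PSAt.of_iteratedFDeriv ?_ fun l _ => ?_
  · filter_upwards [h3, himg] with q hq hq2
    have := (Φ q.1).contDiffAt_rep (hOint hq.1) hq.2.1 (hWc' hq.2.2)
    rw [coord_coordSymm hq2] at this
    exact this.of_le (by exact_mod_cast le_top)
  · filter_upwards [h3, himg, eventually_eventually_nhds.2 h3, eventually_eventually_nhds.2 himg]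
      with q hq hq2 hq3 hq4
    have h4 := h1 q.1 _ hq.1 hq.2.1 hq.2.2 l
    have h5 : ContinuousAt (fun q : P × (Euc (k c.1) × Euc (m c.1)) => (q.1, coordSymm k c q.2))
        q := continuousAt_fst.prodMk (ContinuousAt.comp (g := coordSymm k c) (f := Prod.snd)
          (continuousAt_coordSymm hq2) continuousAt_snd)
    have h6 := ContinuousAt.comp
      (f := fun q : P × (Euc (k c.1) × Euc (m c.1)) => (q.1, coordSymm k c q.2)) h4 h5
    refine h6.congr ?_
    filter_upwards [hq3, hq4] with r hr hr2
    simp only [Function.comp]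
    rw [chartDeriv_eq_iteratedFDeriv _ _ (hOint hr.1) hr.2.1, coord_coordSymm hr2]

/-- The universal family, from which those over spaces of embeddings with the Whitney topology are
obtained by reparametrization. It is restricted to interior points, where derivatives within `N` are
ordinary derivatives. -/
theorem SmoothMap.famAt (hN : IsDomain k N) (f : SmoothMap k N) {z : Tot m V}
    (hz : z ∈ interior N) :
    FamAt k (fun f : SmoothMap k N => ext f.toFun) f z := by
  have hnhds : ∀ (f : SmoothMap k N), ∀ z ∈ interior N, 𝓝 f ×ˢ 𝓝[N] z = 𝓝 (f, z) := by
    intro f z hz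
    rw [nhdsWithin_eq_nhds.2 (mem_interior_iff_mem_nhds.1 hz), nhds_prod_eq]
  have h0 : ∀ (f : SmoothMap k N), ∀ z ∈ interior N,
      ContinuousAt (fun q : SmoothMap k N × Tot m V => ext q.1.toFun q.2) (f, z) :=
    fun f z hz => by
      have := tendsto_ext hN f (interior_subset hz)
      rwa [hnhds f z hz] at this
  refine ⟨h0 f z hz, fun c c' hc hc' n => ?_⟩
  refine famAt_of_tendsto (Φ := id) isOpen_interior interior_subset
    (isOpen_chartDom c') subset_rfl (fun f z hz hc hc' l => ?_) (h0 f z hz) hz hc hc' n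
  have := tendsto_chartDeriv hN f (interior_subset hz) hc hc' l
  rwa [hnhds f z hz] at this

theorem FamAt.continuousAt_chartDeriv {P : Type*} [TopologicalSpace P]
    {Φ : P → N → Tot m V} {p : P} {z : Tot m V} (h : FamAt k (fun p => ext (Φ p)) p z)
    (hz : z ∈ interior N) {c c' : Tot m V} (hc : z ∈ chartDom k c)
    (hc' : ext (Φ p) z ∈ chartDom k c') (l : ℕ) :
    ContinuousAt (fun q : P × Tot m V => chartDeriv k (Φ q.1) c c' l q.2) (p, z) := by
  have h1 := (h.2 c c' hc hc' l).continuousAt_iteratedFDeriv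
  have h2 : ContinuousAt (fun q : P × Tot m V => (q.1, coord k c q.2)) (p, z) :=
    continuousAt_fst.prodMk (ContinuousAt.comp (g := coord k c) (f := Prod.snd)
      (continuousAt_coord hc) continuousAt_snd)
  have h3 := ContinuousAt.comp (f := fun q : P × Tot m V => (q.1, coord k c q.2)) h1 h2
  refine h3.congr ?_
  filter_upwards [continuousAt_snd.eventually (isOpen_interior.mem_nhds hz),
    continuousAt_snd.eventually ((isOpen_chartDom c).mem_nhds hc)] with q h4 h5
  exact (chartDeriv_eq_iteratedFDeriv _ _ h4 h5 l).symm

theorem FamAt.reparam {P Q : Type*} [TopologicalSpace P] [TopologicalSpace Q]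
    {Φ : P → Tot m V → Tot m V} {θ : Q → P} {q : Q} {z : Tot m V} (h : FamAt k Φ (θ q) z)
    (hθ : Continuous θ) : FamAt k (fun q => Φ (θ q)) q z := by
  refine ⟨?_, fun c c' hc hc' n => ?_⟩
  · exact ContinuousAt.comp (g := Function.uncurry Φ) (x := (q, z))
      (f := fun q : Q × Tot m V => (θ q.1, q.2)) h.1
      ((hθ.continuousAt.comp continuousAt_fst).prodMk continuousAt_snd)
  · exact PSAt.reparam (F := fun p => rep k (Φ p) c c') (q := (q, coord k c z)) (h.2 c c' hc hc' n)
      (Eventually.of_forall fun _ => hθ.continuousAt)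

theorem contDiffAt_rep_id {c c' z : Tot m V} (hc : z ∈ chartDom k c) (hc' : z ∈ chartDom k c') :
    ContDiffAt ℝ ∞ (rep k id c c') (coord k c z) := by
  obtain ⟨x, rfl, hx⟩ := exists_of_mem_chartDom hc
  have h1 := contMDiffWithinAt_loc_iff (g := id) (S := univ) hc continuousWithinAt_id hc'
  have h2 : chartSet k univ c ∈ 𝓝 (coord k c ⟨c.1, x⟩) :=
    chartSet_mem_nhds (by simp) hc
  refine ContDiffWithinAt.contDiffAt (h1.1 ?_) h2
  have h3 : loc (id : Tot m V → Tot m V) c.1 x = id := by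
    funext x'
    exact toPiece_mk (⟨c.1, x⟩ : Tot m V) x'
  have h4 : ContMDiffWithinAt (totModel (k c.1) (m c.1)) (totModel (k c.1) (m c.1)) ∞
      (id : TotalSpace (Euc (m c.1)) (V c.1) → _) (slice (univ : Set (Tot m V)) c.1) x :=
    contMDiffWithinAt_id
  rw [← h3] at h4
  exact h4

theorem rep_id_comp {c c' z : Tot m V} (hc : z ∈ chartDom k c) (hc' : z ∈ chartDom k c')
    {g : Tot m V → Tot m V} (c'' : Tot m V) :
    ∀ᶠ u in 𝓝 (coord k c z), rep k g c c'' u = rep k g c' c'' (rep k id c c' u) := by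
  have h1 : ∀ᶠ u in 𝓝 (coord k c z), coordSymm k c u ∈ chartDom k c' := by
    refine (continuousAt_coordSymm (coord_mem hc)).eventually ((isOpen_chartDom c').mem_nhds ?_)
    rwa [coordSymm_coord hc]
  filter_upwards [h1] with u hu
  rw [rep, rep, rep, id, coordSymm_coord hu]

/-- The two chart changes between `c` and `c'` are inverse to each other near the point. -/
theorem fderiv_rep_id_surjective {c c' z : Tot m V} (hc : z ∈ chartDom k c)
    (hc' : z ∈ chartDom k c') :
    Function.Surjective (fderiv ℝ (rep k id c c') (coord k c z)) := by
  have h1 := (contDiffAt_rep_id hc hc').differentiableAt (by simp)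
  have h2 := (contDiffAt_rep_id hc' hc).differentiableAt (by simp)
  have e1 : rep k id c' c (coord k c' z) = coord k c z := by
    rw [rep, coordSymm_coord hc']
    rfl
  have h3 : rep k id c c' ∘ rep k id c' c =ᶠ[𝓝 (coord k c' z)] id := by
    filter_upwards [rep_id_comp hc' hc (g := id) c',
      (isOpen_chartImg c').mem_nhds (coord_mem hc')] with u hu hu2
    rw [Function.comp, ← hu, rep, id, coord_coordSymm hu2]
    rfl
  have h4 := h3.fderiv_eq (𝕜 := ℝ)
  rw [← e1] at h1
  rw [fderiv_comp _ h1 h2, fderiv_id, e1] at h4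
  intro v
  exact ⟨fderiv ℝ (rep k id c' c) (coord k c' z) v, by
    simpa using DFunLike.congr_fun h4 v⟩

theorem rep_eventuallyEq {g : Tot m V → Tot m V} {z c₁ c₁' c₂ c₂' : Tot m V}
    (hg : ContinuousAt g z) (h₁ : z ∈ chartDom k c₁)
    (h₂ : z ∈ chartDom k c₂) (h₂' : g z ∈ chartDom k c₂') :
    rep k g c₁ c₁' =ᶠ[𝓝 (coord k c₁ z)]
      rep k id c₂' c₁' ∘ rep k g c₂ c₂' ∘ rep k id c₁ c₂ := by
  have h4 : ∀ᶠ u in 𝓝 (coord k c₁ z), g (coordSymm k c₁ u) ∈ chartDom k c₂' := by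
    have h5 := continuousAt_coordSymm (coord_mem h₁)
    rw [ContinuousAt, coordSymm_coord h₁] at h5
    exact h5.eventually (hg.eventually ((isOpen_chartDom c₂').mem_nhds h₂'))
  filter_upwards [rep_id_comp h₁ h₂ (g := g) c₂', h4] with u hu hu2
  rw [Function.comp, Function.comp, ← hu]
  simp only [rep]
  rw [coordSymm_coord hu2]
  rfl

theorem rep_id_coord {c c' z : Tot m V} (hc : z ∈ chartDom k c) :
    rep k id c c' (coord k c z) = coord k c' z := by
  rw [rep, coordSymm_coord hc]
  rfl

theorem rep_coord {g : Tot m V → Tot m V} {c c' z : Tot m V} (hc : z ∈ chartDom k c) :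
    rep k g c c' (coord k c z) = coord k c' (g z) := by
  rw [rep, coordSymm_coord hc]

theorem differentiableAt_rep {g : Tot m V → Tot m V} {z c₁ c₁' c₂ c₂' : Tot m V}
    (hg : ContinuousAt g z) (h₁ : z ∈ chartDom k c₁) (h₁' : g z ∈ chartDom k c₁')
    (h₂ : z ∈ chartDom k c₂) (h₂' : g z ∈ chartDom k c₂')
    (hd : DifferentiableAt ℝ (rep k g c₂ c₂') (coord k c₂ z)) :
    DifferentiableAt ℝ (rep k g c₁ c₁') (coord k c₁ z) := by
  refine DifferentiableAt.congr_of_eventuallyEq ?_ (rep_eventuallyEq hg h₁ h₂ h₂')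
  have hd1 := (contDiffAt_rep_id h₁ h₂).differentiableAt (by simp)
  have hd2 := (contDiffAt_rep_id h₂' h₁').differentiableAt (by simp)
  rw [← rep_id_coord h₁] at hd
  refine DifferentiableAt.comp _ ?_ (hd.comp _ hd1)
  rwa [Function.comp, rep_id_coord h₁, rep_coord h₂]

theorem injective_fderiv_rep {g : Tot m V → Tot m V} {z c₁ c₁' c₂ c₂' : Tot m V}
    (hg : ContinuousAt g z) (h₁ : z ∈ chartDom k c₁) (h₁' : g z ∈ chartDom k c₁')
    (h₂ : z ∈ chartDom k c₂) (h₂' : g z ∈ chartDom k c₂')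
    (hd : DifferentiableAt ℝ (rep k g c₂ c₂') (coord k c₂ z))
    (hinj : Function.Injective (fderiv ℝ (rep k g c₁ c₁') (coord k c₁ z))) :
    Function.Injective (fderiv ℝ (rep k g c₂ c₂') (coord k c₂ z)) := by
  have e1 : rep k id c₁ c₂ (coord k c₁ z) = coord k c₂ z := rep_id_coord h₁
  have e2 : rep k g c₂ c₂' (coord k c₂ z) = coord k c₂' (g z) := rep_coord h₂
  have h3 := rep_eventuallyEq (c₁' := c₁') hg h₁ h₂ h₂'
  have hd1 := (contDiffAt_rep_id h₁ h₂).differentiableAt (by simp)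
  have hd2 := (contDiffAt_rep_id h₂' h₁').differentiableAt (by simp)
  have hd' := hd
  rw [← e1] at hd'
  have hd2' : DifferentiableAt ℝ (rep k id c₂' c₁')
      ((rep k g c₂ c₂' ∘ rep k id c₁ c₂) (coord k c₁ z)) := by
    rw [Function.comp, e1, e2]
    exact hd2
  rw [h3.fderiv_eq, fderiv_comp _ hd2' (hd'.comp _ hd1), fderiv_comp _ hd' hd1, e1] at hinj
  intro v w hvw
  obtain ⟨v', rfl⟩ := fderiv_rep_id_surjective h₁ h₂ v
  obtain ⟨w', rfl⟩ := fderiv_rep_id_surjective h₁ h₂ w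
  have : v' = w' := hinj (by simp [hvw])
  rw [this]

end Smooth

end Total

/-! ### The rescaled map, and the fibre derivative in arbitrary charts. -/

section Total

variable {ι : Type*} (k : ι → ℕ) {m : ι → ℕ} {B : ι → Type*}
  [∀ i, TopologicalSpace (B i)] [∀ i, ChartedSpace (Euc (k i)) (B i)]
  {V : ∀ i, B i → Type*}
  [∀ i b, AddCommGroup (V i b)] [∀ i b, Module ℝ (V i b)] [∀ i b, TopologicalSpace (V i b)]
  [∀ i, TopologicalSpace (TotalSpace (Euc (m i)) (V i))]
  [∀ i, FiberBundle (Euc (m i)) (V i)] [∀ i, VectorBundle ℝ (Euc (m i)) (V i)]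

variable {k}

/-- The rescaled map `z ↦ g (s z) / s`, which for `s = 0` is the fibre derivative. -/
def blowup (g : Tot m V → Tot m V) (s : ℝ) (z : Tot m V) : Tot m V :=
  if s = 0 then tfib g z else scale s⁻¹ (g (scale s z))

theorem blowup_zero (g : Tot m V → Tot m V) (z : Tot m V) : blowup g 0 z = tfib g z := if_pos rfl

theorem blowup_of_ne (g : Tot m V → Tot m V) {s : ℝ} (hs : s ≠ 0) (z : Tot m V) :
    blowup g s z = scale s⁻¹ (g (scale s z)) := if_neg hs

theorem blowup_one (g : Tot m V → Tot m V) (z : Tot m V) : blowup g 1 z = g z := by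
  rw [blowup_of_ne g one_ne_zero, inv_one, scale_one, scale_one]

/-- The identity behind conjugation by the radius. It persists at `s = 0` because the fibre
derivative is linear. -/
theorem blowup_scale (g : Tot m V → Tot m V) (s : ℝ) {δ : ℝ} (hδ : δ ≠ 0) (z : Tot m V) :
    blowup g s (scale δ z) = scale δ (blowup g (s * δ) z) := by
  rcases eq_or_ne s 0 with rfl | hs
  · rw [zero_mul, blowup_zero, blowup_zero, tfib, tfib, scale]
    exact congrArg (fun v => (⟨_, ⟨_, v⟩⟩ : Tot m V)) (LinearMap.map_smul _ _ _)
  · rw [blowup_of_ne g hs, blowup_of_ne g (mul_ne_zero hs hδ), scale_scale, scale_scale]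
    congr 1
    field_simp

theorem blowup_mem_zeroSec {g : Tot m V → Tot m V}
    (hg : ∀ w ∈ zeroSec m V, g w ∈ zeroSec m V) (s : ℝ) {z : Tot m V} (hz : z ∈ zeroSec m V) :
    blowup g s z ∈ zeroSec m V := by
  rcases eq_or_ne s 0 with rfl | hs
  · rw [blowup_zero]
    obtain ⟨i, b, v⟩ := z
    obtain rfl : v = 0 := hz
    change fibDeriv _ _ _ (0 : V i b) = 0
    exact map_zero _
  · rw [blowup_of_ne g hs, scale_of_mem_zeroSec hz, scale_of_mem_zeroSec (hg z hz)]
    exact hg z hz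

/-- Division by `s` moves only within a fibre, and chart domains are unions of fibres; for `s = 0`
the fibre derivative lies over the image of the zero vector. -/
theorem blowup_mem_chartDom {g : Tot m V → Tot m V} {s : ℝ} {z c' : Tot m V} :
    blowup g s z ∈ chartDom k c' ↔ g (scale s z) ∈ chartDom k c' := by
  rcases eq_or_ne s 0 with rfl | hs
  · rw [blowup_zero, scale_zero]
    exact mem_chartDom_congr rfl
  · rw [blowup_of_ne g hs]
    exact scale_mem_chartDom

section Smooth

variable [∀ i, IsManifold (𝓡 (k i)) ∞ (B i)]
  [∀ i, ContMDiffVectorBundle ∞ (Euc (m i)) (V i) (𝓡 (k i))]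

theorem coord_scale_zero {c z : Tot m V} (hz : z ∈ chartDom k c) :
    coord k c (scale 0 z) = ((coord k c z).1, 0) := by
  rw [coord_scale hz, zero_smul]

theorem rep_apply_smul {g : Tot m V → Tot m V} {c c' z : Tot m V} (hc : z ∈ chartDom k c) (s : ℝ) :
    rep k g c c' ((coord k c z).1, s • (coord k c z).2) = coord k c' (g (scale s z)) := by
  rw [rep, coordSymm_smul (coord_mem hc), coordSymm_coord hc]

/-- The fibre coordinate of `g (s z)` vanishes at `s = 0`, so dividing it by `s` gives a difference
quotient, whereas the base coordinate is not divided. -/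
theorem tendsto_coord_scale_inv {g : Tot m V → Tot m V} (hZ : ∀ w ∈ zeroSec m V, g w ∈ zeroSec m V)
    {c c' z : Tot m V} (hc : z ∈ chartDom k c) (hg : ContinuousAt g (scale 0 z))
    (hc' : g (scale 0 z) ∈ chartDom k c')
    (hd : DifferentiableAt ℝ (rep k g c c') (coord k c (scale 0 z))) :
    Tendsto (fun s : ℝ => coord k c' (scale s⁻¹ (g (scale s z)))) (𝓝[≠] 0)
      (𝓝 ((rep k g c c' (coord k c (scale 0 z))).1,
        (fderiv ℝ (rep k g c c') (coord k c (scale 0 z)) (0, (coord k c z).2)).2)) := by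
  have hscale : Tendsto (fun s : ℝ => scale s z) (𝓝 0) (𝓝 (scale 0 z)) :=
    ((continuous_scale (V := V) k).comp (Continuous.prodMk_left z)).tendsto 0
  have hmem : ∀ᶠ s : ℝ in 𝓝 0, g (scale s z) ∈ chartDom k c' :=
    hscale.eventually (hg.eventually ((isOpen_chartDom c').mem_nhds hc'))
  set x := coord k c z with hx
  have e0 : coord k c (scale 0 z) = (x.1, (0 : ℝ) • x.2) := coord_scale hc 0
  have hline : HasDerivAt (fun s : ℝ => ((x.1, s • x.2) : Euc (k c.1) × Euc (m c.1)))
      (0, x.2) 0 := by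
    refine (hasDerivAt_const _ _).prodMk ?_
    simpa using (hasDerivAt_id (0 : ℝ)).smul_const x.2
  have hcomp : HasDerivAt (fun s : ℝ => rep k g c c' (x.1, s • x.2))
      (fderiv ℝ (rep k g c c') (coord k c (scale 0 z)) (0, x.2)) 0 := by
    rw [e0] at hd ⊢
    exact hd.hasFDerivAt.comp_hasDerivAt (0 : ℝ) hline
  have hzero : (rep k g c c' (x.1, (0 : ℝ) • x.2)).2 = 0 := by
    rw [hx, rep_apply_smul hc]
    exact (mem_zeroSec_iff hc').1 (hZ _ (scale_zero_mem z))
  have h1 : Tendsto (fun s : ℝ => (rep k g c c' (x.1, s • x.2)).1) (𝓝[≠] 0)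
      (𝓝 (rep k g c c' (coord k c (scale 0 z))).1) := by
    rw [e0]
    exact (hcomp.continuousAt.fst).tendsto.mono_left nhdsWithin_le_nhds
  have h2 : Tendsto (fun s : ℝ => s⁻¹ • (rep k g c c' (x.1, s • x.2)).2) (𝓝[≠] 0)
      (𝓝 (fderiv ℝ (rep k g c c') (coord k c (scale 0 z)) (0, x.2)).2) := by
    have h3 := (hasDerivAt_iff_tendsto_slope.1
      ((ContinuousLinearMap.snd ℝ _ _).hasFDerivAt.comp_hasDerivAt (0 : ℝ) hcomp))
    refine h3.congr fun s => ?_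
    simp only [slope, Function.comp, vsub_eq_sub, sub_zero, ContinuousLinearMap.coe_snd', hzero]
  refine (h1.prodMk_nhds h2).congr' ?_
  filter_upwards [nhdsWithin_le_nhds hmem] with s hs
  rw [coord_scale hs, hx, rep_apply_smul hc]

/-- The fibre derivative in the preferred charts. -/
theorem coord_tfib_self {g : Tot m V → Tot m V} (z : Tot m V) {c₀ : Tot m V}
    (h₀ : c₀ = ⟨z.1, ⟨z.2.proj, 0⟩⟩) (hg : ContinuousAt g c₀)
    (hd : DifferentiableAt ℝ (rep k g c₀ (g c₀)) (coord k c₀ c₀)) :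
    coord k (g c₀) (tfib g z) = ((rep k g c₀ (g c₀) (coord k c₀ c₀)).1,
      (fderiv ℝ (rep k g c₀ (g c₀)) (coord k c₀ c₀) (0, (coord k c₀ z).2)).2) := by
  obtain ⟨i, b, v⟩ := z
  subst h₀
  unfold tfib
  dsimp only at hg hd ⊢
  set c₀ : Tot m V := ⟨i, ⟨b, 0⟩⟩ with hc₀
  set w := g c₀ with hw
  set e := trivializationAt (Euc (m i)) (V i) b with he
  set e' := trivializationAt (Euc (m w.1)) (V w.1) w.2.proj with he'
  have hbe : b ∈ e.baseSet := mem_baseSet_trivializationAt _ _ b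
  have hbe' : w.2.proj ∈ e'.baseSet := mem_baseSet_trivializationAt _ _ _
  set x₁ := extChartAt (𝓡 (k i)) b b with hx₁
  have hcoord : ∀ y : V i b, coord k c₀ ⟨i, ⟨b, y⟩⟩ = (x₁, (e ⟨b, y⟩).2) := fun y => by
    rw [show (⟨i, ⟨b, y⟩⟩ : Tot m V) = ⟨c₀.1, ⟨b, y⟩⟩ from rfl, coord_mk]
    exact extChartAt_apply (k := k i) (⟨b, 0⟩ : TotalSpace (Euc (m i)) (V i)) ⟨b, y⟩ hbe
  have hcoordw : ∀ y : V w.1 w.2.proj, coord k w ⟨w.1, ⟨w.2.proj, y⟩⟩ =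
      (extChartAt (𝓡 (k w.1)) w.2.proj w.2.proj, (e' ⟨w.2.proj, y⟩).2) := fun y => by
    rw [coord_mk]
    exact extChartAt_apply (k := k w.1) w.2 ⟨w.2.proj, y⟩ hbe'
  have hsymm : ∀ u : Euc (m i), coordSymm k c₀ (x₁, u) = ⟨i, ⟨b, e.symm b u⟩⟩ := fun u => by
    have h1 : (⟨i, ⟨b, e.symm b u⟩⟩ : Tot m V) ∈ chartDom k c₀ :=
      (mem_chartDom_congr (by rfl)).1 (mem_chartDom_self (k := k) c₀)
    rw [← coordSymm_coord h1, hcoord, e.apply_mk_symm hbe]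
  have e0 : coord k c₀ c₀ = (x₁, 0) := by
    have := hcoord 0
    rw [this]
    exact Prod.ext rfl ((e.linear ℝ hbe).map_zero)
  have hmemw : ∀ᶠ u : Euc (m i) in 𝓝 0, (g (coordSymm k c₀ (x₁, u))) ∈ chartDom k w := by
    have h1 : ContinuousAt (fun u : Euc (m i) => coordSymm k c₀ (x₁, u)) 0 := by
      refine ContinuousAt.comp (g := coordSymm k c₀) (f := fun u : Euc (m i) => (x₁, u)) ?_
        (by fun_prop)
      rw [← e0]
      exact continuousAt_coordSymm (coord_mem (mem_chartDom_self c₀))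
    have h2 : coordSymm k c₀ (x₁, 0) = c₀ := by
      rw [← e0, coordSymm_coord (mem_chartDom_self c₀)]
    have h3 : Tendsto (fun u : Euc (m i) => coordSymm k c₀ (x₁, u)) (𝓝 0) (𝓝 c₀) := by
      have := h1.tendsto
      rwa [h2] at this
    exact h3.eventually (hg.eventually ((isOpen_chartDom w).mem_nhds (mem_chartDom_self w)))
  have hfun : (fun u : Euc (m i) => (e' (loc g i ⟨b, 0⟩ ⟨b, e.symm b u⟩)).2) =ᶠ[𝓝 0]
      fun u => (rep k g c₀ w (x₁, u)).2 := by
    filter_upwards [hmemw] with u hu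
    rw [rep]
    rw [hsymm] at hu ⊢
    obtain ⟨y, hy, hys⟩ := exists_of_mem_chartDom hu
    rw [loc, hy, coord_mk]
    rw [mem_extChartAt_source_iff] at hys
    rw [extChartAt_apply (k := k w.1) _ _ hys.1]
    change (e' (toPiece w ⟨w.1, y⟩)).2 = _
    rw [toPiece_mk]
  have hder : fderiv ℝ (fun u : Euc (m i) => (e' (loc g i ⟨b, 0⟩ ⟨b, e.symm b u⟩)).2) 0 =
      (ContinuousLinearMap.snd ℝ _ _).comp ((fderiv ℝ (rep k g c₀ w) (coord k c₀ c₀)).comp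
        (ContinuousLinearMap.inr ℝ _ _)) := by
    rw [hfun.fderiv_eq]
    rw [e0] at hd ⊢
    have h4 : HasFDerivAt (fun u : Euc (m i) => ((x₁, u) : Euc (k i) × Euc (m i)))
        (ContinuousLinearMap.inr ℝ _ _) 0 := hasFDerivAt_prodMk_right _ _
    exact ((ContinuousLinearMap.snd ℝ _ _).hasFDerivAt.comp (0 : Euc (m i))
      (HasFDerivAt.comp (0 : Euc (m i)) hd.hasFDerivAt h4)).fderiv
  have hlin : fibDeriv (loc g i ⟨b, 0⟩) b w.2.proj v = e'.symmₗ ℝ w.2.proj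
      ((fderiv ℝ (rep k g c₀ w) (coord k c₀ c₀) (0, (e ⟨b, v⟩).2)).2) := by
    have h5 : e.linearMapAt ℝ b v = (e ⟨b, v⟩).2 := by
      rw [e.linearMapAt_apply, if_pos hbe]
    change e'.symmₗ ℝ w.2.proj ((fderiv ℝ (fun u : Euc (m i) =>
      (e' (loc g i ⟨b, 0⟩ ⟨b, e.symm b u⟩)).2) 0) (e.linearMapAt ℝ b v)) = _
    rw [hder, h5]
    rfl
  have hrep1 : (rep k g c₀ w (coord k c₀ c₀)).1 = extChartAt (𝓡 (k w.1)) w.2.proj w.2.proj := by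
    rw [rep, coordSymm_coord (mem_chartDom_self c₀), ← hw]
    have := hcoordw w.2.2
    rw [show (⟨w.1, ⟨w.2.proj, w.2.2⟩⟩ : Tot m V) = w from rfl] at this
    rw [this]
  rw [hcoordw, hrep1]
  refine Prod.ext rfl ?_
  dsimp only
  rw [hlin]
  have h6 := e'.linearMapAt_symmₗ (R := ℝ) hbe'
    ((fderiv ℝ (rep k g c₀ w) (coord k c₀ c₀) (0, (e ⟨b, v⟩).2)).2)
  rw [e'.linearMapAt_apply, if_pos hbe'] at h6
  refine h6.trans ?_
  change _ = (fderiv ℝ (rep k g c₀ w) (coord k c₀ c₀) (0, (coord k c₀ ⟨i, ⟨b, v⟩⟩).2)).2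
  rw [hcoord v]

/-- Chart independence of the fibre derivative: it is the limit of `g (s z) / s`, as the preferred
charts show, and this limit can be computed in any other pair of charts. -/
theorem coord_tfib {g : Tot m V → Tot m V} (hZ : ∀ w ∈ zeroSec m V, g w ∈ zeroSec m V)
    {c c' z : Tot m V} (hc : z ∈ chartDom k c) (hg : ContinuousAt g (scale 0 z))
    (hc' : g (scale 0 z) ∈ chartDom k c')
    (hd : DifferentiableAt ℝ (rep k g c c') (coord k c (scale 0 z))) :
    coord k c' (tfib g z) = ((rep k g c c' (coord k c (scale 0 z))).1,
        (fderiv ℝ (rep k g c c') (coord k c (scale 0 z)) (0, (coord k c z).2)).2) := by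
  have hd0 : DifferentiableAt ℝ (rep k g (scale 0 z) (g (scale 0 z)))
      (coord k (scale 0 z) (scale 0 z)) :=
    differentiableAt_rep hg (mem_chartDom_self _) (mem_chartDom_self _)
      (scale_mem_chartDom.2 hc) hc' hd
  have hA : Tendsto (fun s : ℝ => scale s⁻¹ (g (scale s z))) (𝓝[≠] 0) (𝓝 (tfib g z)) := by
    have h0 : z ∈ chartDom k (scale 0 z) := scale_mem_chartDom.1 (mem_chartDom_self _)
    have h1 := tendsto_coord_scale_inv hZ h0 hg (mem_chartDom_self (k := k) _) hd0
    rw [← coord_tfib_self z (scale_zero z) hg hd0] at h1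
    have hscale : Tendsto (fun s : ℝ => scale s z) (𝓝 0) (𝓝 (scale 0 z)) :=
      ((continuous_scale (V := V) k).comp (Continuous.prodMk_left z)).tendsto 0
    refine tendsto_of_coord (k := k) (c := g (scale 0 z)) ?_ ?_ h1
    · rw [← blowup_zero, blowup_mem_chartDom]
      exact mem_chartDom_self _
    · refine nhdsWithin_le_nhds ?_
      filter_upwards [hscale.eventually (hg.eventually
        ((isOpen_chartDom (k := k) _).mem_nhds (mem_chartDom_self _)))] with s hs
      exact scale_mem_chartDom.2 hs
  have hB := tendsto_coord_scale_inv hZ hc hg hc' hd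
  have hmem : tfib g z ∈ chartDom k c' := by
    rw [← blowup_zero, blowup_mem_chartDom]
    exact hc'
  exact tendsto_nhds_unique ((continuousAt_coord hmem).tendsto.comp hA) hB

end Smooth

end Total

/-! ### Smoothness of rescaled families across `s = 0`, and of the cutoff factor `φ`. -/

section Total

variable {ι : Type*} (k : ι → ℕ) {m : ι → ℕ} {B : ι → Type*}
  [∀ i, TopologicalSpace (B i)] [∀ i, ChartedSpace (Euc (k i)) (B i)]
  {V : ∀ i, B i → Type*}
  [∀ i b, AddCommGroup (V i b)] [∀ i b, Module ℝ (V i b)] [∀ i b, TopologicalSpace (V i b)]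
  [∀ i, TopologicalSpace (TotalSpace (Euc (m i)) (V i))]
  [∀ i, FiberBundle (Euc (m i)) (V i)] [∀ i, VectorBundle ℝ (Euc (m i)) (V i)]

variable {k}

section Smooth

variable [∀ i, IsManifold (𝓡 (k i)) ∞ (B i)]
  [∀ i, ContMDiffVectorBundle ∞ (Euc (m i)) (V i) (𝓡 (k i))]
  {P : Type*} [TopologicalSpace P]

theorem FamAt.eventually_continuousAt {Φ : P → Tot m V → Tot m V} {p : P} {z : Tot m V}
    (h : FamAt k Φ p z) : ∀ᶠ q in 𝓝 (p, z), ContinuousAt (Function.uncurry Φ) q := by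
  have hc := mem_chartDom_self (k := k) z
  have hc' := mem_chartDom_self (k := k) (Φ p z)
  have h1 := (h.2 z (Φ p z) hc hc' 0).eventually_continuousAt
  have hco : ∀ q : P × Tot m V, q.2 ∈ chartDom k z →
      ContinuousAt (fun q : P × Tot m V => (q.1, coord k z q.2)) q := fun q hq =>
    continuousAt_fst.prodMk (ContinuousAt.comp (g := coord k z) (f := Prod.snd)
      (continuousAt_coord hq) continuousAt_snd)
  have h2 : ∀ᶠ q in 𝓝 (p, z), q.2 ∈ chartDom k z :=
    continuousAt_snd.eventually ((isOpen_chartDom z).mem_nhds hc)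
  have h3 : ∀ᶠ q in 𝓝 (p, z), Φ q.1 q.2 ∈ chartDom k (Φ p z) :=
    h.1.eventually ((isOpen_chartDom (Φ p z)).mem_nhds hc')
  filter_upwards [(hco (p, z) hc).eventually h1, h2, eventually_eventually_nhds.2 h2,
    eventually_eventually_nhds.2 h3] with q h4 h5 h6 h7
  refine continuousAt_of_coord (c := Φ p z) h7 ?_
  have h8 := ContinuousAt.comp (f := fun q : P × Tot m V => (q.1, coord k z q.2)) h4 (hco q h5)
  refine h8.congr ?_
  filter_upwards [h6] with r hr
  exact rep_coord hr

/-- If a family is parametrically smooth near `s z`, then so is its rescaling, also in `s`. -/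
theorem FamAt.psAt_blowup {Φ : P → Tot m V → Tot m V} {p : P} {s : ℝ} {z : Tot m V}
    (h : FamAt k Φ p (scale s z)) (hZ : ∀ p, ∀ w ∈ zeroSec m V, Φ p w ∈ zeroSec m V)
    {c c' : Tot m V} (hc : z ∈ chartDom k c) (hc' : blowup (Φ p) s z ∈ chartDom k c') (n : ℕ) :
    PSAt n (fun p (w : ℝ × (Euc (k c.1) × Euc (m c.1))) =>
      coord k c' (blowup (Φ p) w.1 (coordSymm k c w.2))) (p, (s, coord k c z)) := by
  rw [blowup_mem_chartDom] at hc'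
  set x := coord k c z with hx
  have hcs : scale s z ∈ chartDom k c := scale_mem_chartDom.2 hc
  have hxs : coord k c (scale s z) = (x.1, s • x.2) := coord_scale hc s
  have himg : ∀ᶠ q in 𝓝 (p, (s, x)), q.2.2 ∈ chartImg k c :=
    (continuousAt_snd.comp continuousAt_snd).eventually
      ((isOpen_chartImg c).mem_nhds (coord_mem hc))
  have hmem : ∀ᶠ q in 𝓝 (p, (s, x)), Φ q.1 (scale q.2.1 (coordSymm k c q.2.2)) ∈ chartDom k c' := by
    have h1 : Tendsto (fun q : P × (ℝ × (Euc (k c.1) × Euc (m c.1))) =>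
        (q.1, scale q.2.1 (coordSymm k c q.2.2))) (𝓝 (p, (s, x))) (𝓝 (p, scale s z)) := by
      refine (continuousAt_fst.tendsto).prodMk_nhds ?_
      have h2 : ContinuousAt (fun q : P × (ℝ × (Euc (k c.1) × Euc (m c.1))) =>
          (q.2.1, coordSymm k c q.2.2)) (p, (s, x)) :=
        (continuousAt_fst.comp continuousAt_snd).prodMk (ContinuousAt.comp (g := coordSymm k c)
          (f := fun q : P × (ℝ × (Euc (k c.1) × Euc (m c.1))) => q.2.2)
          (continuousAt_coordSymm (coord_mem hc)) (continuousAt_snd.comp continuousAt_snd))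
      have h3 := ((continuous_scale (V := V) k).continuousAt.comp h2).tendsto
      simpa [Function.comp_def, hx, coordSymm_coord hc] using h3
    exact h1.eventually (h.1.eventually ((isOpen_chartDom c').mem_nhds hc'))
  rcases eq_or_ne s 0 with rfl | hs
  -- At `s = 0` one derivative is spent on Hadamard's formula, so order `n + 1` of the original
  -- family is used to obtain order `n` of the rescaled one.
  · have hn := (h.2 c c' hcs hc' (n + 1)).2
    have h1 := h.2 c c' hcs hc' 1
    rw [hxs, zero_smul] at hn h1
    have hmap : Continuous (fun r : (P × ℝ) × (ℝ × (Euc (k c.1) × Euc (m c.1))) =>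
        ((r.1.1, (r.2.2.1, r.1.2 • r.2.1 • r.2.2.2)) : P × (Euc (k c.1) × Euc (m c.1)))) := by
      fun_prop
    have hF : ∀ τ : ℝ, PSAt n (fun (pt : P × ℝ) (w : ℝ × (Euc (k c.1) × Euc (m c.1))) =>
        (fderiv ℝ (rep k (Φ pt.1) c c') (w.2.1, pt.2 • w.1 • w.2.2) (0, w.2.2)).2)
        ((p, τ), (0, x)) := by
      intro τ
      refine PSAt.snd (PSAt.clm_apply ?_
        (PSAt.of_contDiffAt (f := fun w : ℝ × (Euc (k c.1) × Euc (m c.1)) =>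
          ((0, w.2.2) : Euc (k c.1) × Euc (m c.1))) (by fun_prop)))
      refine PSAt.comp (K := fun pt : P × ℝ => fderiv ℝ (rep k (Φ pt.1) c c'))
        (F := fun (pt : P × ℝ) (w : ℝ × (Euc (k c.1) × Euc (m c.1))) =>
          ((w.2.1, pt.2 • w.1 • w.2.2) : Euc (k c.1) × Euc (m c.1))) ?_ ?_
      · refine PSAt.reparam (F := fun p => fderiv ℝ (rep k (Φ p) c c')) (θ := Prod.fst) ?_
          (Eventually.of_forall fun _ => continuousAt_fst)
        simpa using hn
      · refine (PSAt.of_contDiffAt (f := fun w : ℝ × (Euc (k c.1) × Euc (m c.1)) => w.2.1)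
          (by fun_prop)).prodMk ?_
        exact (PSAt.of_continuousAt (Eventually.of_forall fun _ => continuousAt_snd)).smul
          (PSAt.of_contDiffAt (f := fun w : ℝ × (Euc (k c.1) × Euc (m c.1)) => w.1 • w.2.2)
            (by fun_prop))
    -- The fundamental theorem of calculus needs differentiability along the whole segment from the
    -- zero section; at `s = 0` this segment is a point, so the tube lemma provides it nearby.
    have hline : ∀ᶠ q in 𝓝 (p, ((0 : ℝ), x)), ∀ τ ∈ Icc (0 : ℝ) 1,
        DifferentiableAt ℝ (rep k (Φ q.1) c c') (q.2.2.1, τ • q.2.1 • q.2.2.2) ∧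
        ContinuousAt (fun w : Euc (k c.1) × Euc (m c.1) => fderiv ℝ (rep k (Φ q.1) c c') w)
          (q.2.2.1, τ • q.2.1 • q.2.2.2) := by
      refine eventually_forall_Icc (q := (p, ((0 : ℝ), x)))
        (C := fun r : (P × ℝ) × (ℝ × (Euc (k c.1) × Euc (m c.1))) =>
          DifferentiableAt ℝ (rep k (Φ r.1.1) c c') (r.2.2.1, r.1.2 • r.2.1 • r.2.2.2) ∧
          ContinuousAt (fun w : Euc (k c.1) × Euc (m c.1) => fderiv ℝ (rep k (Φ r.1.1) c c') w)
            (r.2.2.1, r.1.2 • r.2.1 • r.2.2.2)) fun τ _ => ?_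
      have h3 : ∀ᶠ y in 𝓝 (p, ((x.1, 0) : Euc (k c.1) × Euc (m c.1))),
          DifferentiableAt ℝ (rep k (Φ y.1) c c') y.2 ∧
          ContinuousAt (fun w : Euc (k c.1) × Euc (m c.1) => fderiv ℝ (rep k (Φ y.1) c c') w)
            y.2 := by
        filter_upwards [h1.1, h1.2.eventually_continuousAt] with y hy1 hy2
        exact ⟨hy1.2, ContinuousAt.comp (f := fun w => (y.1, w)) (x := y.2) hy2 (by fun_prop)⟩
      have h4 := hmap.tendsto ((p, τ), (0, x))
      simp only [zero_smul, smul_zero] at h4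
      exact h4.eventually h3
    have hcont0 : ∀ᶠ q in 𝓝 (p, ((0 : ℝ), x)), ContinuousAt (Φ q.1)
        (scale 0 (coordSymm k c q.2.2)) := by
      have h2 : ContinuousAt (fun q : P × (ℝ × (Euc (k c.1) × Euc (m c.1))) =>
          ((0 : ℝ), coordSymm k c q.2.2)) (p, (0, x)) :=
        continuousAt_const.prodMk (ContinuousAt.comp (g := coordSymm k c)
          (f := fun q : P × (ℝ × (Euc (k c.1) × Euc (m c.1))) => q.2.2)
          (continuousAt_coordSymm (coord_mem hc)) (continuousAt_snd.comp continuousAt_snd))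
      have h3 : Tendsto (fun q : P × (ℝ × (Euc (k c.1) × Euc (m c.1))) =>
          (q.1, scale 0 (coordSymm k c q.2.2))) (𝓝 (p, (0, x))) (𝓝 (p, scale 0 z)) := by
        refine (continuousAt_fst.tendsto).prodMk_nhds ?_
        have h3 := ((continuous_scale (V := V) k).continuousAt.comp h2).tendsto
        simpa [Function.comp_def, hx, coordSymm_coord hc] using h3
      filter_upwards [h3.eventually h.eventually_continuousAt] with q hq
      exact ContinuousAt.comp (f := fun w => (q.1, w)) hq (by fun_prop)
    have hmem0 : ∀ᶠ q in 𝓝 (p, ((0 : ℝ), x)),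
        Φ q.1 (scale 0 (coordSymm k c q.2.2)) ∈ chartDom k c' := by
      have h3 : ContinuousAt (fun q : P × (ℝ × (Euc (k c.1) × Euc (m c.1))) =>
        (q.1, ((0 : ℝ), q.2.2))) (p, (0, x)) := by fun_prop
      exact h3.eventually hmem
    -- Hadamard's formula: the quotient of the fibre coordinate by `s` is replaced by an integral
    -- that makes sense for `s = 0`. There the integrand is constant in `τ` and equals the fibre
    -- derivative.
    refine PSAt.congr (F := fun p (w : ℝ × (Euc (k c.1) × Euc (m c.1))) =>
      ((rep k (Φ p) c c' (w.2.1, w.1 • w.2.2)).1, ∫ τ in (0 : ℝ)..1,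
        (fderiv ℝ (rep k (Φ p) c c') (w.2.1, τ • w.1 • w.2.2) (0, w.2.2)).2))
      (PSAt.prodMk ?_ ?_) ?_
    · refine PSAt.fst (PSAt.comp (K := fun p => rep k (Φ p) c c')
        (F := fun _ (w : ℝ × (Euc (k c.1) × Euc (m c.1))) =>
          ((w.2.1, w.1 • w.2.2) : Euc (k c.1) × Euc (m c.1)))
        ?_ (PSAt.of_contDiffAt (by fun_prop)))
      have := h.2 c c' hcs hc' n
      rw [hxs] at this
      exact this
    · exact PSAt.integral (F := fun (pt : P × ℝ) (w : ℝ × (Euc (k c.1) × Euc (m c.1))) =>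
        (fderiv ℝ (rep k (Φ pt.1) c c') (w.2.1, pt.2 • w.1 • w.2.2) (0, w.2.2)).2)
        fun τ _ => hF τ
    · filter_upwards [himg, hmem, hline, hcont0, hmem0] with q h2 h3 h4 h5 h6
      obtain ⟨p', σ, u⟩ := q
      dsimp only at h2 h3 h4 h5 h6 ⊢
      have hu := coordSymm_mem h2
      have e1 : coord k c (coordSymm k c u) = u := coord_coordSymm h2
      have e2 : ∀ t : ℝ, rep k (Φ p') c c' (u.1, t • u.2) =
          coord k c' (Φ p' (scale t (coordSymm k c u))) := fun t => by
        have := rep_apply_smul (g := Φ p') (c' := c') hu t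
        rwa [e1] at this
      rcases eq_or_ne σ 0 with rfl | hσ
      · have h7 := (h4 0 ⟨le_rfl, zero_le_one⟩).1
        simp only [zero_smul, smul_zero] at h7 ⊢
        have e3 : coord k c (scale 0 (coordSymm k c u)) = (u.1, 0) := by
          rw [coord_scale_zero hu, e1]
        rw [blowup_zero, coord_tfib (hZ p') hu h5 h6 (by rwa [e3]), e3, e1]
        simp
      · rw [blowup_of_ne _ hσ, coord_scale h3, ← e2 σ]
        refine Prod.ext rfl ?_
        dsimp only
        have hder : ∀ τ ∈ Icc (0 : ℝ) 1,
            HasDerivAt (fun τ : ℝ => (rep k (Φ p') c c' (u.1, τ • σ • u.2)).2)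
            (σ • (fderiv ℝ (rep k (Φ p') c c') (u.1, τ • σ • u.2) (0, u.2)).2) τ := by
          intro τ hτ
          have h8 : HasDerivAt (fun τ : ℝ => ((u.1, τ • σ • u.2) : Euc (k c.1) × Euc (m c.1)))
              (0, σ • u.2) τ := by
            refine (hasDerivAt_const _ _).prodMk ?_
            simpa using (hasDerivAt_id τ).smul_const (σ • u.2)
          have h9 := (ContinuousLinearMap.snd ℝ (Euc (k c'.1)) (Euc (m c'.1))).hasFDerivAt.comp_hasDerivAt τ
            ((h4 τ hτ).1.hasFDerivAt.comp_hasDerivAt τ h8)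
          have e4 : ((0, σ • u.2) : Euc (k c.1) × Euc (m c.1)) = σ • (0, u.2) := by simp
          rw [e4, map_smul] at h9
          exact h9
        have hcont : ContinuousOn (fun τ : ℝ =>
            (fderiv ℝ (rep k (Φ p') c c') (u.1, τ • σ • u.2) (0, u.2)).2) (Icc 0 1) := by
          intro τ hτ
          have h10 : ContinuousAt (fun τ : ℝ =>
              fderiv ℝ (rep k (Φ p') c c') (u.1, τ • σ • u.2)) τ :=
            ContinuousAt.comp (f := fun τ : ℝ => ((u.1, τ • σ • u.2) : Euc (k c.1) × Euc (m c.1)))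
              (h4 τ hτ).2 (by fun_prop)
          exact (h10.clm_apply continuousAt_const).snd.continuousWithinAt
        have hint := intervalIntegral.integral_eq_sub_of_hasDerivAt
          (fun τ hτ => hder τ (by rwa [uIcc_of_le zero_le_one] at hτ))
          ((hcont.const_smul σ).intervalIntegrable_of_Icc zero_le_one)
        simp only [intervalIntegral.integral_smul, one_smul, zero_smul] at hint
        have hz : (rep k (Φ p') c c' (u.1, 0)).2 = 0 := by
          have := e2 0
          rw [zero_smul] at this
          rw [this]
          exact (mem_zeroSec_iff h6).1 (hZ p' _ (scale_zero_mem _))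
        rw [hz, sub_zero] at hint
        rw [← hint, smul_smul, inv_mul_cancel₀ hσ, one_smul]
  -- Away from `s = 0` the division is by a nonvanishing smooth function, and no order is lost.
  · have hn := h.2 c c' hcs hc' n
    rw [hxs] at hn
    have hr : PSAt n (fun p (w : ℝ × (Euc (k c.1) × Euc (m c.1))) =>
        rep k (Φ p) c c' (w.2.1, w.1 • w.2.2)) (p, (s, x)) :=
      PSAt.comp (K := fun p => rep k (Φ p) c c')
        (F := fun _ (w : ℝ × (Euc (k c.1) × Euc (m c.1))) =>
          ((w.2.1, w.1 • w.2.2) : Euc (k c.1) × Euc (m c.1)))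
        hn (PSAt.of_contDiffAt (by fun_prop))
    refine PSAt.congr (F := fun p (w : ℝ × (Euc (k c.1) × Euc (m c.1))) =>
      ((rep k (Φ p) c c' (w.2.1, w.1 • w.2.2)).1,
        w.1⁻¹ • (rep k (Φ p) c c' (w.2.1, w.1 • w.2.2)).2)) ?_ ?_
    · refine hr.fst.prodMk (PSAt.smul
        (PSAt.of_contDiffAt (f := fun w : ℝ × (Euc (k c.1) × Euc (m c.1)) => w.1⁻¹) ?_)
        hr.snd)
      exact contDiffAt_fst.inv hs
    · have hs' : ∀ᶠ q in 𝓝 (p, (s, x)), q.2.1 ≠ 0 :=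
        ContinuousAt.eventually_ne (continuousAt_fst.comp continuousAt_snd) hs
      filter_upwards [himg, hmem, hs'] with q h2 h3 h4
      rw [blowup_of_ne _ h4, coord_scale h3]
      have := rep_apply_smul (g := Φ q.1) (c' := c') (coordSymm_mem h2) q.2.1
      rw [coord_coordSymm h2] at this
      rw [this]

theorem FamAt.continuousAt_blowup {Φ : P → Tot m V → Tot m V} {p : P} {s : ℝ} {z : Tot m V}
    (h : FamAt k Φ p (scale s z)) (hZ : ∀ p, ∀ w ∈ zeroSec m V, Φ p w ∈ zeroSec m V) :
    ContinuousAt (fun q : P × (ℝ × Tot m V) => blowup (Φ q.1) q.2.1 q.2.2) (p, (s, z)) := by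
  have hc := mem_chartDom_self (k := k) z
  have hc' := mem_chartDom_self (k := k) (blowup (Φ p) s z)
  have h1 := (h.psAt_blowup hZ hc hc' 0).continuousAt
  have hc'' := blowup_mem_chartDom.1 hc'
  have hco : ContinuousAt (fun q : P × (ℝ × Tot m V) => (q.1, (q.2.1, coord k z q.2.2)))
      (p, (s, z)) :=
    continuousAt_fst.prodMk ((continuousAt_fst.comp continuousAt_snd).prodMk
      (ContinuousAt.comp (g := coord k z) (f := fun q : P × (ℝ × Tot m V) => q.2.2)
      (continuousAt_coord hc) (continuousAt_snd.comp continuousAt_snd)))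
  have h2 : ∀ᶠ q in 𝓝 (p, (s, z)), q.2.2 ∈ chartDom k z :=
    (continuousAt_snd.comp continuousAt_snd).eventually ((isOpen_chartDom z).mem_nhds hc)
  have h3 : ∀ᶠ q in 𝓝 (p, (s, z)), blowup (Φ q.1) q.2.1 q.2.2 ∈
      chartDom k (blowup (Φ p) s z) := by
    have h4 : ContinuousAt (fun q : P × (ℝ × Tot m V) => (q.1, scale q.2.1 q.2.2))
        (p, (s, z)) := continuousAt_fst.prodMk
      ((continuous_scale (V := V) k).continuousAt.comp continuousAt_snd)
    have h5 : ∀ᶠ q in 𝓝 (p, (s, z)),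
        Φ q.1 (scale q.2.1 q.2.2) ∈ chartDom k (blowup (Φ p) s z) :=
      h4.tendsto.eventually (h.1.eventually ((isOpen_chartDom _).mem_nhds hc''))
    exact h5.mono fun q hq => blowup_mem_chartDom.2 hq
  refine continuousAt_of_coord h3 ?_
  have h8 := ContinuousAt.comp
    (f := fun q : P × (ℝ × Tot m V) => (q.1, (q.2.1, coord k z q.2.2))) h1 hco
  refine h8.congr ?_
  filter_upwards [h2] with r hr
  simp only [Function.comp, Function.uncurry, coordSymm_coord hr]

/-- The scaling factor varies with the point, so the smoothness in `s` is needed: the family is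
composed with `u ↦ (σ p u, u)`. This is why `FamAt.psAt_blowup` treats `s` as a space variable
rather than as a parameter. -/
theorem FamAt.blowup {Φ : P → Tot m V → Tot m V} {σ : P → Tot m V → ℝ} {p : P} {z : Tot m V}
    (h : FamAt k Φ p (scale (σ p z) z)) (hZ : ∀ p, ∀ w ∈ zeroSec m V, Φ p w ∈ zeroSec m V)
    (hσ : ContinuousAt (Function.uncurry σ) (p, z))
    (hσ' : ∀ c, z ∈ chartDom k c → ∀ n, PSAt n (fun p u => σ p (coordSymm k c u))
      (p, coord k c z)) :
    FamAt k (fun p z => LinEmb.blowup (Φ p) (σ p z) z) p z := by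
  refine ⟨?_, fun c c' hc hc' n => ?_⟩
  · exact ContinuousAt.comp (g := fun q : P × (ℝ × Tot m V) => LinEmb.blowup (Φ q.1) q.2.1 q.2.2)
      (f := fun q : P × Tot m V => (q.1, (σ q.1 q.2, q.2))) (x := (p, z))
      (h.continuousAt_blowup hZ) (continuousAt_fst.prodMk (hσ.prodMk continuousAt_snd))
  · refine PSAt.comp (K := fun p (w : ℝ × (Euc (k c.1) × Euc (m c.1))) =>
      coord k c' (LinEmb.blowup (Φ p) w.1 (coordSymm k c w.2)))
      (F := fun p u => (σ p (coordSymm k c u), u)) ?_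
      ((hσ' c hc n).prodMk (PSAt.of_contDiffAt contDiffAt_id))
    have := h.psAt_blowup hZ hc hc' n
    simpa only [coordSymm_coord hc] using this

theorem phi_eq_of_le {ξ : ∀ i, OrthogonalStructure (k i) (m i) (V i)} {a : ℝ} {μ : ℝ → ℝ}
    (hμ0 : ∀ s ∈ Icc 0 a, μ s = 0) {d : ℝ} (hd : 0 < d) (t : ℝ) {z : Tot m V}
    (hz : nrm ξ z ≤ a * d) : phi ξ μ d t z = t := by
  rw [phi, hμ0 _ ⟨div_nonneg (nrm_nonneg ξ z) hd.le, (div_le_iff₀ hd).2 hz⟩]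
  ring

theorem phi_eq_one {ξ : ∀ i, OrthogonalStructure (k i) (m i) (V i)} {b : ℝ} {μ : ℝ → ℝ}
    (hμ1 : ∀ s, b ≤ s → μ s = 1) {d : ℝ} (hd : 0 < d) (t : ℝ) {z : Tot m V}
    (hz : b * d ≤ nrm ξ z) : phi ξ μ d t z = 1 := by
  rw [phi, hμ1 _ ((le_div_iff₀ hd).2 hz)]
  ring

/-- Inside radius `a D` the cutoff is locally constant in space, which hides the non-smoothness of
the norm; elsewhere the norm is the square root of a positive smooth function. -/
theorem psAt_phi {ξ : ∀ i, OrthogonalStructure (k i) (m i) (V i)} {a : ℝ} (ha : 0 < a) {μ : ℝ → ℝ}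
    (hμ : ContDiff ℝ ∞ μ) (hμ0 : ∀ s ∈ Icc 0 a, μ s = 0) {D T : P → ℝ} (hD : Continuous D)
    (hT : Continuous T) {p : P} (hDp : 0 < D p) {c z : Tot m V} (hc : z ∈ chartDom k c) (n : ℕ) :
    PSAt n (fun p u => phi ξ μ (D p) (T p) (coordSymm k c u)) (p, coord k c z) := by
  have hTps : PSAt n (fun p (_ : Euc (k c.1) × Euc (m c.1)) => T p) (p, coord k c z) :=
    PSAt.of_continuousAt (Eventually.of_forall fun _ => hT.continuousAt)
  have hDpos : ∀ᶠ q in 𝓝 (p, coord k c z), 0 < D q.1 :=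
    (hD.continuousAt.comp continuousAt_fst).eventually (lt_mem_nhds hDp)
  have hz : nrm ξ (coordSymm k c (coord k c z)) = nrm ξ z := by rw [coordSymm_coord hc]
  have hnrm : ContinuousAt (fun q : P × (Euc (k c.1) × Euc (m c.1)) =>
      nrm ξ (coordSymm k c q.2)) (p, coord k c z) :=
    (continuous_nrm ξ).continuousAt.comp (ContinuousAt.comp (g := coordSymm k c) (f := Prod.snd)
      (continuousAt_coordSymm (coord_mem hc)) continuousAt_snd)
  by_cases h : nrm ξ z < a * D p
  · refine hTps.congr ?_
    have h1 : ∀ᶠ q in 𝓝 (p, coord k c z), nrm ξ (coordSymm k c q.2) < a * D q.1 := by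
      refine hnrm.eventually_lt (continuousAt_const.mul (hD.continuousAt.comp continuousAt_fst)) ?_
      rwa [hz]
    filter_upwards [h1, hDpos] with q h2 h3
    exact (phi_eq_of_le hμ0 h3 _ h2.le).symm
  · have hpos : 0 < nrm ξ z := (mul_pos ha hDp).trans_le (not_lt.1 h)
    have hsq : ContDiffAt ℝ n (fun u => nrm ξ (coordSymm k c u)) (coord k c z) := by
      have h1 : ContDiffAt ℝ n (fun u => nrm ξ (coordSymm k c u) ^ 2) (coord k c z) :=
        (((contDiffOn_nrm_sq ξ c).contDiffAt ((isOpen_chartImg c).mem_nhds (coord_mem hc)))).of_le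
          (by exact_mod_cast le_top)
      have h2 := h1.sqrt (by rw [hz]; positivity)
      refine h2.congr_of_eventuallyEq (Eventually.of_forall fun u => ?_)
      exact (Real.sqrt_sq (nrm_nonneg ξ _)).symm
    have hinv : PSAt n (fun p (_ : Euc (k c.1) × Euc (m c.1)) => (D p)⁻¹) (p, coord k c z) :=
      PSAt.of_continuousAt ((hD.continuousAt.eventually (lt_mem_nhds hDp)).mono
        fun q hq => hD.continuousAt.inv₀ hq.ne')
    have hquot := hinv.smul (PSAt.of_contDiffAt (q := (p, coord k c z)) hsq)
    have hμps := PSAt.contDiffAt_comp (f := μ)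
      ((hμ.of_le (m := (n : ℕ∞ω)) (by exact_mod_cast le_top)).contDiffAt) hquot
    have h1T : PSAt n (fun p (_ : Euc (k c.1) × Euc (m c.1)) => 1 - T p) (p, coord k c z) :=
      PSAt.of_continuousAt (Eventually.of_forall fun _ => (continuous_const.sub hT).continuousAt)
    refine (hTps.add (h1T.smul hμps)).congr (Eventually.of_forall fun q => ?_)
    rw [phi, smul_eq_mul, smul_eq_mul, div_eq_inv_mul]

theorem continuousAt_phi {ξ : ∀ i, OrthogonalStructure (k i) (m i) (V i)} {μ : ℝ → ℝ}
    (hμ : Continuous μ) {D T : P → ℝ} (hD : Continuous D)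
    (hT : Continuous T) {p : P} (hDp : 0 < D p) (z : Tot m V) :
    ContinuousAt (fun q : P × Tot m V => phi ξ μ (D q.1) (T q.1) q.2) (p, z) := by
  have h1 : ContinuousAt (fun q : P × Tot m V => nrm ξ q.2 / D q.1) (p, z) :=
    ((continuous_nrm ξ).continuousAt.comp continuousAt_snd).div
      (hD.continuousAt.comp continuousAt_fst) hDp.ne'
  have h2 : ContinuousAt (fun q : P × Tot m V => T q.1) (p, z) :=
    hT.continuousAt.comp continuousAt_fst
  exact h2.add ((continuousAt_const.sub h2).mul (hμ.continuousAt.comp h1))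

end Smooth

end Total

/-! ### Embeddings preserve the dimension of the base and the rank of the bundle. -/

/-- An injective continuous self-map of a compact locally connected space that does not decrease a
locally constant function, and is open where it preserves it, preserves it everywhere. -/
theorem eq_of_le_of_open {X : Type*} [TopologicalSpace X] [CompactSpace X] [LocallyConnectedSpace X]
    [T2Space X] {f : X → X} (hf : Continuous f) (hinj : Function.Injective f) {κ : X → ℕ}
    (hκ : Continuous κ) (hle : ∀ x, κ x ≤ κ (f x))
    (hopen : ∀ x, κ (f x) = κ x → ∀ U ∈ 𝓝 x, f '' U ∈ 𝓝 (f x)) (x : X) : κ (f x) = κ x := by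
  set σ := hf.connectedComponentsMap with hσ
  set κ' := hκ.connectedComponentsLift with hκ'
  have hσx : ∀ x, σ (ConnectedComponents.mk x) = ConnectedComponents.mk (f x) := fun _ => rfl
  have hκx : ∀ x, κ' (ConnectedComponents.mk x) = κ x := fun _ => rfl
  -- A component on which `κ` is preserved has a closed and open image, which therefore contains the
  -- whole target component; by injectivity no other component can map there.
  have hA : ∀ y₁ y₂, σ y₁ = σ y₂ → κ' (σ y₁) = κ' y₁ → y₁ = y₂ := by
    intro y₁ y₂ h1 h2
    obtain ⟨x₁, rfl⟩ := ConnectedComponents.surjective_coe y₁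
    obtain ⟨x₂, rfl⟩ := ConnectedComponents.surjective_coe y₂
    have hcl : IsClosed (f '' connectedComponent x₁) :=
      ((isClosed_connectedComponent.isCompact).image hf).isClosed
    have hop : IsOpen (f '' connectedComponent x₁) := by
      rw [isOpen_iff_mem_nhds]
      rintro _ ⟨x, hx, rfl⟩
      have hmk : (ConnectedComponents.mk x) = ConnectedComponents.mk x₁ :=
        ConnectedComponents.coe_eq_coe'.2 hx
      refine hopen x ?_ _ (isOpen_connectedComponent.mem_nhds hx)
      rw [← hκx, ← hκx, ← hσx, hmk]
      exact h2
    have hmem : f x₂ ∈ connectedComponent (f x₁) := ConnectedComponents.coe_eq_coe'.1 h1.symm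
    obtain ⟨x, hx, hxe⟩ := IsClopen.connectedComponent_subset ⟨hcl, hop⟩
      ⟨x₁, mem_connectedComponent, rfl⟩ hmem
    rw [hinj hxe] at hx
    exact (ConnectedComponents.coe_eq_coe'.2 hx).symm
  have hle' : ∀ y, κ' y ≤ κ' (σ y) := by
    intro y
    obtain ⟨x, rfl⟩ := ConnectedComponents.surjective_coe y
    exact hle x
  suffices h : ∀ y, κ' (σ y) = κ' y from h (ConnectedComponents.mk x)
  by_contra! hbad
  -- A compact locally connected space has finitely many components. Among those where `κ` jumps,
  -- take one with the largest `κ`; all components with larger `κ` are then preserved.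
  obtain ⟨y₀, hy₀, hmax⟩ := Set.exists_max_image {y | κ' (σ y) ≠ κ' y} κ' (Set.toFinite _) hbad
  set S := {y | κ' y₀ < κ' y}
  have hgood : ∀ y ∈ S, κ' (σ y) = κ' y := fun y hy => by
    by_contra h
    exact absurd (hmax y h) (not_le.2 hy)
  have hmaps : ∀ y : S, σ y ∈ S := fun y => by
    change κ' y₀ < κ' (σ y)
    rw [hgood y y.2]
    exact y.2
  -- The components with `κ` above `κ' y₀` form a finite set that is mapped injectively, so
  -- bijectively, to itself. It contains `σ y₀`, which is thus also hit from inside `S`, and `hA`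
  -- puts `y₀` in `S`, a contradiction.
  have hsurj : Function.Surjective (fun y : S => (⟨σ y, hmaps y⟩ : S)) := by
    refine Finite.surjective_of_injective fun y₁ y₂ h => ?_
    exact Subtype.ext (hA _ _ (congrArg Subtype.val h) (hgood y₁ y₁.2))
  obtain ⟨y₁, hy₁⟩ := hsurj ⟨σ y₀, (hle' y₀).lt_of_ne (Ne.symm hy₀)⟩
  have h3 : (y₁ : ConnectedComponents X) = y₀ :=
    hA _ _ (congrArg Subtype.val hy₁) (hgood y₁ y₁.2)
  have h4 : κ' y₀ < κ' y₁ := y₁.2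
  rw [h3] at h4
  exact lt_irrefl _ h4

theorem locallyConnectedSpace_sigma {ι : Type*} {X : ι → Type*} [∀ i, TopologicalSpace (X i)]
    [∀ i, LocallyConnectedSpace (X i)] : LocallyConnectedSpace (Σ i, X i) := by
  refine locallyConnectedSpace_iff_subsets_isOpen_isConnected.2 ?_
  rintro ⟨i, x⟩ U hU
  obtain ⟨W, hW, hWo, hxW, hWc⟩ := locallyConnectedSpace_iff_subsets_isOpen_isConnected.1
    (inferInstanceAs (LocallyConnectedSpace (X i))) x _ (continuous_sigmaMk.continuousAt hU)
  exact ⟨Sigma.mk i '' W, image_subset_iff.2 hW, isOpenMap_sigmaMk _ hWo, ⟨x, hxW, rfl⟩,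
    hWc.image _ continuous_sigmaMk.continuousOn⟩

section Total

variable {ι : Type*} (k : ι → ℕ) {m : ι → ℕ} {B : ι → Type*}
  [∀ i, TopologicalSpace (B i)] [∀ i, ChartedSpace (Euc (k i)) (B i)]
  {V : ∀ i, B i → Type*}
  [∀ i b, AddCommGroup (V i b)] [∀ i b, Module ℝ (V i b)] [∀ i b, TopologicalSpace (V i b)]
  [∀ i, TopologicalSpace (TotalSpace (Euc (m i)) (V i))]
  [∀ i, FiberBundle (Euc (m i)) (V i)] [∀ i, VectorBundle ℝ (Euc (m i)) (V i)]

variable {k}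

section Smooth

variable [∀ i, IsManifold (𝓡 (k i)) ∞ (B i)]
  [∀ i, ContMDiffVectorBundle ∞ (Euc (m i)) (V i) (𝓡 (k i))] {N : Set (Tot m V)}

theorem Emb.zeroSec_mapsTo (h : Emb k N) (hB : zeroSec m V ⊆ interior N) :
    ∀ w ∈ zeroSec m V, ext h w ∈ zeroSec m V := fun w hw => by
  rw [ext_of_mem _ (interior_subset (hB hw))]
  exact h.2.1 ⟨w, interior_subset (hB hw)⟩ hw

theorem Emb.continuousAt_ext (h : Emb k N) {z : Tot m V} (hz : z ∈ interior N) :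
    ContinuousAt (ext h) z :=
  (continuousOn_ext h.1.continuous_toFun).continuousAt (mem_interior_iff_mem_nhds.1 hz)

theorem Emb.injOn_ext (h : Emb k N) : InjOn (ext h) N := fun z hz w hw he => by
  rw [ext_of_mem _ hz, ext_of_mem _ hw] at he
  exact congrArg Subtype.val (h.2.2.1.injective he)

theorem Emb.fderiv_rep_injective (h : Emb k N) {z c c' : Tot m V} (hz : z ∈ interior N)
    (hc : z ∈ chartDom k c) (hc' : ext h z ∈ chartDom k c') :
    Function.Injective (fderiv ℝ (rep k (ext h) c c') (coord k c z)) := by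
  obtain ⟨i, x⟩ := z
  have hzN : (⟨i, x⟩ : Tot m V) ∈ N := interior_subset hz
  have h1 := h.2.2.2 i x hzN
  rw [mfderivWithin_loc_injective_iff (w := ext h ⟨i, x⟩) rfl
    ((h.1.smooth_toFun i x hzN).mdifferentiableWithinAt (by simp)),
    fderivWithin_of_mem_nhds (chartSet_mem_nhds hz (mem_chartDom_self (k := k) _))] at h1
  exact injective_fderiv_rep (h.continuousAt_ext hz) (mem_chartDom_self _) (mem_chartDom_self _)
    hc hc' ((h.1.contDiffAt_rep hz hc hc').differentiableAt (by simp)) h1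

/-- A map that preserves the zero section has block triangular derivative there. -/
theorem fderiv_rep_inl_snd {g : Tot m V → Tot m V} (hZ : ∀ w ∈ zeroSec m V, g w ∈ zeroSec m V)
    {c c' z : Tot m V} (hzZ : z ∈ zeroSec m V) (hc : z ∈ chartDom k c) (hg : ContinuousAt g z)
    (hc' : g z ∈ chartDom k c') (hd : DifferentiableAt ℝ (rep k g c c') (coord k c z))
    (w : Euc (k c.1)) : (fderiv ℝ (rep k g c c') (coord k c z) (w, 0)).2 = 0 := by
  set x := coord k c z with hx
  have hx0 : x = (x.1, 0) := Prod.ext rfl ((mem_zeroSec_iff hc).1 hzZ)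
  have hin : ContinuousAt (fun u : Euc (k c.1) => ((u, 0) : Euc (k c.1) × Euc (m c.1))) x.1 := by
    fun_prop
  have h1 : (fun u : Euc (k c.1) => (rep k g c c' (u, 0)).2) =ᶠ[𝓝 x.1] fun _ => 0 := by
    have h2 : ∀ᶠ u in 𝓝 x, u ∈ chartImg k c ∧ g (coordSymm k c u) ∈ chartDom k c' := by
      refine Filter.Eventually.and ((isOpen_chartImg c).mem_nhds (coord_mem hc)) ?_
      have h5 := continuousAt_coordSymm (coord_mem hc)
      rw [ContinuousAt, coordSymm_coord hc] at h5
      exact h5.eventually (hg.eventually ((isOpen_chartDom c').mem_nhds hc'))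
    rw [hx0] at h2
    filter_upwards [hin.eventually h2] with u hu
    refine (mem_zeroSec_iff hu.2).1 (hZ _ ((mem_zeroSec_iff (coordSymm_mem hu.1)).2 ?_))
    rw [coord_coordSymm hu.1]
  have h3 : HasFDerivAt (fun u : Euc (k c.1) => (rep k g c c' (u, 0)).2)
      ((ContinuousLinearMap.snd ℝ _ _).comp ((fderiv ℝ (rep k g c c') x).comp
        (ContinuousLinearMap.inl ℝ _ _))) x.1 := by
    have h4 : HasFDerivAt (rep k g c c') (fderiv ℝ (rep k g c c') x) (x.1, 0) := by
      rw [← hx0]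
      exact hd.hasFDerivAt
    have h6 : HasFDerivAt (fun u : Euc (k c.1) => ((u, 0) : Euc (k c.1) × Euc (m c.1)))
      (ContinuousLinearMap.inl ℝ _ _) x.1 := hasFDerivAt_prodMk_left _ _
    exact (ContinuousLinearMap.snd ℝ _ _).hasFDerivAt.comp x.1
      (HasFDerivAt.comp (g := rep k g c c') x.1 h4 h6)
  have h5 := h3.unique ((hasFDerivAt_const (0 : Euc (m c'.1)) x.1).congr_of_eventuallyEq h1)
  exact DFunLike.congr_fun h5 w

/-- The horizontal block of the derivative is injective, hence bijective for equal base dimensions,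
and the map induced on the zero section is open at `z` by the inverse function theorem. -/
theorem eventually_mem_image_zeroSec {g : Tot m V → Tot m V} (hZ : ∀ w ∈ zeroSec m V, g w ∈ zeroSec m V)
    {c c' z : Tot m V} (hzZ : z ∈ zeroSec m V) (hc : z ∈ chartDom k c)
    (hc' : g z ∈ chartDom k c') (hd : ContDiffAt ℝ ∞ (rep k g c c') (coord k c z))
    (hg : ContinuousAt g z)
    (hinj : Function.Injective (fderiv ℝ (rep k g c c') (coord k c z))) (hk : k c.1 = k c'.1)
    {U : Set (Tot m V)} (hU : U ∈ 𝓝 z) :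
    ∀ᶠ w in 𝓝 (g z), w ∈ zeroSec m V → w ∈ g '' (U ∩ zeroSec m V) := by
  set x := coord k c z with hx
  have hx0 : x = (x.1, 0) := Prod.ext rfl ((mem_zeroSec_iff hc).1 hzZ)
  set A : Euc (k c.1) →L[ℝ] Euc (k c'.1) := (ContinuousLinearMap.fst ℝ _ _).comp
    ((fderiv ℝ (rep k g c c') x).comp (ContinuousLinearMap.inl ℝ _ _))
  have hAinj : Function.Injective A := by
    intro v w hvw
    have h2 : fderiv ℝ (rep k g c c') x (v, 0) = fderiv ℝ (rep k g c c') x (w, 0) := by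
      refine Prod.ext hvw ?_
      rw [fderiv_rep_inl_snd hZ hzZ hc hg hc' (hd.differentiableAt (by simp)),
        fderiv_rep_inl_snd hZ hzZ hc hg hc' (hd.differentiableAt (by simp))]
    exact congrArg Prod.fst (hinj h2)
  have hAsurj : A.range = ⊤ := by
    rw [LinearMap.range_eq_top]
    exact (LinearMap.injective_iff_surjective_of_finrank_eq_finrank
      (by simp [hk])).1 hAinj
  have hstrict : HasStrictFDerivAt (fun u : Euc (k c.1) => (rep k g c c' (u, 0)).1) A x.1 := by
    have h4 : HasStrictFDerivAt (rep k g c c') (fderiv ℝ (rep k g c c') x) (x.1, 0) := by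
      rw [← hx0]
      exact hd.hasStrictFDerivAt (by simp)
    have h6 : HasStrictFDerivAt (fun u : Euc (k c.1) => ((u, 0) : Euc (k c.1) × Euc (m c.1)))
      (ContinuousLinearMap.inl ℝ _ _) x.1 :=
      (ContinuousLinearMap.inl ℝ (Euc (k c.1)) (Euc (m c.1))).hasStrictFDerivAt
    exact (ContinuousLinearMap.fst ℝ _ _).hasStrictFDerivAt.comp x.1
      (HasStrictFDerivAt.comp (g := rep k g c c') x.1 h4 h6)
  have hmap := hstrict.map_nhds_eq_of_surj hAsurj
  have hin : Tendsto (fun u : Euc (k c.1) => ((u, 0) : Euc (k c.1) × Euc (m c.1))) (𝓝 x.1)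
      (𝓝 x) := by
    refine Continuous.tendsto' (by fun_prop) _ _ hx0.symm
  have h6 : ∀ᶠ u in 𝓝 x.1, (u, 0) ∈ chartImg k c ∧ coordSymm k c (u, 0) ∈ U ∧
      g (coordSymm k c (u, 0)) ∈ chartDom k c' := by
    have h5 := continuousAt_coordSymm (coord_mem hc)
    rw [ContinuousAt, coordSymm_coord hc] at h5
    exact Filter.Eventually.and (hin.eventually ((isOpen_chartImg c).mem_nhds (coord_mem hc)))
      (((h5.comp hin).eventually hU).and ((h5.comp hin).eventually
        (hg.eventually ((isOpen_chartDom c').mem_nhds hc'))))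
  have h7 : (fun u : Euc (k c.1) => (rep k g c c' (u, 0)).1) '' {u | (u, 0) ∈ chartImg k c ∧
      coordSymm k c (u, 0) ∈ U ∧ g (coordSymm k c (u, 0)) ∈ chartDom k c'} ∈
      𝓝 ((rep k g c c' (x.1, 0)).1) := by
    rw [← hmap]
    exact image_mem_map h6
  have e1 : rep k g c c' (x.1, 0) = coord k c' (g z) := by
    rw [← hx0, hx, rep_coord hc]
  rw [e1] at h7
  filter_upwards [(continuousAt_coord hc').fst.eventually h7,
    (isOpen_chartDom c').mem_nhds hc'] with w hw hwc hwZ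
  obtain ⟨u, ⟨hu1, hu2, hu3⟩, hu4⟩ := hw
  have hu0 : coordSymm k c (u, 0) ∈ zeroSec m V := by
    rw [mem_zeroSec_iff (coordSymm_mem hu1), coord_coordSymm hu1]
  refine ⟨coordSymm k c (u, 0), ⟨hu2, hu0⟩, injOn_coord c' hu3 hwc (Prod.ext hu4 ?_)⟩
  rw [(mem_zeroSec_iff hu3).1 (hZ _ hu0), (mem_zeroSec_iff hwc).1 hwZ]

variable [Finite ι] [∀ i, CompactSpace (B i)] [∀ i, T2Space (B i)]

/-- An embedding that preserves the zero section preserves the dimension and the rank. -/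
theorem Emb.dim_eq (h : Emb k N) (hB : zeroSec m V ⊆ interior N) {z : Tot m V}
    (hz : z ∈ zeroSec m V) : k (ext h z).1 = k z.1 ∧ m (ext h z).1 = m z.1 := by
  have hlc : ∀ i, LocallyConnectedSpace (B i) := fun i =>
    ChartedSpace.locallyConnectedSpace (Euc (k i)) (B i)
  have : LocallyConnectedSpace (Σ i, B i) := locallyConnectedSpace_sigma
  set zero : (Σ i, B i) → Tot m V := fun x => ⟨x.1, ⟨x.2, 0⟩⟩ with hzero
  set base : Tot m V → Σ i, B i := fun z => ⟨z.1, z.2.proj⟩ with hbase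
  have hzero_mem : ∀ x, zero x ∈ zeroSec m V := fun x => rfl
  have hbz : ∀ x, base (zero x) = x := fun x => rfl
  have hzb : ∀ z ∈ zeroSec m V, zero (base z) = z := by
    rintro ⟨i, b, v⟩ hv
    obtain rfl : v = 0 := hv
    rfl
  have hzero_cont : Continuous zero := continuous_sigma fun i =>
    continuous_sigmaMk.comp (contMDiff_zeroSection ℝ (V i) (n := ∞) (IB := 𝓡 (k i))).continuous
  have hbase_cont : Continuous base := continuous_sigma fun i =>
    continuous_sigmaMk.comp (FiberBundle.continuous_proj (Euc (m i)) (V i))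
  have hZ := h.zeroSec_mapsTo hB
  set f : (Σ i, B i) → Σ i, B i := fun x => base (ext h (zero x)) with hf
  have hzf : ∀ x, zero (f x) = ext h (zero x) := fun x => hzb _ (hZ _ (hzero_mem x))
  have hf_cont : Continuous f := by
    refine hbase_cont.comp (continuous_iff_continuousAt.2 fun x => ?_)
    exact ContinuousAt.comp (g := ext h) (h.continuousAt_ext (hB (hzero_mem x)))
      hzero_cont.continuousAt
  have hf_inj : Function.Injective f := by
    intro x y hxy
    have h1 : ext h (zero x) = ext h (zero y) := by rw [← hzf, ← hzf, hxy]
    have h2 := h.injOn_ext (interior_subset (hB (hzero_mem x)))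
      (interior_subset (hB (hzero_mem y))) h1
    rw [← hbz x, ← hbz y, h2]
  have hloc : ∀ φ : ι → ℕ, Continuous (fun x : Σ i, B i => φ x.1) := fun φ =>
    continuous_sigma fun i => (continuous_const : Continuous fun _ : B i => φ i)
  -- Injectivity of the horizontal block bounds the base dimension, and injectivity of the full
  -- derivative bounds the dimension of the total space. Equality of base dimensions gives openness.
  have hdim : ∀ x : Σ i, B i, k x.1 ≤ k (f x).1 ∧ k x.1 + m x.1 ≤ k (f x).1 + m (f x).1 ∧
      (k (f x).1 = k x.1 → ∀ U ∈ 𝓝 x, f '' U ∈ 𝓝 (f x)) := by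
    intro x
    have hzN := hB (hzero_mem x)
    have hc := mem_chartDom_self (k := k) (zero x)
    have hc' := mem_chartDom_self (k := k) (ext h (zero x))
    have hd := h.1.contDiffAt_rep hzN hc hc'
    have hinj := h.fderiv_rep_injective hzN hc hc'
    have hcont := h.continuousAt_ext hzN
    refine ⟨?_, ?_, fun hk U hU => ?_⟩
    · have := LinearMap.finrank_le_finrank_of_injective (R := ℝ)
        (f := ((ContinuousLinearMap.fst ℝ _ _).comp ((fderiv ℝ (rep k (ext h) (zero x)
          (ext h (zero x))) (coord k (zero x) (zero x))).comp
          (ContinuousLinearMap.inl ℝ _ _)) : Euc (k x.1) →ₗ[ℝ] Euc (k (f x).1))) (by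
          intro v w hvw
          have h2 : fderiv ℝ (rep k (ext h) (zero x) (ext h (zero x)))
              (coord k (zero x) (zero x)) (v, 0) = fderiv ℝ (rep k (ext h) (zero x)
              (ext h (zero x))) (coord k (zero x) (zero x)) (w, 0) := by
            refine Prod.ext hvw ?_
            rw [fderiv_rep_inl_snd hZ (hzero_mem x) hc hcont hc' (hd.differentiableAt (by simp)),
              fderiv_rep_inl_snd hZ (hzero_mem x) hc hcont hc' (hd.differentiableAt (by simp))]
          exact congrArg Prod.fst (hinj h2))
      simpa using this
    · have := LinearMap.finrank_le_finrank_of_injective (R := ℝ)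
        (f := ((fderiv ℝ (rep k (ext h) (zero x) (ext h (zero x)))
          (coord k (zero x) (zero x)) :) : (Euc (k x.1) × Euc (m x.1)) →ₗ[ℝ]
            (Euc (k (f x).1) × Euc (m (f x).1)))) hinj
      simpa using this
    · have h3 := eventually_mem_image_zeroSec hZ (hzero_mem x) hc hc' hd hcont hinj hk.symm
        (hbase_cont.continuousAt (x := zero x) hU)
      rw [← hzf] at h3
      filter_upwards [hzero_cont.continuousAt.eventually h3] with y hy
      obtain ⟨z, ⟨hzU, hzZ⟩, hz2⟩ := hy (hzero_mem y)
      refine ⟨base z, hzU, ?_⟩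
      rw [hf]
      dsimp only
      rw [hzb z hzZ, hz2, hbz]
  have hk := eq_of_le_of_open hf_cont hf_inj (hloc k) (fun x => (hdim x).1)
    (fun x hx => (hdim x).2.2 hx)
  -- Once the base dimension is preserved, the inequality of total dimensions becomes one of ranks
  -- and openness holds everywhere, so the same principle applies to the rank.
  have hm := eq_of_le_of_open hf_cont hf_inj (hloc m)
    (fun x => by have := (hdim x).2.1; have := hk x; omega) (fun x _ => (hdim x).2.2 (hk x))
  have e := hzb z hz
  have h1 := hk (base z)
  have h2 := hm (base z)
  rw [hf] at h1 h2
  dsimp only at h1 h2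
  rw [e] at h1 h2
  exact ⟨h1, h2⟩

end Smooth

end Total

/-! ### The fibre derivative of an embedding is injective with injective derivative. -/

section Total

variable {ι : Type*} (k : ι → ℕ) {m : ι → ℕ} {B : ι → Type*}
  [∀ i, TopologicalSpace (B i)] [∀ i, ChartedSpace (Euc (k i)) (B i)]
  {V : ∀ i, B i → Type*}
  [∀ i b, AddCommGroup (V i b)] [∀ i b, Module ℝ (V i b)] [∀ i b, TopologicalSpace (V i b)]
  [∀ i, TopologicalSpace (TotalSpace (Euc (m i)) (V i))]
  [∀ i, FiberBundle (Euc (m i)) (V i)] [∀ i, VectorBundle ℝ (Euc (m i)) (V i)]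

variable {k}

variable [∀ i, IsManifold (𝓡 (k i)) ∞ (B i)]
  [∀ i, ContMDiffVectorBundle ∞ (Euc (m i)) (V i) (𝓡 (k i))] {N : Set (Tot m V)}

/-- Horizontal vectors have horizontal images along the zero section, so the base component of the
image determines the whole image. -/
theorem Emb.fderiv_rep_inl_fst_injective (h : Emb k N) (hB : zeroSec m V ⊆ interior N)
    {z c c' : Tot m V} (hz : z ∈ zeroSec m V) (hc : z ∈ chartDom k c)
    (hc' : ext h z ∈ chartDom k c') :
    Function.Injective fun w : Euc (k c.1) =>
      (fderiv ℝ (rep k (ext h) c c') (coord k c z) (w, 0)).1 := by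
  have hd := (h.1.contDiffAt_rep (hB hz) hc hc').differentiableAt (by simp)
  intro v w hvw
  refine congrArg Prod.fst (h.fderiv_rep_injective (hB hz) hc hc' (a₁ := (v, 0)) (a₂ := (w, 0))
    (Prod.ext hvw ?_))
  rw [fderiv_rep_inl_snd (h.zeroSec_mapsTo hB) hz hc (h.continuousAt_ext (hB hz)) hc' hd,
    fderiv_rep_inl_snd (h.zeroSec_mapsTo hB) hz hc (h.continuousAt_ext (hB hz)) hc' hd]

variable [Finite ι] [∀ i, CompactSpace (B i)] [∀ i, T2Space (B i)]

theorem Emb.dim_eq_of_mem_chartDom (h : Emb k N) (hB : zeroSec m V ⊆ interior N)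
    {z c c' : Tot m V} (hz : z ∈ zeroSec m V) (hc : z ∈ chartDom k c)
    (hc' : ext h z ∈ chartDom k c') : k c.1 = k c'.1 ∧ m c.1 = m c'.1 := by
  have h1 := h.dim_eq hB hz
  rw [fst_eq_of_mem_chartDom hc, fst_eq_of_mem_chartDom hc'] at h1
  exact ⟨h1.1.symm, h1.2.symm⟩

/-- The vertical derivative of an embedding along the zero section is injective. -/
theorem Emb.eq_zero_of_fderiv_rep_inr (h : Emb k N) (hB : zeroSec m V ⊆ interior N)
    {z c c' : Tot m V} (hz : z ∈ zeroSec m V) (hc : z ∈ chartDom k c)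
    (hc' : ext h z ∈ chartDom k c') {w : Euc (m c.1)}
    (hw : (fderiv ℝ (rep k (ext h) c c') (coord k c z) (0, w)).2 = 0) : w = 0 := by
  have hd := (h.1.contDiffAt_rep (hB hz) hc hc').differentiableAt (by simp)
  -- The horizontal block is surjective by equality of dimensions, so the image of `(0, w)`, being
  -- horizontal, is also the image of some `(v, 0)`; injectivity of the full derivative then forces
  -- `w = 0`.
  obtain ⟨v, hv⟩ := (LinearMap.injective_iff_surjective_of_finrank_eq_finrank
    (f := ((ContinuousLinearMap.fst ℝ _ _).comp ((fderiv ℝ (rep k (ext h) c c')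
      (coord k c z)).comp (ContinuousLinearMap.inl ℝ _ _)) : Euc (k c.1) →ₗ[ℝ] Euc (k c'.1)))
    (by simp [(h.dim_eq_of_mem_chartDom hB hz hc hc').1])).1
    (h.fderiv_rep_inl_fst_injective hB hz hc hc')
    (fderiv ℝ (rep k (ext h) c c') (coord k c z) (0, w)).1
  have h1 := h.fderiv_rep_injective (hB hz) hc hc' (a₁ := (v, 0)) (a₂ := (0, w)) (Prod.ext hv ?_)
  · exact (congrArg Prod.snd h1).symm
  · rw [hw, fderiv_rep_inl_snd (h.zeroSec_mapsTo hB) hz hc (h.continuousAt_ext (hB hz)) hc' hd]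

theorem Emb.coord_tfib (h : Emb k N) (hB : zeroSec m V ⊆ interior N) {c c' z : Tot m V}
    (hc : z ∈ chartDom k c) (hc' : ext h (scale 0 z) ∈ chartDom k c') :
    coord k c' (tfib (ext h) z) = ((rep k (ext h) c c' (coord k c (scale 0 z))).1,
      (fderiv ℝ (rep k (ext h) c c') (coord k c (scale 0 z)) (0, (coord k c z).2)).2) :=
  have h0 := hB (scale_zero_mem z)
  LinEmb.coord_tfib (h.zeroSec_mapsTo hB) hc (h.continuousAt_ext h0) hc'
    ((h.1.contDiffAt_rep h0 (scale_mem_chartDom.2 hc) hc').differentiableAt (by simp))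

theorem Emb.scale_zero_tfib (h : Emb k N) (hB : zeroSec m V ⊆ interior N) (z : Tot m V) :
    scale 0 (tfib (ext h) z) = ext h (scale 0 z) := by
  rw [← scale_of_mem_zeroSec (h.zeroSec_mapsTo hB _ (scale_zero_mem z)) 0, scale_zero z, scale_zero,
    scale_zero]
  rfl

/-- Equal values lie over the same point, which determines the base point since `h` is injective on
the zero section. Within a fibre the map is linear with trivial kernel. -/
theorem Emb.tfib_injective (h : Emb k N) (hB : zeroSec m V ⊆ interior N) :
    Function.Injective (tfib (ext h)) := by
  intro z w hzw
  have h0 : scale 0 z = scale 0 w := by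
    refine h.injOn_ext (interior_subset (hB (scale_zero_mem z)))
      (interior_subset (hB (scale_zero_mem w))) ?_
    rw [← h.scale_zero_tfib hB, ← h.scale_zero_tfib hB, hzw]
  have hc := mem_chartDom_self (k := k) z
  have hcw : w ∈ chartDom k z := by
    rw [← scale_mem_chartDom (s := 0), ← h0, scale_mem_chartDom]
    exact hc
  have hc' := mem_chartDom_self (k := k) (ext h (scale 0 z))
  have h1 := h.coord_tfib hB hc hc'
  have h2 := h.coord_tfib hB hcw (c' := ext h (scale 0 z)) (by rw [← h0]; exact hc')
  rw [hzw, h2, ← h0] at h1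
  have h3 : (coord k z w).2 - (coord k z z).2 = 0 := by
    refine h.eq_zero_of_fderiv_rep_inr hB (scale_zero_mem z) (scale_mem_chartDom.2 hc) hc' ?_
    have e : ((0, (coord k z w).2 - (coord k z z).2) : Euc (k z.1) × Euc (m z.1)) =
      (0, (coord k z w).2) - (0, (coord k z z).2) := by simp
    rw [e, map_sub, Prod.snd_sub, congrArg Prod.snd h1, sub_self]
  refine injOn_coord z hc hcw (Prod.ext ?_ (sub_eq_zero.1 h3).symm)
  have h4 := coord_scale hc 0
  have h5 := coord_scale hcw 0
  rw [← h0, h4] at h5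
  exact (Prod.ext_iff.1 h5).1

/-- The base coordinate of the fibre derivative depends only on the base point, and its fibre
coordinate is linear in the fibre. So its derivative is block triangular with the diagonal blocks of
the derivative of `h` at `scale 0 z`, both injective; the remaining block is never computed. -/
theorem Emb.fderiv_rep_tfib_injective (h : Emb k N) (hB : zeroSec m V ⊆ interior N)
    {c c' z : Tot m V} (hc : z ∈ chartDom k c) (hc' : ext h (scale 0 z) ∈ chartDom k c')
    (hd : DifferentiableAt ℝ (rep k (tfib (ext h)) c c') (coord k c z)) :
    Function.Injective (fderiv ℝ (rep k (tfib (ext h)) c c') (coord k c z)) := by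
  have h0 := hB (scale_zero_mem z)
  have hc0 : scale 0 z ∈ chartDom k c := scale_mem_chartDom.2 hc
  have hd0 := (h.1.contDiffAt_rep h0 hc0 hc').differentiableAt (by simp)
  obtain ⟨x, hx⟩ : ∃ x, x = coord k c z := ⟨_, rfl⟩
  have hx0 : coord k c (scale 0 z) = (x.1, 0) := hx ▸ coord_scale_zero hc
  rw [← hx] at hd ⊢
  have hfst : (fun u => (rep k (tfib (ext h)) c c' u).1) =ᶠ[𝓝 x]
      fun u => (rep k (ext h) c c' (u.1, 0)).1 := by
    have h1 : ∀ᶠ w in 𝓝 z, ext h (scale 0 w) ∈ chartDom k c' := by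
      have h2 : ContinuousAt (fun w : Tot m V => scale 0 w) z :=
        ((continuous_scale k).comp (Continuous.prodMk_right (0 : ℝ))).continuousAt
      exact (ContinuousAt.comp (g := ext h) (f := fun w : Tot m V => scale 0 w)
        (h.continuousAt_ext h0) h2).eventually ((isOpen_chartDom c').mem_nhds hc')
    have h3 := continuousAt_coordSymm (coord_mem hc)
    rw [ContinuousAt, coordSymm_coord hc, ← hx] at h3
    filter_upwards [h3.eventually h1, (isOpen_chartImg c).mem_nhds (hx ▸ coord_mem hc)] with u hu hui
    have h4 := h.coord_tfib hB (coordSymm_mem hui) hu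
    rw [coord_scale_zero (coordSymm_mem hui), coord_coordSymm hui] at h4
    exact (Prod.ext_iff.1 h4).1
  have hsnd : (fun v => (rep k (tfib (ext h)) c c' (x.1, v)).2) =ᶠ[𝓝 x.2]
      fun v => (fderiv ℝ (rep k (ext h) c c') (x.1, 0) (0, v)).2 := by
    refine Eventually.of_forall fun v => ?_
    have hvi : (x.1, v) ∈ chartImg k c := mem_chartImg_of_fst (u := coord k c z) (by rw [← hx]) (coord_mem hc)
    have h1 : scale 0 (coordSymm k c (x.1, v)) = scale 0 z := by
      refine injOn_coord c (scale_mem_chartDom.2 (coordSymm_mem hvi)) hc0 ?_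
      rw [coord_scale_zero (coordSymm_mem hvi), coord_coordSymm hvi, hx0]
    have h4 := h.coord_tfib hB (coordSymm_mem hvi) (by rw [h1]; exact hc')
    rw [h1, hx0, coord_coordSymm hvi] at h4
    exact (Prod.ext_iff.1 h4).2
  set D := fderiv ℝ (rep k (tfib (ext h)) c c') x with hD
  set A := fderiv ℝ (rep k (ext h) c c') (x.1, 0) with hA
  rw [hx0] at hd0
  have hD1 : ∀ w, (D w).1 = (A (w.1, 0)).1 := by
    have h1 : HasFDerivAt (fun u => (rep k (tfib (ext h)) c c' u).1)
        ((ContinuousLinearMap.fst ℝ _ _).comp D) x :=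
      hd.hasFDerivAt.fst
    have h2 : HasFDerivAt (fun u : Euc (k c.1) × Euc (m c.1) => (u.1, (0 : Euc (m c.1))))
        ((ContinuousLinearMap.inl ℝ _ _).comp (ContinuousLinearMap.fst ℝ _ _)) x :=
      ((ContinuousLinearMap.inl ℝ (Euc (k c.1)) (Euc (m c.1))).comp
        (ContinuousLinearMap.fst ℝ (Euc (k c.1)) (Euc (m c.1)))).hasFDerivAt
    have h3 : HasFDerivAt (fun u => (rep k (ext h) c c' (u.1, 0)).1)
        ((ContinuousLinearMap.fst ℝ _ _).comp (A.comp
          ((ContinuousLinearMap.inl ℝ _ _).comp (ContinuousLinearMap.fst ℝ _ _)))) x :=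
      (HasFDerivAt.comp (g := rep k (ext h) c c') x hd0.hasFDerivAt h2).fst
    intro w
    exact DFunLike.congr_fun (h1.unique (h3.congr_of_eventuallyEq hfst)) w
  have hD2 : ∀ w, (D (0, w)).2 = (A (0, w)).2 := by
    have h2 : HasFDerivAt (fun v : Euc (m c.1) => (x.1, v)) (ContinuousLinearMap.inr ℝ _ _) x.2 :=
      hasFDerivAt_prodMk_right _ _
    have h1 : HasFDerivAt (fun v => (rep k (tfib (ext h)) c c' (x.1, v)).2)
        ((ContinuousLinearMap.snd ℝ _ _).comp (D.comp (ContinuousLinearMap.inr ℝ _ _))) x.2 :=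
      (HasFDerivAt.comp (g := rep k (tfib (ext h)) c c') x.2 hd.hasFDerivAt h2).snd
    have h3 : HasFDerivAt (fun v => (A (0, v)).2)
        ((ContinuousLinearMap.snd ℝ _ _).comp (A.comp (ContinuousLinearMap.inr ℝ _ _))) x.2 :=
      ((ContinuousLinearMap.snd ℝ _ _).comp (A.comp (ContinuousLinearMap.inr ℝ _ _))).hasFDerivAt
    intro w
    exact DFunLike.congr_fun (h1.unique (h3.congr_of_eventuallyEq hsnd)) w
  refine (injective_iff_map_eq_zero D).2 fun w hw => ?_
  have hz := scale_zero_mem z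
  have hw1 : w.1 = 0 := by
    refine h.fderiv_rep_inl_fst_injective hB hz hc0 hc' ?_
    rw [hx0]
    change (A (w.1, 0)).1 = (A (0, 0)).1
    rw [← hD1, hw, Prod.mk_zero_zero, map_zero]
  have hw0 : w = (0, w.2) := Prod.ext hw1 rfl
  refine Prod.ext hw1 (h.eq_zero_of_fderiv_rep_inr hB hz hc0 hc' ?_)
  rw [hx0]
  change (A (0, w.2)).2 = 0
  rw [← hD2, ← hw0, hw]
  rfl

end Total

/-! ### The deformation, its conjugation by the radius, and local inversion of families. -/

section Total

variable {ι : Type*} (k : ι → ℕ) {m : ι → ℕ} {B : ι → Type*}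
  [∀ i, TopologicalSpace (B i)] [∀ i, ChartedSpace (Euc (k i)) (B i)]
  {V : ∀ i, B i → Type*}
  [∀ i b, AddCommGroup (V i b)] [∀ i b, Module ℝ (V i b)] [∀ i b, TopologicalSpace (V i b)]
  [∀ i, TopologicalSpace (TotalSpace (Euc (m i)) (V i))]
  [∀ i, FiberBundle (Euc (m i)) (V i)] [∀ i, VectorBundle ℝ (Euc (m i)) (V i)]

variable {k}

variable [∀ i, IsManifold (𝓡 (k i)) ∞ (B i)]
  [∀ i, ContMDiffVectorBundle ∞ (Euc (m i)) (V i) (𝓡 (k i))] {N : Set (Tot m V)}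

/-- The deformation `H(h, t)` for a map of the total space, with the radius `d` as a parameter. -/
def deform (ξ : ∀ i, OrthogonalStructure (k i) (m i) (V i)) (μ : ℝ → ℝ)
    (g : Tot m V → Tot m V) (d t : ℝ) (z : Tot m V) : Tot m V :=
  blowup g (phi ξ μ d t z) z

variable {P : Type*} [TopologicalSpace P]

theorem FamAt.eventually_near {F : P → Tot m V → Tot m V} {q : P} {z c c' : Tot m V}
    (hF : FamAt k F q z) (hc : z ∈ chartDom k c) (hc' : F q z ∈ chartDom k c') :
    ∀ᶠ w in 𝓝 (q, z), w.2 ∈ chartDom k c ∧ F w.1 w.2 ∈ chartDom k c' :=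
  Filter.Eventually.and (continuousAt_snd.eventually ((isOpen_chartDom c).mem_nhds hc))
    (hF.1.eventually ((isOpen_chartDom c').mem_nhds hc'))

theorem continuousAt_prod_coord {X : Type*} [TopologicalSpace X] {f : X → Tot m V} {g : X → P}
    {x : X} {c : Tot m V} (hg : ContinuousAt g x) (hf : ContinuousAt f x)
    (hc : f x ∈ chartDom k c) : ContinuousAt (fun y => (g y, coord k c (f y))) x :=
  hg.prodMk (ContinuousAt.comp (g := coord k c) (f := f) (continuousAt_coord hc) hf)

section LocalInverse

variable {F : P → Tot m V → Tot m V} {q : P} {z c c' : Tot m V}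
  {A : (Euc (k c.1) × Euc (m c.1)) ≃L[ℝ] (Euc (k c'.1) × Euc (m c'.1))}

/-- A family with bijective derivative at a point is locally injective, uniformly in the
parameter. -/
theorem FamAt.eventually_injective (hF : FamAt k F q z) (hc : z ∈ chartDom k c)
    (hc' : F q z ∈ chartDom k c') (hA : fderiv ℝ (rep k (F q) c c') (coord k c z) = A) :
    ∀ᶠ w in 𝓝 (q, (z, z)), F w.1 w.2.1 = F w.1 w.2.2 → w.2.1 = w.2.2 := by
  have h1 := (hF.2 c c' hc hc' 1).eventually_injective A hA
  have h5 : ContinuousAt (fun w : P × (Tot m V × Tot m V) => (w.1, coord k c w.2.1)) (q, (z, z)) :=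
    continuousAt_prod_coord continuousAt_fst (continuousAt_fst.comp continuousAt_snd) hc
  have h6 : ContinuousAt (fun w : P × (Tot m V × Tot m V) => (w.1, coord k c w.2.2)) (q, (z, z)) :=
    continuousAt_prod_coord continuousAt_fst (continuousAt_snd.comp continuousAt_snd) hc
  have h2 := h5.fst.prodMk (h5.snd.prodMk h6.snd)
  have h3 : ContinuousAt (fun w : P × (Tot m V × Tot m V) => (w.1, w.2.1)) (q, (z, z)) := by
    fun_prop
  have h4 : ContinuousAt (fun w : P × (Tot m V × Tot m V) => (w.1, w.2.2)) (q, (z, z)) := by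
    fun_prop
  filter_upwards [h2.eventually h1, h3.eventually (hF.eventually_near hc hc'),
    h4.eventually (hF.eventually_near hc hc')] with w hw hw1 hw2 he
  refine injOn_coord c hw1.1 hw2.1 (hw ?_)
  change rep k (F w.1) c c' _ = rep k (F w.1) c c' _
  rw [rep_coord hw1.1, rep_coord hw2.1, he]

theorem FamAt.eventually_fderiv_injective (hF : FamAt k F q z) (hc : z ∈ chartDom k c)
    (hc' : F q z ∈ chartDom k c') (hA : fderiv ℝ (rep k (F q) c c') (coord k c z) = A) :
    ∀ᶠ w in 𝓝 (q, z), ∀ c₂ c₂' : Tot m V, w.2 ∈ chartDom k c₂ → F w.1 w.2 ∈ chartDom k c₂' →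
      DifferentiableAt ℝ (rep k (F w.1) c₂ c₂') (coord k c₂ w.2) ∧
      Function.Injective (fderiv ℝ (rep k (F w.1) c₂ c₂') (coord k c₂ w.2)) := by
  have hP := hF.2 c c' hc hc' 1
  have hco : ContinuousAt (fun w : P × Tot m V => (w.1, coord k c w.2)) (q, z) :=
    continuousAt_prod_coord continuousAt_fst continuousAt_snd hc
  filter_upwards [hco.eventually (hP.eventually_fderiv_injective A hA),
    hF.eventually_near hc hc', hF.eventually_continuousAt,
    hco.eventually hP.eventually_contDiffAt] with w hw hw1 hw2 hw3 c₂ c₂' hc₂ hc₂'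
  have h1 : ContinuousAt (F w.1) w.2 :=
    ContinuousAt.comp (g := Function.uncurry F) (f := fun x => (w.1, x)) hw2 (by fun_prop)
  have h2 := differentiableAt_rep h1 hc₂ hc₂' hw1.1 hw1.2 (hw3.differentiableAt (by simp))
  exact ⟨h2, injective_fderiv_rep h1 hw1.1 hw1.2 hc₂ hc₂' h2 hw⟩

/-- A family with bijective derivative at a point is locally open, uniformly in the parameter. -/
theorem FamAt.eventually_mem_image (hF : FamAt k F q z) (hc : z ∈ chartDom k c)
    (hc' : F q z ∈ chartDom k c') (hA : fderiv ℝ (rep k (F q) c c') (coord k c z) = A)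
    {U : Set (Tot m V)} (hU : U ∈ 𝓝 z) :
    ∀ᶠ w in 𝓝 (q, F q z), w.2 ∈ F w.1 '' U := by
  have hnear := hF.eventually_near hc hc'
  -- The neighbourhood is split into a product so that the set of points to which the charts apply
  -- does not depend on the parameter.
  rw [nhds_prod_eq, eventually_prod_iff] at hnear
  obtain ⟨p₁, hp₁, p₂, hp₂, hp⟩ := hnear
  have h3 := continuousAt_coordSymm (coord_mem hc)
  rw [ContinuousAt, coordSymm_coord hc] at h3
  have h1 := (hF.2 c c' hc hc' 1).eventually_mem_image A hA
    (U := {u | u ∈ chartImg k c ∧ coordSymm k c u ∈ U ∧ p₂ (coordSymm k c u)})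
    (Filter.Eventually.and ((isOpen_chartImg c).mem_nhds (coord_mem hc))
      ((h3.eventually hU).and (h3.eventually hp₂)))
  have hco : ContinuousAt (fun w : P × Tot m V => (w.1, coord k c' w.2)) (q, F q z) :=
    continuousAt_prod_coord continuousAt_fst continuousAt_snd hc'
  rw [rep_coord hc] at h1
  have hfst : ContinuousAt (fun w : P × Tot m V => w.1) (q, F q z) := continuousAt_fst
  have hsnd : ContinuousAt (fun w : P × Tot m V => w.2) (q, F q z) := continuousAt_snd
  filter_upwards [hco.eventually h1, hfst.eventually hp₁,
    hsnd.eventually ((isOpen_chartDom c').mem_nhds hc')] with w hw hw1 hw2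
  obtain ⟨u, ⟨hu1, hu2, hu3⟩, hu4⟩ := hw
  exact ⟨coordSymm k c u, hu2, injOn_coord c' (hp hw1 hu3).2 hw2 hu4⟩

end LocalInverse

section Rescaled

variable {ξ : ∀ i, OrthogonalStructure (k i) (m i) (V i)} {a : ℝ} {μ : ℝ → ℝ}

/-- The deformation conjugated by the multiplication by `d`. It makes sense for `d = 0`. -/
def rescaled (ξ : ∀ i, OrthogonalStructure (k i) (m i) (V i)) (μ : ℝ → ℝ)
    (g : Tot m V → Tot m V) (d t : ℝ) (z : Tot m V) : Tot m V :=
  blowup g (d * phi ξ μ 1 t z) z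

theorem phi_scale (ξ : ∀ i, OrthogonalStructure (k i) (m i) (V i)) (μ : ℝ → ℝ) {d : ℝ}
    (hd : 0 < d) (t : ℝ) (z : Tot m V) : phi ξ μ d t (scale d z) = phi ξ μ 1 t z := by
  rw [phi, phi, nrm_scale, abs_of_pos hd, div_one, mul_div_cancel_left₀ _ hd.ne']

theorem deform_scale (ξ : ∀ i, OrthogonalStructure (k i) (m i) (V i)) (μ : ℝ → ℝ)
    (g : Tot m V → Tot m V) {d : ℝ} (hd : 0 < d) (t : ℝ) (z : Tot m V) :
    deform ξ μ g d t (scale d z) = scale d (rescaled ξ μ g d t z) := by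
  rw [deform, phi_scale ξ μ hd, blowup_scale _ _ hd.ne', rescaled, mul_comm]

theorem deform_eq_scale (ξ : ∀ i, OrthogonalStructure (k i) (m i) (V i)) (μ : ℝ → ℝ)
    (g : Tot m V → Tot m V) {d : ℝ} (hd : 0 < d) (t : ℝ) (z : Tot m V) :
    deform ξ μ g d t z = scale d (rescaled ξ μ g d t (scale d⁻¹ z)) := by
  rw [← deform_scale ξ μ g hd, scale_scale, mul_inv_cancel₀ hd.ne', scale_one]

theorem rescaled_zero (ξ : ∀ i, OrthogonalStructure (k i) (m i) (V i)) (μ : ℝ → ℝ)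
    (g : Tot m V → Tot m V) (t : ℝ) : rescaled ξ μ g 0 t = tfib g := by
  funext z
  rw [rescaled, zero_mul, blowup_zero]

theorem famAt_rescaled (ha : 0 < a) (hμ : ContDiff ℝ ∞ μ) (hμ0 : ∀ s ∈ Icc 0 a, μ s = 0)
    {Φ : P → Tot m V → Tot m V} {p : P} {z : Tot m V} {d t : ℝ}
    (h : FamAt k Φ p (scale (d * phi ξ μ 1 t z) z))
    (hZ : ∀ p, ∀ w ∈ zeroSec m V, Φ p w ∈ zeroSec m V) :
    FamAt k (fun (q : (P × ℝ) × ℝ) => rescaled ξ μ (Φ q.1.1) q.1.2 q.2) ((p, d), t) z := by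
  have hT : Continuous fun q : (P × ℝ) × ℝ => q.2 := continuous_snd
  have hD : Continuous fun q : (P × ℝ) × ℝ => q.1.2 := continuous_snd.comp continuous_fst
  refine FamAt.blowup (Φ := fun q : (P × ℝ) × ℝ => Φ q.1.1)
    (σ := fun q z => q.1.2 * phi ξ μ 1 q.2 z) (h.reparam (θ := fun q : (P × ℝ) × ℝ => q.1.1)
      (q := ((p, d), t)) (continuous_fst.comp continuous_fst)) (fun q => hZ q.1.1) ?_ ?_
  · exact (hD.comp continuous_fst).continuousAt.mul
      (continuousAt_phi (D := fun _ => 1) hμ.continuous continuous_const hT one_pos z)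
  · intro c hc n
    exact (PSAt.of_continuousAt (Eventually.of_forall fun q => hD.continuousAt)).smul
      (psAt_phi (D := fun _ => 1) ha hμ hμ0 continuous_const hT one_pos hc n)

end Rescaled

/-- The properties of the deformation at radius `d` that make it an embedding: conditions on the
compact set of vectors of norm at most `(b + 1) d`. -/
structure IsGoodRadius (ξ : ∀ i, OrthogonalStructure (k i) (m i) (V i)) (b : ℝ) (μ : ℝ → ℝ)
    (O N : Set (Tot m V)) (g : Tot m V → Tot m V) (d : ℝ) : Prop where
  subset : {z | nrm ξ z ≤ (b + 1) * d} ⊆ O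
  injOn : ∀ t ∈ Icc (0 : ℝ) 1, InjOn (deform ξ μ g d t) {z | nrm ξ z ≤ (b + 1) * d}
  fderiv_injective : ∀ t ∈ Icc (0 : ℝ) 1, ∀ z, nrm ξ z ≤ (b + 1) * d → ∀ c c' : Tot m V,
    z ∈ chartDom k c → deform ξ μ g d t z ∈ chartDom k c' →
      Function.Injective (fderiv ℝ (rep k (deform ξ μ g d t) c c') (coord k c z))
  mem_image : ∀ t ∈ Icc (0 : ℝ) 1, ∀ z, nrm ξ z ≤ b * d →
    ∃ w, nrm ξ w ≤ (b + 1) * d ∧ deform ξ μ g d t z = g w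
  mem : ∀ t ∈ Icc (0 : ℝ) 1, ∀ z, nrm ξ z ≤ d → deform ξ μ g d t z ∈ N

/-- The derivative of the fibre derivative of an embedding is bijective. -/
theorem exists_equiv_fderiv_tfib [Finite ι] [∀ i, CompactSpace (B i)] [∀ i, T2Space (B i)]
    (h : Emb k N) (hB : zeroSec m V ⊆ interior N)
    {c c' z : Tot m V} (hc : z ∈ chartDom k c) (hc' : ext h (scale 0 z) ∈ chartDom k c')
    (hd : DifferentiableAt ℝ (rep k (tfib (ext h)) c c') (coord k c z)) :
    ∃ A : (Euc (k c.1) × Euc (m c.1)) ≃L[ℝ] (Euc (k c'.1) × Euc (m c'.1)),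
      fderiv ℝ (rep k (tfib (ext h)) c c') (coord k c z) = A := by
  have h1 := h.dim_eq_of_mem_chartDom hB (scale_zero_mem z) (scale_mem_chartDom.2 hc) hc'
  refine ⟨(LinearMap.linearEquivOfInjective (fderiv ℝ (rep k (tfib (ext h)) c c')
    (coord k c z) : (Euc (k c.1) × Euc (m c.1)) →ₗ[ℝ] (Euc (k c'.1) × Euc (m c'.1)))
    (h.fderiv_rep_tfib_injective hB hc hc' hd) (by simp [h1.1, h1.2])).toContinuousLinearEquiv, ?_⟩
  exact ContinuousLinearMap.ext fun w => rfl

section Local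

variable [Finite ι] [∀ i, CompactSpace (B i)] [∀ i, T2Space (B i)]
  {Φ : P → Emb k N} {ξ : ∀ i, OrthogonalStructure (k i) (m i) (V i)} {a b : ℝ} {μ : ℝ → ℝ}
  {O : Set (Tot m V)}

/-- At `d = 0` the map is evaluated only on the zero section, so smoothness of the family there
suffices for every `z`, however large. This is what allows the passage to a coarser topology on the
embeddings. -/
theorem famAt_rescaled_zero (hB : zeroSec m V ⊆ interior N)
    (hΦ : ∀ p, ∀ z ∈ zeroSec m V, FamAt k (fun p => ext (Φ p)) p z)
    (ha : 0 < a) (hμ : ContDiff ℝ ∞ μ) (hμ0 : ∀ s ∈ Icc 0 a, μ s = 0) (p : P) (t : ℝ)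
    (z : Tot m V) :
    FamAt k (fun (q : (P × ℝ) × ℝ) => rescaled ξ μ (ext (Φ q.1.1)) q.1.2 q.2) ((p, 0), t) z :=
  famAt_rescaled (Φ := fun p => ext (Φ p)) ha hμ hμ0
    (hΦ p _ (by rw [zero_mul]; exact scale_zero_mem z)) fun p => (Φ p).zeroSec_mapsTo hB

theorem exists_equiv_fderiv_rescaled (hB : zeroSec m V ⊆ interior N)
    (hΦ : ∀ p, ∀ z ∈ zeroSec m V, FamAt k (fun p => ext (Φ p)) p z)
    (ha : 0 < a) (hμ : ContDiff ℝ ∞ μ) (hμ0 : ∀ s ∈ Icc 0 a, μ s = 0) (p : P) (t : ℝ)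
    (z : Tot m V) :
    ∃ c', rescaled ξ μ (ext (Φ p)) 0 t z ∈ chartDom k c' ∧
      ∃ A : (Euc (k z.1) × Euc (m z.1)) ≃L[ℝ] (Euc (k c'.1) × Euc (m c'.1)),
        fderiv ℝ (rep k (rescaled ξ μ (ext (Φ p)) 0 t) z c') (coord k z z) = A := by
  have hF := famAt_rescaled_zero (ξ := ξ) hB hΦ ha hμ hμ0 p t z
  have hc := mem_chartDom_self (k := k) z
  -- Only the fact that this chart contains the image is kept: its index enters the types below,
  -- where the map is rewritten.
  obtain ⟨c', hc'⟩ : ∃ c', rescaled ξ μ (ext (Φ p)) 0 t z ∈ chartDom k c' :=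
    ⟨_, mem_chartDom_self _⟩
  refine ⟨c', hc', ?_⟩
  have hd : DifferentiableAt ℝ (rep k (rescaled ξ μ (ext (Φ p)) 0 t) z c') (coord k z z) :=
    (hF.2 z c' hc hc' 1).contDiffAt.differentiableAt (by simp)
  rw [rescaled_zero] at hd hc' ⊢
  rw [← blowup_zero] at hc'
  exact exists_equiv_fderiv_tfib (Φ p) hB hc (blowup_mem_chartDom.1 hc') hd

end Local

end Total

/-! ### All sufficiently small radii are good, locally uniformly in the embedding. -/

section Total

variable {ι : Type*} (k : ι → ℕ) {m : ι → ℕ} {B : ι → Type*}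
  [∀ i, TopologicalSpace (B i)] [∀ i, ChartedSpace (Euc (k i)) (B i)]
  {V : ∀ i, B i → Type*}
  [∀ i b, AddCommGroup (V i b)] [∀ i b, Module ℝ (V i b)] [∀ i b, TopologicalSpace (V i b)]
  [∀ i, TopologicalSpace (TotalSpace (Euc (m i)) (V i))]
  [∀ i, FiberBundle (Euc (m i)) (V i)] [∀ i, VectorBundle ℝ (Euc (m i)) (V i)]

variable {k}

variable [∀ i, IsManifold (𝓡 (k i)) ∞ (B i)]
  [∀ i, ContMDiffVectorBundle ∞ (Euc (m i)) (V i) (𝓡 (k i))] {N : Set (Tot m V)}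

/-- Conjugation by a multiplication in the fibres preserves injectivity of the derivative. -/
theorem fderiv_rep_conj_scale_injective {g : Tot m V → Tot m V} {d : ℝ} (hd : d ≠ 0)
    {z c c' : Tot m V} (hg : ContinuousAt g (scale d⁻¹ z)) (hc : z ∈ chartDom k c)
    (hc' : g (scale d⁻¹ z) ∈ chartDom k c')
    (hD : DifferentiableAt ℝ (rep k g c c') (coord k c (scale d⁻¹ z)))
    (hinj : Function.Injective (fderiv ℝ (rep k g c c') (coord k c (scale d⁻¹ z)))) :
    Function.Injective
      (fderiv ℝ (rep k (fun z => scale d (g (scale d⁻¹ z))) c c') (coord k c z)) := by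
  let S : ∀ (i : ι) (_ : ℝ), (Euc (k i) × Euc (m i)) →L[ℝ] (Euc (k i) × Euc (m i)) :=
    fun i s => (ContinuousLinearMap.fst ℝ _ _).prod (s • ContinuousLinearMap.snd ℝ _ _)
  have hS : ∀ i s, s ≠ 0 → Function.Injective (S i s) := by
    intro i s hs v w hvw
    exact Prod.ext (Prod.ext_iff.1 hvw).1 (smul_right_injective _ hs (Prod.ext_iff.1 hvw).2)
  have hsz : S c.1 d⁻¹ (coord k c z) = coord k c (scale d⁻¹ z) := (coord_scale hc _).symm
  have h1 : HasFDerivAt (fun u => S c'.1 d (rep k g c c' (S c.1 d⁻¹ u)))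
      ((S c'.1 d).comp ((fderiv ℝ (rep k g c c') (coord k c (scale d⁻¹ z))).comp (S c.1 d⁻¹)))
      (coord k c z) := by
    refine (S c'.1 d).hasFDerivAt.comp _ (HasFDerivAt.comp (g := rep k g c c') _ ?_
      (S c.1 d⁻¹).hasFDerivAt)
    rw [hsz]
    exact hD.hasFDerivAt
  have h2 : rep k (fun z => scale d (g (scale d⁻¹ z))) c c' =ᶠ[𝓝 (coord k c z)]
      fun u => S c'.1 d (rep k g c c' (S c.1 d⁻¹ u)) := by
    have h3 : ContinuousAt (fun w : Tot m V => scale d⁻¹ w) z :=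
      ((continuous_scale k).comp (Continuous.prodMk_right d⁻¹)).continuousAt
    have h4 := continuousAt_coordSymm (coord_mem hc)
    rw [ContinuousAt, coordSymm_coord hc] at h4
    have h5 : ∀ᶠ w in 𝓝 z, g (scale d⁻¹ w) ∈ chartDom k c' :=
      (ContinuousAt.comp (g := g) (f := fun w : Tot m V => scale d⁻¹ w) hg h3).eventually
        ((isOpen_chartDom c').mem_nhds hc')
    filter_upwards [h4.eventually h5, (isOpen_chartImg c).mem_nhds (coord_mem hc)] with u hu hui
    have h6 : coordSymm k c (S c.1 d⁻¹ u) = scale d⁻¹ (coordSymm k c u) := coordSymm_smul hui _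
    change coord k c' (scale d (g (scale d⁻¹ (coordSymm k c u)))) =
      S c'.1 d (coord k c' (g (coordSymm k c (S c.1 d⁻¹ u))))
    rw [coord_scale hu, h6]
    rfl
  rw [(h1.congr_of_eventuallyEq h2).fderiv]
  exact (hS _ _ hd).comp (hinj.comp (hS _ _ (inv_ne_zero hd)))

variable {P : Type*} [TopologicalSpace P]
  [Finite ι] [∀ i, CompactSpace (B i)] [∀ i, T2Space (B i)]
  {Φ : P → Emb k N} {ξ : ∀ i, OrthogonalStructure (k i) (m i) (V i)} {a b : ℝ} {μ : ℝ → ℝ}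
  {O : Set (Tot m V)}

/-- Compactness of the set of triples `(t, x, y)`. On the diagonal the inverse function theorem
gives local injectivity; off the diagonal the values of the limit `T^fib h` are distinct and remain
so nearby, since the total space is Hausdorff. -/
theorem eventually_injOn_rescaled (hB : zeroSec m V ⊆ interior N)
    (hΦ : ∀ p, ∀ z ∈ zeroSec m V, FamAt k (fun p => ext (Φ p)) p z)
    (ha : 0 < a) (hμ : ContDiff ℝ ∞ μ) (hμ0 : ∀ s ∈ Icc 0 a, μ s = 0) (r : ℝ) (p : P) :
    ∀ᶠ q in 𝓝 (p, (0 : ℝ)), ∀ t ∈ Icc (0 : ℝ) 1,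
      InjOn (rescaled ξ μ (ext (Φ q.1)) q.2 t) {z | nrm ξ z ≤ r} := by
  have := t2Space_tot (m := m) (V := V) (B := B)
  have hK := isCompact_nrm_le ξ r
  have h := (isCompact_Icc (a := (0 : ℝ)) (b := 1)).prod (hK.prod hK)
  have key := h.eventually_forall_of_forall_eventually (x₀ := (p, (0 : ℝ)))
    (P := fun (q : P × ℝ) (w : ℝ × (Tot m V × Tot m V)) =>
      rescaled ξ μ (ext (Φ q.1)) q.2 w.1 w.2.1 = rescaled ξ μ (ext (Φ q.1)) q.2 w.1 w.2.2 →
        w.2.1 = w.2.2) ?_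
  · filter_upwards [key] with q hq t ht x hx y hy hxy
    exact hq (t, (x, y)) ⟨ht, hx, hy⟩ hxy
  rintro ⟨t, x, y⟩ -
  have hF := fun z => famAt_rescaled_zero (ξ := ξ) hB hΦ ha hμ hμ0 p t z
  rcases eq_or_ne x y with rfl | hxy
  · obtain ⟨c', hc', A, hA⟩ := exists_equiv_fderiv_rescaled (ξ := ξ) hB hΦ ha hμ hμ0 p t x
    have h1 := (hF x).eventually_injective (mem_chartDom_self x) hc' hA
    have h2 : ContinuousAt (fun w : (P × ℝ) × (ℝ × (Tot m V × Tot m V)) => ((w.1, w.2.1), w.2.2))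
      ((p, 0), (t, (x, x))) := by fun_prop
    exact h2.eventually h1
  · have hne : rescaled ξ μ (ext (Φ p)) 0 t x ≠ rescaled ξ μ (ext (Φ p)) 0 t y := by
      rw [rescaled_zero]
      exact fun he => hxy ((Φ p).tfib_injective hB he)
    have hx : ContinuousAt (fun w : (P × ℝ) × (ℝ × (Tot m V × Tot m V)) => ((w.1, w.2.1), w.2.2.1))
      ((p, 0), (t, (x, y))) := by fun_prop
    have hy : ContinuousAt (fun w : (P × ℝ) × (ℝ × (Tot m V × Tot m V)) => ((w.1, w.2.1), w.2.2.2))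
      ((p, 0), (t, (x, y))) := by fun_prop
    have h1 := (Tendsto.prodMk_nhds (Tendsto.comp (hF x).1 hx)
      (Tendsto.comp (hF y).1 hy)).eventually (isClosed_diagonal.isOpen_compl.mem_nhds hne)
    filter_upwards [h1] with w hw he
    exact absurd he hw

theorem eventually_fderiv_rescaled_injective (hB : zeroSec m V ⊆ interior N)
    (hΦ : ∀ p, ∀ z ∈ zeroSec m V, FamAt k (fun p => ext (Φ p)) p z)
    (ha : 0 < a) (hμ : ContDiff ℝ ∞ μ) (hμ0 : ∀ s ∈ Icc 0 a, μ s = 0) (r : ℝ) (p : P) :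
    ∀ᶠ q in 𝓝 (p, (0 : ℝ)), ∀ t ∈ Icc (0 : ℝ) 1, ∀ z, nrm ξ z ≤ r →
      ContinuousAt (rescaled ξ μ (ext (Φ q.1)) q.2 t) z ∧
      ∀ c c' : Tot m V, z ∈ chartDom k c → rescaled ξ μ (ext (Φ q.1)) q.2 t z ∈ chartDom k c' →
        DifferentiableAt ℝ (rep k (rescaled ξ μ (ext (Φ q.1)) q.2 t) c c') (coord k c z) ∧
        Function.Injective
          (fderiv ℝ (rep k (rescaled ξ μ (ext (Φ q.1)) q.2 t) c c') (coord k c z)) := by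
  have h := (isCompact_Icc (a := (0 : ℝ)) (b := 1)).prod (isCompact_nrm_le ξ r)
  have key := h.eventually_forall_of_forall_eventually (x₀ := (p, (0 : ℝ)))
    (P := fun (q : P × ℝ) (w : ℝ × Tot m V) =>
      ContinuousAt (rescaled ξ μ (ext (Φ q.1)) q.2 w.1) w.2 ∧
      ∀ c c' : Tot m V, w.2 ∈ chartDom k c →
        rescaled ξ μ (ext (Φ q.1)) q.2 w.1 w.2 ∈ chartDom k c' →
        DifferentiableAt ℝ (rep k (rescaled ξ μ (ext (Φ q.1)) q.2 w.1) c c') (coord k c w.2) ∧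
        Function.Injective
          (fderiv ℝ (rep k (rescaled ξ μ (ext (Φ q.1)) q.2 w.1) c c') (coord k c w.2))) ?_
  · filter_upwards [key] with q hq t ht z hz
    exact hq (t, z) ⟨ht, hz⟩
  rintro ⟨t, x⟩ -
  have hF := famAt_rescaled_zero (ξ := ξ) hB hΦ ha hμ hμ0 p t x
  obtain ⟨c', hc', A, hA⟩ := exists_equiv_fderiv_rescaled (ξ := ξ) hB hΦ ha hμ hμ0 p t x
  have h2 : ContinuousAt (fun w : (P × ℝ) × (ℝ × Tot m V) => ((w.1, w.2.1), w.2.2))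
    ((p, 0), (t, x)) := by fun_prop
  filter_upwards [h2.eventually (hF.eventually_fderiv_injective (mem_chartDom_self x) hc' hA),
    h2.eventually hF.eventually_continuousAt] with w hw hw2
  exact ⟨ContinuousAt.comp (g := Function.uncurry fun (q : (P × ℝ) × ℝ) =>
    rescaled ξ μ (ext (Φ q.1.1)) q.1.2 q.2) (f := fun x => ((w.1, w.2.1), x)) hw2 (by fun_prop), hw⟩

/-- At `d = 0` the map does not depend on `t`. So for small `d` the value at time `t` is close to
the value of the limit map at the same point, and the time one map is open there, uniformly in the
parameter. Time one is the rescaling of the embedding itself. -/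
theorem eventually_rescaled_mem_image (hB : zeroSec m V ⊆ interior N)
    (hΦ : ∀ p, ∀ z ∈ zeroSec m V, FamAt k (fun p => ext (Φ p)) p z)
    (ha : 0 < a) (hμ : ContDiff ℝ ∞ μ) (hμ0 : ∀ s ∈ Icc 0 a, μ s = 0) {r r' : ℝ} (hr : r < r')
    (p : P) :
    ∀ᶠ q in 𝓝 (p, (0 : ℝ)), ∀ t ∈ Icc (0 : ℝ) 1, ∀ z, nrm ξ z ≤ r →
      rescaled ξ μ (ext (Φ q.1)) q.2 t z ∈
        rescaled ξ μ (ext (Φ q.1)) q.2 1 '' {z | nrm ξ z ≤ r'} := by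
  have h := (isCompact_Icc (a := (0 : ℝ)) (b := 1)).prod (isCompact_nrm_le ξ r)
  have key := h.eventually_forall_of_forall_eventually (x₀ := (p, (0 : ℝ)))
    (P := fun (q : P × ℝ) (w : ℝ × Tot m V) =>
      rescaled ξ μ (ext (Φ q.1)) q.2 w.1 w.2 ∈
        rescaled ξ μ (ext (Φ q.1)) q.2 1 '' {z | nrm ξ z ≤ r'}) ?_
  · filter_upwards [key] with q hq t ht z hz
    exact hq (t, z) ⟨ht, hz⟩
  rintro ⟨t, x⟩ ⟨-, hx⟩
  have hF := famAt_rescaled_zero (ξ := ξ) hB hΦ ha hμ hμ0 p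
  obtain ⟨c', hc', A, hA⟩ := exists_equiv_fderiv_rescaled (ξ := ξ) hB hΦ ha hμ hμ0 p 1 x
  have h2 : ContinuousAt (fun w : (P × ℝ) × (ℝ × Tot m V) => ((w.1, w.2.1), w.2.2))
    ((p, 0), (t, x)) := by fun_prop
  have h3 := (hF 1 x).eventually_mem_image (mem_chartDom_self x) hc' hA
    (((continuous_nrm ξ).tendsto x).eventually_le_const (lt_of_le_of_lt hx hr))
  have h4 : Tendsto (fun w : (P × ℝ) × (ℝ × Tot m V) =>
      rescaled ξ μ (ext (Φ w.1.1)) w.1.2 w.2.1 w.2.2) (𝓝 ((p, 0), (t, x)))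
      (𝓝 (rescaled ξ μ (ext (Φ p)) 0 1 x)) := by
    have h5 := Tendsto.comp (hF t x).1 h2
    have e : rescaled ξ μ (ext (Φ p)) 0 1 x = rescaled ξ μ (ext (Φ p)) 0 t x := by
      rw [rescaled_zero, rescaled_zero]
    rw [e]
    exact h5
  have h6 : Tendsto (fun w : (P × ℝ) × (ℝ × Tot m V) => (w.1, (1 : ℝ)))
      (𝓝 ((p, 0), (t, x))) (𝓝 ((p, 0), 1)) :=
    Continuous.tendsto' (by fun_prop) _ _ rfl
  exact (h6.prodMk_nhds h4).eventually h3

/-- As `d` tends to zero, the factor `d` pushes the values to the zero section, which is interior to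
`N`. -/
theorem eventually_scale_rescaled_mem (hB : zeroSec m V ⊆ interior N)
    (hΦ : ∀ p, ∀ z ∈ zeroSec m V, FamAt k (fun p => ext (Φ p)) p z)
    (ha : 0 < a) (hμ : ContDiff ℝ ∞ μ) (hμ0 : ∀ s ∈ Icc 0 a, μ s = 0) (r : ℝ) (p : P) :
    ∀ᶠ q in 𝓝 (p, (0 : ℝ)), ∀ t ∈ Icc (0 : ℝ) 1, ∀ z, nrm ξ z ≤ r →
      scale q.2 (rescaled ξ μ (ext (Φ q.1)) q.2 t z) ∈ N := by
  have h := (isCompact_Icc (a := (0 : ℝ)) (b := 1)).prod (isCompact_nrm_le ξ r)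
  have key := h.eventually_forall_of_forall_eventually (x₀ := (p, (0 : ℝ)))
    (P := fun (q : P × ℝ) (w : ℝ × Tot m V) =>
      scale q.2 (rescaled ξ μ (ext (Φ q.1)) q.2 w.1 w.2) ∈ N) ?_
  · filter_upwards [key] with q hq t ht z hz
    exact hq (t, z) ⟨ht, hz⟩
  rintro ⟨t, x⟩ -
  have hF := famAt_rescaled_zero (ξ := ξ) hB hΦ ha hμ hμ0 p t x
  have h2 : ContinuousAt (fun w : (P × ℝ) × (ℝ × Tot m V) => ((w.1, w.2.1), w.2.2))
    ((p, 0), (t, x)) := by fun_prop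
  have h3 : Tendsto (fun w : (P × ℝ) × (ℝ × Tot m V) => w.1.2) (𝓝 ((p, 0), (t, x))) (𝓝 0) :=
    Continuous.tendsto' (by fun_prop) _ _ rfl
  exact (((continuous_scale k).tendsto _).comp (h3.prodMk_nhds (Tendsto.comp hF.1 h2))).eventually
    (mem_interior_iff_mem_nhds.1 (hB (scale_zero_mem _)))

theorem eventually_isGoodRadius (hB : zeroSec m V ⊆ interior N) (hO : O ∈ 𝓝ˢ (zeroSec m V))
    (hΦ : ∀ p, ∀ z ∈ zeroSec m V, FamAt k (fun p => ext (Φ p)) p z)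
    (ha : 0 < a) (hμ : ContDiff ℝ ∞ μ) (hμ0 : ∀ s ∈ Icc 0 a, μ s = 0) (p : P) :
    ∀ᶠ q in 𝓝 (p, (0 : ℝ)), 0 < q.2 → IsGoodRadius ξ b μ O N (ext (Φ q.1)) q.2 := by
  have h5 : Tendsto (fun q : P × ℝ => (b + 1) * q.2) (𝓝 (p, 0)) (𝓝 0) :=
    Continuous.tendsto' (by fun_prop) _ _ (by simp)
  -- The rescaled deformation is the rescaled embedding from radius `b` on; the margin from `b` to
  -- `b + 1` absorbs the difference of the images. The last radius, one, becomes `d` after scaling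
  -- back.
  filter_upwards [h5.eventually (eventually_nrm_subset ξ hO),
    eventually_injOn_rescaled (ξ := ξ) hB hΦ ha hμ hμ0 (b + 1) p,
    eventually_fderiv_rescaled_injective (ξ := ξ) hB hΦ ha hμ hμ0 (b + 1) p,
    eventually_rescaled_mem_image (ξ := ξ) hB hΦ ha hμ hμ0 (lt_add_one b) p,
    eventually_scale_rescaled_mem (ξ := ξ) hB hΦ ha hμ hμ0 1 p] with q h1 h2 h3 h4 h5 hq
  have hle : ∀ {r : ℝ} {z : Tot m V}, nrm ξ z ≤ r * q.2 → nrm ξ (scale q.2⁻¹ z) ≤ r := by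
    intro r z hz
    rw [nrm_scale, abs_of_pos (inv_pos.2 hq), inv_mul_le_iff₀ hq, mul_comm]
    exact hz
  have hdef : ∀ t, deform ξ μ (ext (Φ q.1)) q.2 t =
      fun z => scale q.2 (rescaled ξ μ (ext (Φ q.1)) q.2 t (scale q.2⁻¹ z)) := fun t =>
    funext fun z => deform_eq_scale ξ μ _ hq t z
  have hsc : Function.Injective (scale q.2 : Tot m V → Tot m V) := fun z w hzw => by
    have := congrArg (scale q.2⁻¹) hzw
    rwa [scale_scale, scale_scale, inv_mul_cancel₀ hq.ne', scale_one, scale_one] at this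
  have hsc' : Function.Injective (scale q.2⁻¹ : Tot m V → Tot m V) := fun z w hzw => by
    have := congrArg (scale q.2) hzw
    rwa [scale_scale, scale_scale, mul_inv_cancel₀ hq.ne', scale_one, scale_one] at this
  refine ⟨h1, fun t ht z hz w hw he => ?_, fun t ht z hz c c' hc hc' => ?_,
    fun t ht z hz => ?_, fun t ht z hz => ?_⟩
  · rw [hdef] at he
    exact hsc' (h2 t ht (hle hz) (hle hw) (hsc he))
  · rw [hdef] at hc' ⊢
    rw [scale_mem_chartDom] at hc'
    obtain ⟨h6, h7⟩ := h3 t ht _ (hle hz)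
    obtain ⟨h8, h9⟩ := h7 c c' (scale_mem_chartDom.2 hc) hc'
    exact fderiv_rep_conj_scale_injective hq.ne' h6 hc hc' h8 h9
  · obtain ⟨w, hw, hwe⟩ := h4 t ht _ (hle hz)
    refine ⟨scale q.2 w, ?_, ?_⟩
    · rw [nrm_scale, abs_of_pos hq, mul_comm]
      exact mul_le_mul_of_nonneg_right hw hq.le
    · rw [hdef]
      dsimp only
      rw [← hwe, ← deform_scale ξ μ _ hq, deform]
      have e : phi ξ μ q.2 1 (scale q.2 w) = 1 := by simp [phi]
      rw [e, blowup_one]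
  · rw [hdef]
    exact h5 t ht _ (hle (by rwa [one_mul]))

end Total

/-! ### From a good radius to an embedding of all of `N`. -/

/-- A continuous injection that agrees with an embedding outside a compact set, and whose range is
contained in the range of this embedding, is an embedding. -/
theorem isEmbedding_of_eqOn {X Y : Type*} [TopologicalSpace X] [TopologicalSpace Y] [T2Space Y]
    {f g : X → Y} (hg : IsEmbedding g) (hf : Continuous f) (hinj : Function.Injective f)
    {K C : Set X} (hK : IsCompact K) (hC : IsClosed C) (hKC : K ∪ C = univ) (he : EqOn f g C)
    (hr : range f ⊆ range g) : IsEmbedding f := by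
  refine ⟨isInducing_iff_nhds.2 fun x => le_antisymm hf.continuousAt.le_comap ?_, hinj⟩
  refine le_iff_ultrafilter.2 fun U hU => ?_
  have hUf : Tendsto f U (𝓝 (f x)) := tendsto_iff_comap.2 hU
  have hmem : K ∪ C ∈ U := by rw [hKC]; exact univ_mem
  rcases Ultrafilter.union_mem_iff.1 hmem with h | h
  -- On the compact part the ultrafilter has a limit `y`, whose image is the limit `f x` of the
  -- images; injectivity identifies `y` with `x`.
  · obtain ⟨y, -, hy⟩ := hK.ultrafilter_le_nhds' U h
    rwa [← hinj (tendsto_nhds_unique ((hf.tendsto y).mono_left hy) hUf)]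
  -- On `C` the maps agree, and the inclusion of ranges produces a `y` with `g y = f x` to which the
  -- embedding `g` forces convergence. As `C` is closed it contains `y`, so `f y = g y = f x` and `y
  -- = x`.
  · obtain ⟨y, hy⟩ := hr ⟨x, rfl⟩
    have h1 : Tendsto g U (𝓝 (g y)) := by
      rw [hy]
      exact hUf.congr' (mem_of_superset h he)
    have h2 : (U : Filter X) ≤ 𝓝 y := by
      rw [hg.isInducing.nhds_eq_comap]
      exact tendsto_iff_comap.1 h1
    have hyC : y ∈ C := by
      by_contra hyC
      exact Ultrafilter.compl_notMem_iff.2 h (h2 (hC.isOpen_compl.mem_nhds hyC))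
    rwa [← hinj ((he hyC).trans hy)]

section Total

variable {ι : Type*} (k : ι → ℕ) {m : ι → ℕ} {B : ι → Type*}
  [∀ i, TopologicalSpace (B i)] [∀ i, ChartedSpace (Euc (k i)) (B i)]
  {V : ∀ i, B i → Type*}
  [∀ i b, AddCommGroup (V i b)] [∀ i b, Module ℝ (V i b)] [∀ i b, TopologicalSpace (V i b)]
  [∀ i, TopologicalSpace (TotalSpace (Euc (m i)) (V i))]
  [∀ i, FiberBundle (Euc (m i)) (V i)] [∀ i, VectorBundle ℝ (Euc (m i)) (V i)]

variable {k}

variable [∀ i, IsManifold (𝓡 (k i)) ∞ (B i)]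
  [∀ i, ContMDiffVectorBundle ∞ (Euc (m i)) (V i) (𝓡 (k i))] {N : Set (Tot m V)}

theorem FamAt.congr {P : Type*} [TopologicalSpace P] {Φ Ψ : P → Tot m V → Tot m V} {p : P}
    {z : Tot m V} (h : FamAt k Φ p z) (he : ∀ᶠ w in 𝓝 (p, z), Φ w.1 w.2 = Ψ w.1 w.2) :
    FamAt k Ψ p z := by
  refine ⟨h.1.congr he, fun c c' hc hc' n => ?_⟩
  rw [← he.self_of_nhds] at hc'
  refine (h.2 c c' hc hc' n).congr ?_
  have h3 := continuousAt_coordSymm (coord_mem hc)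
  have h4 : ContinuousAt (fun w : P × (Euc (k c.1) × Euc (m c.1)) => (w.1, coordSymm k c w.2))
      (p, coord k c z) :=
    continuousAt_fst.prodMk (ContinuousAt.comp (g := coordSymm k c) (f := Prod.snd) h3
      continuousAt_snd)
  rw [ContinuousAt, coordSymm_coord hc] at h4
  filter_upwards [h4.eventually he] with w hw
  exact congrArg (coord k c') hw

/-- Maps that agree on `N` near `z` have representatives that agree near `z`. -/
theorem rep_eventuallyEq_nhdsWithin {g g' : Tot m V → Tot m V} {z c : Tot m V} (c' : Tot m V)
    (hc : z ∈ chartDom k c) (he : g =ᶠ[𝓝[N] z] g') :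
    rep k g c c' =ᶠ[𝓝[chartSet k N c] (coord k c z)] rep k g' c c' := by
  filter_upwards [(tendsto_coordSymm_nhdsWithin hc).eventually he] with u hu
  exact congrArg (coord k c') hu

variable {ξ : ∀ i, OrthogonalStructure (k i) (m i) (V i)} {a b : ℝ} {μ : ℝ → ℝ}

theorem phi_mem_Icc (hμ01 : ∀ s, μ s ∈ Icc (0 : ℝ) 1) (d : ℝ) {t : ℝ} (ht : t ∈ Icc (0 : ℝ) 1)
    (z : Tot m V) : phi ξ μ d t z ∈ Icc (0 : ℝ) 1 := by
  have h1 := hμ01 (nrm ξ z / d)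
  rw [phi]
  constructor
  · nlinarith [h1.1, h1.2, ht.1, ht.2, mul_nonneg (sub_nonneg.2 ht.2) h1.1]
  · nlinarith [h1.1, h1.2, ht.1, ht.2, mul_nonneg (sub_nonneg.2 ht.2) (sub_nonneg.2 h1.2)]

theorem nrm_scale_phi_le (hμ01 : ∀ s, μ s ∈ Icc (0 : ℝ) 1) (d : ℝ) {t : ℝ}
    (ht : t ∈ Icc (0 : ℝ) 1) (z : Tot m V) : nrm ξ (scale (phi ξ μ d t z) z) ≤ nrm ξ z := by
  have h := phi_mem_Icc (ξ := ξ) hμ01 d ht z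
  rw [nrm_scale, abs_of_nonneg h.1]
  exact mul_le_of_le_one_left (nrm_nonneg ξ z) h.2

theorem deform_eq_of_le (hμ1 : ∀ s, b ≤ s → μ s = 1) {d : ℝ} (hd : 0 < d) (g : Tot m V → Tot m V)
    (t : ℝ) {z : Tot m V} (hz : b * d ≤ nrm ξ z) : deform ξ μ g d t z = g z := by
  rw [deform, phi_eq_one hμ1 hd t hz, blowup_one]

/-- Two points of the ball of radius `(b + 1) d` are separated by the good radius, two points
outside the ball of radius `b d` by `h`. In the remaining mixed case the value at the inner point is
`h w` with `w` in the larger ball, and injectivity of `h` excludes the outer point. -/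
theorem IsGoodRadius.injOn_deform {h : Emb k N} {d t : ℝ}
    (hd : IsGoodRadius ξ b μ (interior N) N (ext h) d) (hd0 : 0 < d)
    (hμ1 : ∀ s, b ≤ s → μ s = 1) (ht : t ∈ Icc (0 : ℝ) 1) :
    InjOn (deform ξ μ (ext h) d t) N := by
  have hlt : b * d < (b + 1) * d := mul_lt_mul_of_pos_right (lt_add_one b) hd0
  have key : ∀ z ∈ N, ∀ w ∈ N, nrm ξ z ≤ b * d → (b + 1) * d < nrm ξ w →
      deform ξ μ (ext h) d t z ≠ deform ξ μ (ext h) d t w := by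
    intro z _ w hw hz1 hw1 he
    obtain ⟨y, hy, hye⟩ := hd.mem_image t ht z hz1
    rw [deform_eq_of_le hμ1 hd0 _ _ (hlt.trans hw1).le, hye] at he
    rw [h.injOn_ext (interior_subset (hd.subset hy)) hw he] at hy
    exact absurd hy (not_le.2 hw1)
  intro z hz w hw he
  rcases le_or_gt (nrm ξ z) (b * d) with hz1 | hz1 <;>
  rcases le_or_gt (nrm ξ w) (b * d) with hw1 | hw1
  · exact hd.injOn t ht (hz1.trans hlt.le) (hw1.trans hlt.le) he
  · rcases le_or_gt (nrm ξ w) ((b + 1) * d) with hw2 | hw2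
    · exact hd.injOn t ht (hz1.trans hlt.le) hw2 he
    · exact absurd he (key z hz w hw hz1 hw2)
  · rcases le_or_gt (nrm ξ z) ((b + 1) * d) with hz2 | hz2
    · exact hd.injOn t ht hz2 (hw1.trans hlt.le) he
    · exact absurd he.symm (key w hw z hz hw1 hz2)
  · rw [deform_eq_of_le hμ1 hd0 _ _ hz1.le, deform_eq_of_le hμ1 hd0 _ _ hw1.le] at he
    exact h.injOn_ext hz hw he

theorem IsGoodRadius.isEmbedding_deform [Finite ι] [∀ i, CompactSpace (B i)] [∀ i, T2Space (B i)]
    {h : Emb k N} {d t : ℝ}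
    (hd : IsGoodRadius ξ b μ (interior N) N (ext h) d) (hd0 : 0 < d)
    (hμ1 : ∀ s, b ≤ s → μ s = 1) (ht : t ∈ Icc (0 : ℝ) 1)
    (hcont : Continuous fun z : N => deform ξ μ (ext h) d t z) :
    IsEmbedding fun z : N => deform ξ μ (ext h) d t z := by
  have := t2Space_tot (m := m) (V := V) (B := B)
  have hlt : b * d < (b + 1) * d := mul_lt_mul_of_pos_right (lt_add_one b) hd0
  refine isEmbedding_of_eqOn (K := {z : N | nrm ξ z.1 ≤ b * d}) (C := {z : N | b * d ≤ nrm ξ z.1})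
    h.2.2.1 hcont (fun z w hzw => Subtype.ext (hd.injOn_deform hd0 hμ1 ht z.2 w.2 hzw)) ?_ ?_ ?_ ?_ ?_
  · refine Topology.IsInducing.subtypeVal.isCompact_preimage_iff (K := {z | nrm ξ z ≤ b * d}) ?_
      |>.2 (isCompact_nrm_le ξ _)
    rw [Subtype.range_coe]
    exact fun z hz => interior_subset (hd.subset (le_trans hz hlt.le))
  · exact isClosed_le continuous_const ((continuous_nrm ξ).comp continuous_subtype_val)
  · exact eq_univ_of_forall fun z => le_total (nrm ξ z.1) (b * d)
  · intro z hz
    exact (deform_eq_of_le hμ1 hd0 _ _ hz).trans (ext_coe _ _)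
  · rintro _ ⟨z, rfl⟩
    rcases le_total (nrm ξ z.1) (b * d) with hz | hz
    · obtain ⟨w, hw, hwe⟩ := hd.mem_image t ht z hz
      have hwN := interior_subset (hd.subset hw)
      exact ⟨⟨w, hwN⟩, ((ext_of_mem _ hwN).symm.trans hwe.symm)⟩
    · exact ⟨z, ((deform_eq_of_le hμ1 hd0 _ _ hz).trans (ext_coe _ _)).symm⟩

end Total

/-! ### The isotopy defined by an admissible radius function: smoothness and injective tangent maps.
-/

section Total

variable {ι : Type*} (k : ι → ℕ) {m : ι → ℕ} {B : ι → Type*}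
  [∀ i, TopologicalSpace (B i)] [∀ i, ChartedSpace (Euc (k i)) (B i)]
  {V : ∀ i, B i → Type*}
  [∀ i b, AddCommGroup (V i b)] [∀ i b, Module ℝ (V i b)] [∀ i b, TopologicalSpace (V i b)]
  [∀ i, TopologicalSpace (TotalSpace (Euc (m i)) (V i))]
  [∀ i, FiberBundle (Euc (m i)) (V i)] [∀ i, VectorBundle ℝ (Euc (m i)) (V i)]

variable {k}

theorem eventuallyEq_ext_restrict {N : Set (Tot m V)} (g : Tot m V → Tot m V) (z : Tot m V) :
    ext (fun w : N => g w) =ᶠ[𝓝[N] z] g := by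
  filter_upwards [self_mem_nhdsWithin] with w hw
  exact ext_of_mem _ hw

variable [∀ i, IsManifold (𝓡 (k i)) ∞ (B i)]
  [∀ i, ContMDiffVectorBundle ∞ (Euc (m i)) (V i) (𝓡 (k i))] {N : Set (Tot m V)}
  {ξ : ∀ i, OrthogonalStructure (k i) (m i) (V i)} {a b : ℝ} {μ : ℝ → ℝ}

theorem eventuallyEq_ext_deform (hμ1 : ∀ s, b ≤ s → μ s = 1) {d : ℝ} (hd : 0 < d)
    (h : N → Tot m V) (t : ℝ) {z : Tot m V} (hz : b * d < nrm ξ z) :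
    ext (fun w : N => deform ξ μ (ext h) d t w) =ᶠ[𝓝[N] z] ext h := by
  filter_upwards [eventuallyEq_ext_restrict (N := N) (deform ξ μ (ext h) d t) z,
    mem_nhdsWithin_of_mem_nhds ((continuous_nrm ξ).continuousAt.eventually (lt_mem_nhds hz))]
    with w hw hw1
  rw [hw, deform_eq_of_le hμ1 hd _ _ (le_of_lt hw1)]

/-- The hypotheses under which the deformation of radius `δ h` is an isotopy of embeddings that
depends continuously on `h`. -/
structure IsAdmissible (ξ : ∀ i, OrthogonalStructure (k i) (m i) (V i)) (a b : ℝ) (μ : ℝ → ℝ)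
    (δ : Emb k N → ℝ) : Prop where
  isDomain : IsDomain k N
  zeroSec_subset : zeroSec m V ⊆ interior N
  a_pos : 0 < a
  a_lt : a < b
  contDiff : ContDiff ℝ ∞ μ
  mem_Icc : ∀ s, μ s ∈ Icc (0 : ℝ) 1
  eq_zero : ∀ s ∈ Icc 0 a, μ s = 0
  eq_one : ∀ s, b ≤ s → μ s = 1
  continuous : Continuous δ
  pos : ∀ h, 0 < δ h
  isGoodRadius : ∀ h : Emb k N, IsGoodRadius ξ b μ (interior N) N (ext h) (δ h)

namespace IsAdmissible

variable {δ : Emb k N → ℝ}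

/-- Since `φ ≤ 1`, scaling by `φ` does not increase the norm, so the embedding is evaluated at
points interior to `N`, where the universal family is parametrically smooth. -/
theorem famAt (hA : IsAdmissible ξ a b μ δ)
    (q : Emb k N × Icc (0 : ℝ) 1) {z : Tot m V} (hz : nrm ξ z ≤ (b + 1) * δ q.1) :
    FamAt k (fun q : Emb k N × Icc (0 : ℝ) 1 =>
      ext (fun w : N => deform ξ μ (ext q.1) (δ q.1) q.2 w)) q z := by
  have hT : Continuous fun q : Emb k N × Icc (0 : ℝ) 1 => (q.2 : ℝ) := by fun_prop
  have hD : Continuous fun q : Emb k N × Icc (0 : ℝ) 1 => δ q.1 := hA.continuous.comp continuous_fst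
  have hθ : Continuous fun q : Emb k N × Icc (0 : ℝ) 1 => q.1.1 :=
    continuous_subtype_val.comp continuous_fst
  have h1 : FamAt k (fun q : Emb k N × Icc (0 : ℝ) 1 => ext q.1) q
      (scale (phi ξ μ (δ q.1) q.2 z) z) := by
    refine FamAt.reparam (Φ := fun f : SmoothMap k N => ext f.toFun)
      (θ := fun q : Emb k N × Icc (0 : ℝ) 1 => q.1.1) (SmoothMap.famAt hA.isDomain q.1.1 ?_) hθ
    exact (hA.isGoodRadius q.1).subset ((nrm_scale_phi_le hA.mem_Icc _ q.2.2 z).trans hz)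
  have h2 : FamAt k (fun q : Emb k N × Icc (0 : ℝ) 1 => deform ξ μ (ext q.1) (δ q.1) q.2) q z :=
    FamAt.blowup (Φ := fun q : Emb k N × Icc (0 : ℝ) 1 => ext q.1)
      (σ := fun q z => phi ξ μ (δ q.1) q.2 z) h1 (fun q => q.1.zeroSec_mapsTo hA.zeroSec_subset)
      (continuousAt_phi hA.contDiff.continuous hD hT (hA.pos q.1) z)
      (fun c hc n => psAt_phi hA.a_pos hA.contDiff hA.eq_zero hD hT (hA.pos q.1) hc n)
  refine h2.congr ?_
  have hzN : N ∈ 𝓝 z := mem_interior_iff_mem_nhds.1 ((hA.isGoodRadius q.1).subset hz)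
  have hsnd : ContinuousAt (fun w : (Emb k N × Icc (0 : ℝ) 1) × Tot m V => w.2) (q, z) :=
    continuousAt_snd
  filter_upwards [hsnd.eventually hzN] with w hw
  exact (ext_of_mem (fun x : N => deform ξ μ (ext w.1.1) (δ w.1.1) w.1.2 x) hw).symm

/-- The dichotomy used for all regularity statements below: up to norm `b δ` the point is interior
to `N` and the smooth family applies; beyond it the deformation agrees with the embedding near the
point within `N`, even at boundary points. -/
theorem continuousOn (hA : IsAdmissible ξ a b μ δ) (q : Emb k N × Icc (0 : ℝ) 1) :
    ContinuousOn (ext (fun w : N => deform ξ μ (ext q.1) (δ q.1) q.2 w)) N := by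
  intro z hz
  rcases le_or_gt (nrm ξ z) (b * δ q.1) with hz1 | hz1
  · refine ContinuousAt.continuousWithinAt ?_
    have h1 := (hA.famAt q
      (hz1.trans (mul_le_mul_of_nonneg_right (lt_add_one b).le (hA.pos q.1).le))).1
    exact ContinuousAt.comp (g := Function.uncurry fun q : Emb k N × Icc (0 : ℝ) 1 =>
      ext (fun w : N => deform ξ μ (ext q.1) (δ q.1) q.2 w)) (f := fun x => (q, x)) h1
      (by fun_prop)
  · exact (continuousOn_ext q.1.1.continuous_toFun z hz).congr_of_eventuallyEq_of_mem
      (eventuallyEq_ext_deform hA.eq_one (hA.pos q.1) q.1 q.2 hz1) hz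

theorem contDiffWithinAt_rep (hA : IsAdmissible ξ a b μ δ) (q : Emb k N × Icc (0 : ℝ) 1) {z c c' : Tot m V}
    (hz : z ∈ N) (hc : z ∈ chartDom k c)
    (hc' : ext (fun w : N => deform ξ μ (ext q.1) (δ q.1) q.2 w) z ∈ chartDom k c') :
    ContDiffWithinAt ℝ ∞ (rep k (ext (fun w : N => deform ξ μ (ext q.1) (δ q.1) q.2 w)) c c')
      (chartSet k N c) (coord k c z) := by
  rcases le_or_gt (nrm ξ z) (b * δ q.1) with hz1 | hz1
  · refine ContDiffAt.contDiffWithinAt (contDiffAt_infty.2 fun n => ?_)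
    exact ((hA.famAt q (hz1.trans
      (mul_le_mul_of_nonneg_right (lt_add_one b).le (hA.pos q.1).le))).2 c c' hc hc' n).contDiffAt
  · have he := eventuallyEq_ext_deform hA.eq_one (hA.pos q.1) q.1 q.2 hz1
    rw [he.self_of_nhdsWithin hz] at hc'
    exact (q.1.1.contDiffWithinAt_rep hz hc hc').congr_of_eventuallyEq_of_mem
      (rep_eventuallyEq_nhdsWithin c' hc he) (coord_mem_chartSet hz hc)

theorem contMDiffWithinAt (hA : IsAdmissible ξ a b μ δ) (q : Emb k N × Icc (0 : ℝ) 1) (i : ι)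
    (x : TotalSpace (Euc (m i)) (V i)) (hx : x ∈ slice N i) :
    ContMDiffWithinAt (totModel (k i) (m i))
      (totModel (k (ext (fun w : N => deform ξ μ (ext q.1) (δ q.1) q.2 w) ⟨i, x⟩).1)
        (m (ext (fun w : N => deform ξ μ (ext q.1) (δ q.1) q.2 w) ⟨i, x⟩).1)) ∞
      (loc (ext fun w : N => deform ξ μ (ext q.1) (δ q.1) q.2 w) i x) (slice N i) x :=
  (contMDiffWithinAt_loc_iff (c := ⟨i, x⟩) (mem_chartDom_self _)
    (hA.continuousOn q _ hx) (mem_chartDom_self _)).2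
    (hA.contDiffWithinAt_rep q hx
      (mem_chartDom_self _) (mem_chartDom_self _))

theorem mfderivWithin_injective (hA : IsAdmissible ξ a b μ δ) (q : Emb k N × Icc (0 : ℝ) 1) (i : ι)
    (x : TotalSpace (Euc (m i)) (V i)) (hx : x ∈ slice N i) :
    Function.Injective (mfderivWithin (totModel (k i) (m i))
      (totModel (k (ext (fun w : N => deform ξ μ (ext q.1) (δ q.1) q.2 w) ⟨i, x⟩).1)
        (m (ext (fun w : N => deform ξ μ (ext q.1) (δ q.1) q.2 w) ⟨i, x⟩).1))
      (loc (ext fun w : N => deform ξ μ (ext q.1) (δ q.1) q.2 w) i x) (slice N i) x) := by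
  have hxN : (⟨i, x⟩ : Tot m V) ∈ N := hx
  have hc := mem_chartDom_self (k := k) (⟨i, x⟩ : Tot m V)
  rw [mfderivWithin_loc_injective_iff (w := deform ξ μ (ext q.1) (δ q.1) q.2 ⟨i, x⟩)
    (ext_of_mem _ hxN) ((hA.contMDiffWithinAt q i x
      hx).mdifferentiableWithinAt (by simp))]
  rcases le_or_gt (nrm ξ (⟨i, x⟩ : Tot m V)) (b * δ q.1) with hz1 | hz1
  · have hz2 := hz1.trans (mul_le_mul_of_nonneg_right (lt_add_one b).le (hA.pos q.1).le)
    have hint := (hA.isGoodRadius q.1).subset hz2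
    have hnhds := chartSet_mem_nhds hint hc
    have he := rep_eventuallyEq_nhdsWithin (deform ξ μ (ext q.1) (δ q.1) q.2 ⟨i, x⟩) hc
      (eventuallyEq_ext_restrict (N := N) (deform ξ μ (ext q.1) (δ q.1) q.2) ⟨i, x⟩)
    rw [nhdsWithin_eq_nhds.2 hnhds] at he
    rw [fderivWithin_of_mem_nhds hnhds, he.fderiv_eq]
    exact (hA.isGoodRadius q.1).fderiv_injective q.2 q.2.2 _ hz2 _ _ hc (mem_chartDom_self _)
  · have he := eventuallyEq_ext_deform hA.eq_one (hA.pos q.1) q.1 q.2 hz1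
    have he1 := he.self_of_nhdsWithin hxN
    rw [ext_of_mem _ hxN] at he1
    have he2 := rep_eventuallyEq_nhdsWithin (deform ξ μ (ext q.1) (δ q.1) q.2 ⟨i, x⟩) hc he
    rw [he2.fderivWithin_eq (he2.self_of_nhdsWithin (coord_mem_chartSet hxN hc))]
    exact (mfderivWithin_loc_injective_iff he1.symm
      ((q.1.1.smooth_toFun i x hx).mdifferentiableWithinAt (by simp))).1 (q.1.2.2.2 i x hx)

end IsAdmissible

end Total

/-! ### Continuity of the isotopy for the Whitney topology. -/

section Total

variable {ι : Type*} (k : ι → ℕ) {m : ι → ℕ} {B : ι → Type*}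
  [∀ i, TopologicalSpace (B i)] [∀ i, ChartedSpace (Euc (k i)) (B i)]
  {V : ∀ i, B i → Type*}
  [∀ i b, AddCommGroup (V i b)] [∀ i b, Module ℝ (V i b)] [∀ i b, TopologicalSpace (V i b)]
  [∀ i, TopologicalSpace (TotalSpace (Euc (m i)) (V i))]
  [∀ i, FiberBundle (Euc (m i)) (V i)] [∀ i, VectorBundle ℝ (Euc (m i)) (V i)]

variable {k}

variable [∀ i, IsManifold (𝓡 (k i)) ∞ (B i)]
  [∀ i, ContMDiffVectorBundle ∞ (Euc (m i)) (V i) (𝓡 (k i))]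
  {N : Set (Tot m V)}

theorem chartDeriv_congr {h h' : N → Tot m V} {c z : Tot m V} (c' : Tot m V)
    (hz : z ∈ N) (hc : z ∈ chartDom k c) (he : ext h =ᶠ[𝓝[N] z] ext h') (l : ℕ) :
    chartDeriv k h c c' l z = chartDeriv k h' c c' l z := by
  have h1 := rep_eventuallyEq_nhdsWithin c' hc he
  rw [chartDeriv_eq, chartDeriv_eq,
    h1.iteratedFDerivWithin_eq (h1.self_of_nhdsWithin (coord_mem_chartSet hz hc))]

variable {ξ : ∀ i, OrthogonalStructure (k i) (m i) (V i)} {a b : ℝ} {μ : ℝ → ℝ}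
  {δ : Emb k N → ℝ}

namespace IsAdmissible

variable [Finite ι] [∀ i, CompactSpace (B i)] [∀ i, T2Space (B i)]

/-- The deformation as a smooth map. -/
def smoothMap (hA : IsAdmissible ξ a b μ δ) (q : Emb k N × Icc (0 : ℝ) 1) : SmoothMap k N where
  toFun w := deform ξ μ (ext q.1) (δ q.1) q.2 w
  continuous_toFun := by
    have h := (hA.continuousOn q).comp_continuous continuous_subtype_val fun z : N => z.2
    exact h.congr fun z => ext_coe _ z
  smooth_toFun := hA.contMDiffWithinAt q

/-- The deformation as an embedding. -/
def isotopy (hA : IsAdmissible ξ a b μ δ) (q : Emb k N × Icc (0 : ℝ) 1) : Emb k N :=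
  ⟨hA.smoothMap q, fun _ hz => blowup_mem_zeroSec (q.1.zeroSec_mapsTo hA.zeroSec_subset) _ hz,
    (hA.isGoodRadius q.1).isEmbedding_deform (hA.pos q.1) hA.eq_one q.2.2
      (hA.smoothMap q).continuous_toFun, hA.mfderivWithin_injective q⟩

theorem isotopy_apply (hA : IsAdmissible ξ a b μ δ) (q : Emb k N × Icc (0 : ℝ) 1) (z : N) :
    hA.isotopy q z = deform ξ μ (ext q.1) (δ q.1) q.2 z := rfl

/-- Continuity of `δ` keeps a point outside the ball of radius `b δ` when the embedding and the
point vary slightly. -/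
theorem eventually_eventuallyEq (hA : IsAdmissible ξ a b μ δ) (p : Emb k N × Icc (0 : ℝ) 1)
    {z : Tot m V} (hz : b * δ p.1 < nrm ξ z) :
    ∀ᶠ q in 𝓝 p ×ˢ 𝓝[N] z, ext (hA.smoothMap q.1).toFun =ᶠ[𝓝[N] q.2] ext q.1.1 := by
  have h1 : ContinuousAt (fun q : (Emb k N × Icc (0 : ℝ) 1) × Tot m V => b * δ q.1.1) (p, z) :=
    (continuous_const.mul (hA.continuous.comp
      (continuous_fst.comp continuous_fst))).continuousAt
  have h2 : ContinuousAt (fun q : (Emb k N × Icc (0 : ℝ) 1) × Tot m V => nrm ξ q.2) (p, z) :=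
    ((continuous_nrm ξ).comp continuous_snd).continuousAt
  have h3 := h1.eventually_lt h2 hz
  rw [nhds_prod_eq] at h3
  filter_upwards [h3.filter_mono (Filter.prod_mono le_rfl nhdsWithin_le_nhds)] with q hq
  exact eventuallyEq_ext_deform hA.eq_one (hA.pos q.1.1) q.1.1 q.1.2 hq

/-- It suffices that chart derivatives are jointly continuous. Inside the ball this is part of
parametric smoothness; outside they are the derivatives of the embedding itself, jointly continuous
by definition of the topology. -/
theorem continuous_isotopy (hA : IsAdmissible ξ a b μ δ) : Continuous hA.isotopy := by
  have hle : ∀ (p : Emb k N × Icc (0 : ℝ) 1) (z : Tot m V),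
      𝓝 p ×ˢ 𝓝[N] z ≤ 𝓝 (p, z) := fun p z =>
    (Filter.prod_mono le_rfl nhdsWithin_le_nhds).trans_eq nhds_prod_eq.symm
  have hmap : ∀ (p : Emb k N × Icc (0 : ℝ) 1) (z : Tot m V),
      Tendsto (fun q : (Emb k N × Icc (0 : ℝ) 1) × Tot m V => (q.1.1.1, q.2))
        (𝓝 p ×ˢ 𝓝[N] z) (𝓝 p.1.1 ×ˢ 𝓝[N] z) := fun p z => by
    have h1 : Continuous fun q : Emb k N × Icc (0 : ℝ) 1 => q.1.1 :=
      continuous_subtype_val.comp continuous_fst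
    exact Tendsto.prodMap (h1.tendsto p) tendsto_id
  have hmem : ∀ (p : Emb k N × Icc (0 : ℝ) 1) (z : Tot m V), ∀ᶠ q in 𝓝 p ×ˢ 𝓝[N] z, q.2 ∈ N :=
    fun p z => tendsto_snd.eventually self_mem_nhdsWithin
  refine continuous_induced_rng.2 (continuous_of_tendsto_chartDeriv hA.isDomain
    (Φ := hA.smoothMap) (fun p z hz => ?_) fun p z hz c c' hc hc' l => ?_) <;>
  rcases le_or_gt (nrm ξ z) (b * δ p.1) with hz1 | hz1
  · exact (hA.famAt p (hz1.trans (mul_le_mul_of_nonneg_right (lt_add_one b).le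
      (hA.pos p.1).le))).1.mono_left (hle p z)
  · have he := (eventuallyEq_ext_deform hA.eq_one (hA.pos p.1) p.1 p.2 hz1).self_of_nhdsWithin hz
    have h1 := (tendsto_ext hA.isDomain p.1.1 hz).comp (hmap p z)
    rw [← he] at h1
    refine h1.congr' ?_
    filter_upwards [hA.eventually_eventuallyEq p hz1, hmem p z] with q hq hqN
    exact (hq.self_of_nhdsWithin hqN).symm
  · have hz2 := hz1.trans (mul_le_mul_of_nonneg_right (lt_add_one b).le (hA.pos p.1).le)
    exact ((hA.famAt p hz2).continuousAt_chartDeriv ((hA.isGoodRadius p.1).subset hz2) hc hc'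
      l).mono_left (hle p z)
  · have he := eventuallyEq_ext_deform hA.eq_one (hA.pos p.1) p.1 p.2 hz1
    have hc'' : ext p.1 z ∈ chartDom k c' := by
      rw [← he.self_of_nhdsWithin hz]
      exact hc'
    have h1 := (tendsto_chartDeriv hA.isDomain p.1.1 hz hc hc'' l).comp (hmap p z)
    rw [← chartDeriv_congr c' hz hc he l] at h1
    refine h1.congr' ?_
    have hdom : ∀ᶠ q in 𝓝 p ×ˢ 𝓝[N] z, q.2 ∈ chartDom k c :=
      tendsto_snd.eventually (mem_nhdsWithin_of_mem_nhds ((isOpen_chartDom c).mem_nhds hc))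
    filter_upwards [hA.eventually_eventuallyEq p hz1, hmem p z, hdom] with q hq hqN hqc
    exact (chartDeriv_congr c' hqN hqc hq l).symm

theorem exists_isotopy (hA : IsAdmissible ξ a b μ δ) :
    ∃ H : Emb k N × Icc (0 : ℝ) 1 → Emb k N, Continuous H ∧
      (∀ (h : Emb k N) (t : Icc (0 : ℝ) 1), 0 < (t : ℝ) → ∀ x : N,
        ∃ hx : scale (phi ξ μ (δ h) t x) x ∈ N,
          H (h, t) x = scale (phi ξ μ (δ h) t x)⁻¹ (h ⟨_, hx⟩)) ∧
      (∀ (h : Emb k N) (t : Icc (0 : ℝ) 1) (x : N), b * δ h ≤ nrm ξ x.1 → H (h, t) x = h x) ∧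
      (∀ (h : Emb k N) (t : Icc (0 : ℝ) 1) (x : Tot m V), nrm ξ x ≤ δ h →
        ∃ hx : x ∈ N, H (h, t) ⟨x, hx⟩ ∈ N) ∧
      (∀ (h : Emb k N) (x : Tot m V), nrm ξ x ≤ a * δ h →
        ∃ hx : x ∈ N, H (h, 0) ⟨x, hx⟩ = tfib (ext h) x) := by
  have hpos := hA.pos
  have hab := hA.a_lt
  have ha := hA.a_pos
  have hmem : ∀ h (x : Tot m V), nrm ξ x ≤ (b + 1) * δ h → x ∈ N := fun h x hx =>
    interior_subset ((hA.isGoodRadius h).subset hx)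
  refine ⟨hA.isotopy, hA.continuous_isotopy, fun h t ht x => ?_, fun h t x hx => ?_,
    fun h t x hx => ?_, fun h x hx => ?_⟩
  · have hx : scale (phi ξ μ (δ h) t x) x.1 ∈ N := by
      rcases le_or_gt (nrm ξ x.1) (b * δ h) with hx | hx
      · exact hmem h _ ((nrm_scale_phi_le hA.mem_Icc _ t.2 _).trans
          (hx.trans (mul_le_mul_of_nonneg_right (lt_add_one b).le (hpos h).le)))
      · rw [phi_eq_one hA.eq_one (hpos h) _ hx.le, scale_one]
        exact x.2
    have hphi : phi ξ μ (δ h) t x.1 ≠ 0 := by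
      have h1 := (hA.mem_Icc (nrm ξ x.1 / δ h)).1
      have h2 := mul_nonneg (sub_nonneg.2 t.2.2) h1
      rw [phi]
      exact (add_pos_of_pos_of_nonneg ht h2).ne'
    refine ⟨hx, ?_⟩
    rw [isotopy_apply, deform, blowup_of_ne _ hphi, ext_of_mem _ hx]
  · rw [isotopy_apply, deform_eq_of_le hA.eq_one (hpos h) _ _ hx, ext_coe]
  · have hxN : x ∈ N := hmem h x (hx.trans (le_mul_of_one_le_left (hpos h).le (by linarith)))
    exact ⟨hxN, (hA.isGoodRadius h).mem t t.2 x hx⟩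
  · have hxN : x ∈ N :=
      hmem h x (hx.trans (mul_le_mul_of_nonneg_right (by linarith) (hpos h).le))
    refine ⟨hxN, ?_⟩
    rw [isotopy_apply, deform, phi_eq_of_le hA.eq_zero (hpos h) _ hx]
    exact blowup_zero _ _

end IsAdmissible

end Total

/-! ### Continuous choice of a radius over a pseudometrizable space. -/

open TopologicalSpace

/-- A positive continuous choice of radius, for a property that holds for all small radii, locally
uniformly. -/
theorem exists_continuous_pos {P : Type*} [TopologicalSpace P] [PseudoMetrizableSpace P]
    {C : P → ℝ → Prop} (hC : ∀ p, ∀ᶠ q in 𝓝 (p, (0 : ℝ)), 0 < q.2 → C q.1 q.2) :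
    ∃ δ : P → ℝ, Continuous δ ∧ ∀ p, 0 < δ p ∧ C p (δ p) := by
  let := pseudoMetrizableSpacePseudoMetric P
  -- Requiring the property for all positive radii up to `d` makes the set of suitable `d` an
  -- interval, so locally constant choices can be averaged by a partition of unity.
  have hconv : ∀ p, Convex ℝ {d : ℝ | 0 < d ∧ ∀ d', 0 < d' → d' ≤ d → C p d'} := fun p => by
    refine OrdConnected.convex ⟨fun x hx y hy z hz => ?_⟩
    exact ⟨hx.1.trans_le hz.1, fun d' h1 h2 => hy.2 d' h1 (h2.trans hz.2)⟩
  obtain ⟨g, hg⟩ := exists_continuous_forall_mem_convex_of_local_const hconv fun p => by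
    have h := hC p
    rw [nhds_prod_eq, eventually_prod_iff] at h
    obtain ⟨p₁, hp₁, p₂, hp₂, hp⟩ := h
    obtain ⟨ε, hε, hε'⟩ := Metric.eventually_nhds_iff.1 hp₂
    refine ⟨ε / 2, hp₁.mono fun q hq => ⟨half_pos hε, fun d h1 h2 => hp hq (hε' ?_) h1⟩⟩
    rw [Real.dist_eq, sub_zero, abs_of_pos h1]
    linarith
  exact ⟨g, g.continuous, fun p => ⟨(hg p).1, (hg p).2 _ (hg p).1 le_rfl⟩⟩

/-- A copy of a space, with the topology induced by a family of maps. -/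
structure InducedCopy {X A : Type*} {Y : A → Type*} (J : ∀ α, X → Y α) where
  val : X

section InducedCopy

variable {X A : Type*} {Y : A → Type*} [∀ α, PseudoMetricSpace (Y α)] (J : ∀ α, X → Y α)

instance : TopologicalSpace (InducedCopy J) :=
  TopologicalSpace.induced (fun x α => J α x.val) inferInstance

theorem InducedCopy.isInducing : IsInducing fun (x : InducedCopy J) α => J α x.val := ⟨rfl⟩

instance [Countable A] : PseudoMetrizableSpace (InducedCopy J) :=
  (InducedCopy.isInducing J).pseudoMetrizableSpace

variable {J}

theorem InducedCopy.continuous_mk [TopologicalSpace X] (hJ : ∀ α, Continuous (J α)) :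
    Continuous (InducedCopy.mk : X → InducedCopy J) :=
  (InducedCopy.isInducing J).continuous_iff.2 (continuous_pi hJ)

theorem InducedCopy.continuous_apply (α : A) : Continuous fun x : InducedCopy J => J α x.val :=
  (_root_.continuous_apply α).comp (InducedCopy.isInducing J).continuous

end InducedCopy

/-! ### Cut off derivatives, which detect parametric smoothness in a fixed pair of charts. -/

section Total

variable {ι : Type*} (k : ι → ℕ) {m : ι → ℕ} {B : ι → Type*}
  [∀ i, TopologicalSpace (B i)] [∀ i, ChartedSpace (Euc (k i)) (B i)]
  {V : ∀ i, B i → Type*}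
  [∀ i b, AddCommGroup (V i b)] [∀ i b, Module ℝ (V i b)] [∀ i b, TopologicalSpace (V i b)]
  [∀ i, TopologicalSpace (TotalSpace (Euc (m i)) (V i))]
  [∀ i, FiberBundle (Euc (m i)) (V i)] [∀ i, VectorBundle ℝ (Euc (m i)) (V i)]

variable {k}

variable [∀ i, IsManifold (𝓡 (k i)) ∞ (B i)]
  [∀ i, ContMDiffVectorBundle ∞ (Euc (m i)) (V i) (𝓡 (k i))]
  {N : Set (Tot m V)}

/-- Parametric smoothness can be checked in one pair of charts. -/
theorem FamAt.of_psAt {P : Type*} [TopologicalSpace P] {Φ : P → Tot m V → Tot m V} {p : P}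
    {z c₁ c₁' : Tot m V} (h0 : ContinuousAt (Function.uncurry Φ) (p, z)) (hc₁ : z ∈ chartDom k c₁)
    (hc₁' : Φ p z ∈ chartDom k c₁')
    (h : ∀ n, PSAt n (fun p => rep k (Φ p) c₁ c₁') (p, coord k c₁ z)) : FamAt k Φ p z := by
  refine ⟨h0, fun c c' hc hc' n => ?_⟩
  have h1 : PSAt n (fun p u => rep k (Φ p) c₁ c₁' (rep k id c c₁ u)) (p, coord k c z) := by
    refine PSAt.comp ?_ (PSAt.of_contDiffAt ((contDiffAt_rep_id hc hc₁).of_le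
      (by exact_mod_cast le_top)))
    dsimp only
    rw [rep_id_coord hc]
    exact h n
  have h2 : PSAt n (fun p u => rep k id c₁' c' (rep k (Φ p) c₁ c₁' (rep k id c c₁ u)))
      (p, coord k c z) := by
    refine PSAt.contDiffAt_comp ?_ h1
    dsimp only
    rw [rep_id_coord hc, rep_coord hc₁]
    exact (contDiffAt_rep_id hc₁' hc').of_le (by exact_mod_cast le_top)
  refine h2.congr ?_
  have h3 := continuousAt_coordSymm (coord_mem hc)
  have h4 : ContinuousAt (fun w : P × (Euc (k c.1) × Euc (m c.1)) => (w.1, coordSymm k c w.2))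
      (p, coord k c z) :=
    continuousAt_fst.prodMk (ContinuousAt.comp (g := coordSymm k c) (f := Prod.snd) h3
      continuousAt_snd)
  rw [ContinuousAt, coordSymm_coord hc] at h4
  have h5 : ∀ᶠ w in 𝓝 (p, z), w.2 ∈ chartDom k c₁ ∧ Φ w.1 w.2 ∈ chartDom k c₁' :=
    Filter.Eventually.and (continuousAt_snd.eventually ((isOpen_chartDom c₁).mem_nhds hc₁))
      (h0.eventually ((isOpen_chartDom c₁').mem_nhds hc₁'))
  filter_upwards [h4.eventually h5] with w hw
  change rep k id c₁' c' (rep k (Φ w.1) c₁ c₁' (coord k c₁ (coordSymm k c w.2))) = _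
  rw [rep_coord hw.1, rep_id_coord hw.2]
  rfl

/-- The `l`-th derivative in charts, cut off in the target. -/
def cutDeriv (χ : Tot m V → ℝ) (c c' : Tot m V) (l : ℕ) (h : Emb k N) (z : Tot m V) :
    ℝ × ((Euc (k c.1) × Euc (m c.1)) [×l]→L[ℝ] (Euc (k c'.1) × Euc (m c'.1))) :=
  (χ (ext h z), χ (ext h z) • chartDeriv k h c c' l z)

/-- The cutoff removes the condition that `h z` lie in the target chart: off the closed support the
product vanishes locally, on it the derivative in the chart is continuous. So the derivatives become
globally defined continuous functions of `h`. -/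
theorem continuousAt_cutDeriv (hN : IsDomain k N) {χ : Tot m V → ℝ} (hχ : Continuous χ)
    {c c' : Tot m V} (hχ' : tsupport χ ⊆ chartDom k c') (l : ℕ) (h : Emb k N) {z : Tot m V}
    (hz : z ∈ interior N) (hc : z ∈ chartDom k c) :
    ContinuousAt (fun q : Emb k N × Tot m V => cutDeriv χ c c' l q.1 q.2) (h, z) := by
  have hmap : Tendsto (fun q : Emb k N × Tot m V => (q.1.1, q.2)) (𝓝 (h, z))
      (𝓝 h.1 ×ˢ 𝓝[N] z) := by
    rw [nhdsWithin_eq_nhds.2 (mem_interior_iff_mem_nhds.1 hz), nhds_prod_eq]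
    exact Tendsto.prodMap (continuous_subtype_val.tendsto h) tendsto_id
  have h0 : ContinuousAt (fun q : Emb k N × Tot m V => ext q.1 q.2) (h, z) :=
    (tendsto_ext hN h.1 (interior_subset hz)).comp hmap
  have h1 : ContinuousAt (fun q : Emb k N × Tot m V => χ (ext q.1 q.2)) (h, z) :=
    hχ.continuousAt.comp h0
  refine h1.prodMk ?_
  by_cases hs : ext h z ∈ tsupport χ
  · have h2 : ContinuousAt (fun q : Emb k N × Tot m V => chartDeriv k q.1 c c' l q.2) (h, z) :=
      Tendsto.comp (g := fun p : SmoothMap k N × Tot m V => chartDeriv k p.1.toFun c c' l p.2)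
        (f := fun q : Emb k N × Tot m V => (q.1.1, q.2))
        (tendsto_chartDeriv hN h.1 (interior_subset hz) hc (hχ' hs) l) hmap
    exact Tendsto.smul h1 h2
  · have h2 : ∀ᶠ q in 𝓝 (h, z), χ (ext q.1 q.2) = 0 :=
      (h0.eventually ((isClosed_tsupport χ).isOpen_compl.mem_nhds hs)).mono fun q hq =>
        image_eq_zero_of_notMem_tsupport hq
    have h3 : ∀ᶠ q in 𝓝 (h, z), χ (ext q.1 q.2) • chartDeriv k q.1 c c' l q.2 = 0 :=
      h2.mono fun q hq => by
        rw [hq]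
        exact zero_smul ℝ (chartDeriv k q.1 c c' l q.2)
    exact continuousAt_const.congr (h3.mono fun q hq => hq.symm)

/-- Where the cutoff does not vanish, the cut off derivatives determine the derivatives. -/
theorem famAt_of_continuous_cutDeriv {P : Type*} [TopologicalSpace P] {Φ : P → Emb k N}
    {K : Set (Tot m V)} {χ : Tot m V → ℝ} (hχ : Continuous χ) {c c' : Tot m V} (hKN : K ⊆ N)
    (hKc : K ⊆ chartDom k c) (hχ' : tsupport χ ⊆ chartDom k c')
    (h : ∀ l, Continuous fun q : P × K => cutDeriv χ c c' l (Φ q.1) q.2)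
    {p : P} {z : Tot m V} (hz : z ∈ interior K) (hp : χ (ext (Φ p) z) ≠ 0) :
    FamAt k (fun p => ext (Φ p)) p z := by
  have hcont : ∀ l p, ∀ z ∈ interior K,
      ContinuousAt (fun q : P × Tot m V => cutDeriv χ c c' l (Φ q.1) q.2) (p, z) := by
    intro l p z hz
    have h1 : ContinuousOn (fun q : P × Tot m V => cutDeriv χ c c' l (Φ q.1) q.2) (univ ×ˢ K) := by
      rw [continuousOn_iff_continuous_domRestrict]
      have h2 : Continuous fun w : (univ ×ˢ K : Set (P × Tot m V)) =>
          ((w.1.1, ⟨w.1.2, w.2.2⟩) : P × K) := by fun_prop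
      exact (h l).comp h2
    exact h1.continuousAt (prod_mem_nhds univ_mem (mem_interior_iff_mem_nhds.1 hz))
  set W : Set (Tot m V) := {w | χ w ≠ 0}
  have hWo : IsOpen W := isOpen_ne_fun hχ continuous_const
  have hWc : W ⊆ chartDom k c' := fun w hw => hχ' (subset_tsupport χ hw)
  have hval : ∀ p, ∀ z ∈ interior K,
      ContinuousAt (fun q : P × Tot m V => χ (ext (Φ q.1) q.2)) (p, z) :=
    fun p z hz => (hcont 0 p z hz).fst
  have hder : ∀ p, ∀ z ∈ interior K, ext (Φ p) z ∈ W → ∀ l,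
      ContinuousAt (fun q : P × Tot m V => chartDeriv k (Φ q.1) c c' l q.2) (p, z) := by
    intro p z hz hW l
    -- The value of the cutoff is the first entry of the cut off derivative, so it is continuous and
    -- can be divided out where it is nonzero.
    have h1 : ContinuousAt (fun q : P × Tot m V => (χ (ext (Φ q.1) q.2))⁻¹ •
        (χ (ext (Φ q.1) q.2) • chartDeriv k (Φ q.1) c c' l q.2)) (p, z) :=
      Tendsto.smul ((hval p z hz).inv₀ hW) (hcont l p z hz).snd
    refine h1.congr ?_
    filter_upwards [(hval p z hz).eventually_ne hW] with q hq
    exact inv_smul_smul₀ hq _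
  have hext : ∀ p, ∀ z ∈ interior K, ext (Φ p) z ∈ W →
      ContinuousAt (fun q : P × Tot m V => ext (Φ q.1) q.2) (p, z) := by
    intro p z hz hW
    refine continuousAt_of_coord (c := c') ((hval p z hz).eventually_ne hW |>.mono
      fun q hq => hWc hq) ?_
    have h1 := (continuousMultilinearCurryFin0 ℝ (Euc (k c.1) × Euc (m c.1))
      (Euc (k c'.1) × Euc (m c'.1))).continuous.continuousAt.comp (hder p z hz hW 0)
    refine h1.congr ?_
    have h2 : ContinuousAt (fun q : P × Tot m V => q.2) (p, z) := continuousAt_snd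
    filter_upwards [h2.eventually (isOpen_interior.mem_nhds hz)] with q hq
    exact (chartDeriv_zero _ c' (hKc (interior_subset hq))).symm
  have hc : z ∈ chartDom k c := hKc (interior_subset hz)
  exact FamAt.of_psAt (hext p z hz hp) hc (hWc hp) fun n =>
    famAt_of_tendsto (Φ := fun p => (Φ p).1) isOpen_interior (interior_subset.trans hKN) hWo hWc
      (fun p z hz _ hW l => hder p z hz hW l) (hext p z hz hp) hz hc hp n

end Total

universe u v w

/-! ### A pseudometrizable topology on the embeddings, and the radius function. -/

section Total

variable {ι : Type u} (k : ι → ℕ) {m : ι → ℕ} {B : ι → Type v}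
  [∀ i, TopologicalSpace (B i)] [∀ i, ChartedSpace (Euc (k i)) (B i)]
  {V : ∀ i, B i → Type w}
  [∀ i b, AddCommGroup (V i b)] [∀ i b, Module ℝ (V i b)] [∀ i b, TopologicalSpace (V i b)]
  [∀ i, TopologicalSpace (TotalSpace (Euc (m i)) (V i))]
  [∀ i, FiberBundle (Euc (m i)) (V i)] [∀ i, VectorBundle ℝ (Euc (m i)) (V i)]

variable {k}

variable [∀ i, IsManifold (𝓡 (k i)) ∞ (B i)]
  [∀ i, ContMDiffVectorBundle ∞ (Euc (m i)) (V i) (𝓡 (k i))] [Finite ι]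
  [∀ i, CompactSpace (B i)] [∀ i, T2Space (B i)]
  {N : Set (Tot m V)}

theorem isCompact_zeroSec (ξ : ∀ i, OrthogonalStructure (k i) (m i) (V i)) : IsCompact (zeroSec m V) := by
  have h := isCompact_nrm_le ξ 0
  convert h using 1
  ext z
  rw [mem_ofPred_eq, ← nrm_eq_zero_iff ξ]
  exact ⟨fun h => h.le, fun h => le_antisymm h (nrm_nonneg ξ z)⟩

/-- Finitely many charts of the total space, with cutoff functions that have no common zero. -/
theorem exists_cutoff (ξ : ∀ i, OrthogonalStructure (k i) (m i) (V i)) :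
    ∃ (s : Finset (Tot m V)) (χ : Tot m V → Tot m V → ℝ),
    (∀ c, Continuous (χ c)) ∧ (∀ c, tsupport (χ c) ⊆ chartDom k c) ∧ ∀ z, ∃ c ∈ s, χ c z ≠ 0 := by
  have : CompactSpace (zeroSec m V) := isCompact_iff_compactSpace.1 (isCompact_zeroSec ξ)
  have := t2Space_tot (m := m) (V := V) (B := B)
  obtain ⟨f, hf⟩ := PartitionOfUnity.exists_isSubordinate (X := zeroSec m V) isClosed_univ
    (fun c => Subtype.val ⁻¹' chartDom k c)
    (fun c => (isOpen_chartDom c).preimage continuous_subtype_val)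
    (fun z _ => mem_iUnion.2 ⟨z.1, mem_chartDom_self z.1⟩)
  have hpos : ∀ x, ∃ c, 0 < f c x := fun x => f.exists_pos (mem_univ x)
  obtain ⟨s, hs⟩ := isCompact_univ.elim_finite_subcover (fun c => {x | 0 < f c x})
    (fun c => isOpen_lt continuous_const (f c).continuous) fun x _ => mem_iUnion.2 (hpos x)
  -- The partition of unity lives on the compact zero section and is pulled back by the bundle
  -- projection; chart domains are unions of fibres, so the supports remain inside them.
  set r : Tot m V → zeroSec m V := fun z => ⟨scale 0 z, scale_zero_mem z⟩
  have hr : Continuous r :=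
    ((continuous_scale k).comp (Continuous.prodMk_right (0 : ℝ))).subtype_mk _
  refine ⟨s, fun c z => f c (r z), fun c => (f c).continuous.comp hr, fun c z hz => ?_,
    fun z => ?_⟩
  · exact scale_mem_chartDom.1 (hf c (tsupport_comp_subset_preimage (f c) hr hz))
  · obtain ⟨c, hc, hcz⟩ := mem_iUnion₂.1 (hs (mem_univ (r z)))
    exact ⟨c, hc, (ne_of_gt hcz)⟩

/-- The zero section is covered by the interiors of finitely many compact sets in charts. -/
theorem exists_compact_cover (ξ : ∀ i, OrthogonalStructure (k i) (m i) (V i))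
    (hN : IsDomain k N) (hB : zeroSec m V ⊆ interior N) :
    ∃ (t : Finset (Tot m V)) (K : Tot m V → Set (Tot m V)),
      (∀ c ∈ t, IsCompact (K c) ∧ K c ⊆ interior N ∩ chartDom k c) ∧
      zeroSec m V ⊆ ⋃ c ∈ t, interior (K c) := by
  have hK : ∀ c : Tot m V, ∃ K, c ∈ zeroSec m V →
      IsCompact K ∧ K ⊆ interior N ∩ chartDom k c ∧ K ∈ 𝓝 c := by
    intro c
    by_cases hc : c ∈ zeroSec m V
    · obtain ⟨K, h1, h2, h3⟩ := exists_isCompact_nhdsWithin hN c (interior_subset (hB hc))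
        (Filter.inter_mem (isOpen_interior.mem_nhds (hB hc))
          ((isOpen_chartDom (k := k) c).mem_nhds (mem_chartDom_self c)))
      rw [nhdsWithin_eq_nhds.2 (mem_interior_iff_mem_nhds.1 (hB hc))] at h3
      exact ⟨K, fun _ => ⟨h1, h2.trans inter_subset_right, h3⟩⟩
    · exact ⟨∅, fun h => absurd h hc⟩
  choose K hK using hK
  obtain ⟨t, ht, hcov⟩ := (isCompact_zeroSec ξ).elim_nhds_subcover (fun c => interior (K c))
    fun c hc => interior_mem_nhds.2 (hK c hc).2.2
  exact ⟨t, K, fun c hc => ⟨(hK c (ht c hc)).1, (hK c (ht c hc)).2.1⟩, hcov⟩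

/-- The embeddings form a continuous family, parametrically smooth near the zero section, over a
pseudometrizable space. -/
theorem exists_pseudoMetrizable_family (ξ : ∀ i, OrthogonalStructure (k i) (m i) (V i))
    (hN : IsDomain k N) (hB : zeroSec m V ⊆ interior N) :
    ∃ (P : Type (max u v w)) (_ : TopologicalSpace P) (_ : PseudoMetrizableSpace P) (s : Emb k N → P)
      (Φ : P → Emb k N), Continuous s ∧ (∀ h, Φ (s h) = h) ∧
      ∀ p, ∀ z ∈ zeroSec m V, FamAt k (fun p => ext (Φ p)) p z := by
  obtain ⟨s, χ, hχ, hχ', hχ0⟩ := exists_cutoff (V := V) ξ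
  obtain ⟨t, K, hK, hcov⟩ := exists_compact_cover ξ hN hB
  have := t2Space_tot (m := m) (V := V) (B := B)
  have hcomp : ∀ c : t, CompactSpace (K c) := fun c => isCompact_iff_compactSpace.1 (hK c c.2).1
  have hcont : ∀ (c : t) (c' : s) (l : ℕ), Continuous fun q : Emb k N × K c =>
      cutDeriv (χ c') c.1 c'.1 l q.1 q.2.1 := by
    intro c c' l
    refine continuous_iff_continuousAt.2 fun q => ?_
    have hq := (hK c c.2).2 q.2.2
    have h1 : ContinuousAt (fun q : Emb k N × K c => (q.1, q.2.1)) q := by fun_prop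
    exact ContinuousAt.comp
      (g := fun q : Emb k N × Tot m V => cutDeriv (χ c') c.1 c'.1 l q.1 q.2)
      (f := fun q : Emb k N × K c => (q.1, q.2.1))
      (continuousAt_cutDeriv hN (hχ c') (hχ' c') l q.1 hq.1 hq.2) h1
  -- One space of continuous functions, with its uniform metric, for each compact set, target chart
  -- and order of derivative. There are countably many, so the induced topology is pseudometrizable.
  let Y : t × s × ℕ → Type _ := fun α => C(K α.1, ℝ × ((Euc (k α.1.1.1) × Euc (m α.1.1.1))
    [×α.2.2]→L[ℝ] (Euc (k α.2.1.1.1) × Euc (m α.2.1.1.1))))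
  let instY : ∀ α, PseudoMetricSpace (Y α) := fun α =>
    have := hcomp α.1
    ContinuousMap.instPseudoMetricSpace _ _
  let J : ∀ α, Emb k N → Y α := fun α h =>
    ⟨fun z => cutDeriv (χ α.2.1) α.1.1 α.2.1.1 α.2.2 h z,
      (hcont α.1 α.2.1 α.2.2).comp (Continuous.prodMk_right h)⟩
  have hJ : ∀ α, Continuous (J α) := fun α =>
    ContinuousMap.continuous_of_continuous_uncurry _ (hcont α.1 α.2.1 α.2.2)
  refine ⟨InducedCopy J, inferInstance, inferInstance, InducedCopy.mk, InducedCopy.val,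
    InducedCopy.continuous_mk hJ, fun _ => rfl, fun p z hz => ?_⟩
  -- Near a given point of the zero section one source chart, and one target chart whose cutoff does
  -- not vanish at the image, suffice.
  obtain ⟨c, hc, hzc⟩ := mem_iUnion₂.1 (hcov hz)
  obtain ⟨c', hc', hne⟩ := hχ0 (ext p.val z)
  refine famAt_of_continuous_cutDeriv (K := K c) (hχ c') (c := c)
    ((hK c hc).2.trans (inter_subset_left.trans interior_subset))
    ((hK c hc).2.trans inter_subset_right) (hχ' c') (fun l => ?_) hzc hne
  have h1 := InducedCopy.continuous_apply (J := J) (⟨c, hc⟩, ⟨c', hc'⟩, l)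
  exact continuous_eval.comp ((h1.comp continuous_fst).prodMk continuous_snd)

/-- The radius is chosen on the pseudometrizable copy and pulled back by the continuous map from the
embeddings with the Whitney topology. -/
theorem exists_radius (ξ : ∀ i, OrthogonalStructure (k i) (m i) (V i))
    {a b : ℝ} {μ : ℝ → ℝ} (hN : IsDomain k N) (hB : zeroSec m V ⊆ interior N)
    (ha : 0 < a) (hμ : ContDiff ℝ ∞ μ) (hμ0 : ∀ s ∈ Icc 0 a, μ s = 0) :
    ∃ δ : Emb k N → ℝ, Continuous δ ∧
      ∀ h, 0 < δ h ∧ IsGoodRadius ξ b μ (interior N) N (ext h) (δ h) := by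
  obtain ⟨P, _, _, s, Φ, hs, hΦ, hF⟩ := exists_pseudoMetrizable_family ξ hN hB
  obtain ⟨δ, hδ, hδ'⟩ := exists_continuous_pos
    (C := fun p d => IsGoodRadius ξ b μ (interior N) N (ext (Φ p)) d) fun p =>
      eventually_isGoodRadius hB (isOpen_interior.mem_nhdsSet.2 hB) hF ha hμ hμ0 p
  refine ⟨fun h => δ (s h), hδ.comp hs, fun h => ?_⟩
  have h1 := hδ' (s h)
  rwa [hΦ] at h1

end Total

end LinEmb

end

theorem theorem1p1 {ι : Type*} [Finite ι] (k m : ι → ℕ)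
    (B : ι → Type*) [∀ i, TopologicalSpace (B i)] [∀ i, ChartedSpace (LinEmb.Euc (k i)) (B i)]
    [∀ i, IsManifold (𝓡 (k i)) ∞ (B i)] [∀ i, T2Space (B i)] [∀ i, CompactSpace (B i)]
    (V : ∀ i, B i → Type*)
    [∀ i b, AddCommGroup (V i b)] [∀ i b, Module ℝ (V i b)] [∀ i b, TopologicalSpace (V i b)]
    [∀ i, TopologicalSpace (TotalSpace (LinEmb.Euc (m i)) (V i))]
    [∀ i, FiberBundle (LinEmb.Euc (m i)) (V i)] [∀ i, VectorBundle ℝ (LinEmb.Euc (m i)) (V i)]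
    [∀ i, ContMDiffVectorBundle ∞ (LinEmb.Euc (m i)) (V i) (𝓡 (k i))]
    (ξ : ∀ i, LinEmb.OrthogonalStructure (k i) (m i) (V i))
    (a b : ℝ) (ha : 0 < a) (hab : a < b)
    (μ : ℝ → ℝ) (hμ : ContDiff ℝ ∞ μ) (hμ01 : ∀ s, μ s ∈ Icc (0 : ℝ) 1)
    (hμ0 : ∀ s ∈ Icc 0 a, μ s = 0) (hμ1 : ∀ s, b ≤ s → μ s = 1)
    (N : Set (LinEmb.Tot m V)) (hN : LinEmb.IsDomain k N) (hBN : N ∈ 𝓝ˢ (LinEmb.zeroSec m V)) :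
    ∃ δ : LinEmb.Emb k N → ℝ, Continuous δ ∧ (∀ h, 0 < δ h) ∧
      ∃ H : LinEmb.Emb k N × Icc (0 : ℝ) 1 → LinEmb.Emb k N, Continuous H ∧
        (∀ (h : LinEmb.Emb k N) (t : Icc (0 : ℝ) 1), 0 < (t : ℝ) → ∀ x : N,
          ∃ hx : LinEmb.scale (LinEmb.phi ξ μ (δ h) t x) x ∈ N,
            H (h, t) x = LinEmb.scale (LinEmb.phi ξ μ (δ h) t x)⁻¹ (h ⟨_, hx⟩)) ∧
        (∀ (h : LinEmb.Emb k N) (t : Icc (0 : ℝ) 1) (x : N),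
          b * δ h ≤ LinEmb.nrm ξ x.1 → H (h, t) x = h x) ∧
        (∀ (h : LinEmb.Emb k N) (t : Icc (0 : ℝ) 1) (x : LinEmb.Tot m V),
          LinEmb.nrm ξ x ≤ δ h → ∃ hx : x ∈ N, H (h, t) ⟨x, hx⟩ ∈ N) ∧
        (∀ (h : LinEmb.Emb k N) (x : LinEmb.Tot m V),
          LinEmb.nrm ξ x ≤ a * δ h → ∃ hx : x ∈ N, H (h, 0) ⟨x, hx⟩ = LinEmb.tfib (LinEmb.ext h) x) := by
  have hB : LinEmb.zeroSec m V ⊆ interior N := subset_interior_iff_mem_nhdsSet.2 hBN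
  obtain ⟨δ, hδ, hδ'⟩ := LinEmb.exists_radius (b := b) ξ hN hB ha hμ hμ0
  exact ⟨δ, hδ, fun h => (hδ' h).1, LinEmb.IsAdmissible.exists_isotopy
    ⟨hN, hB, ha, hab, hμ, hμ01, hμ0, hμ1, hδ, fun h => (hδ' h).1, fun h => (hδ' h).2⟩⟩
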